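/- **Setting.** All values come from a nonempty, totally and densely ordered set $\Delta$ without least or greatest element (such as $\mathbb Q$ or $\mathbb R$). An arithmetic comparison (AC) is $s\,\theta\,t$ with $\theta\in\{\le,<,=,\neq\}$ and $s,t$ variables or constants. A CQAC is a conjunctive query $h(\bar s)\text{ :- }e_1(\bar s_1),\dots,e_k(\bar s_k),\beta$ with a finite set $\beta$ of ACs; it is safe (each head variable and each variable of $\beta$ occurs in some $e_i(\bar s_i)$) and $\beta$ is satisfiable. A query in Datalog with ACs is a finite set of Datalog rules, each safe and with finitely many, jointly satisfiable ACs in its body, and a query predicate. The closure of a set of ACs is the set of ACs that it implies. A CQAC is *RSI1 with closed ACs* if each of its ACs is of the form $X\le c$ or $X\ge c$ ($X$ a variable, $c$ a constant), and at most one of them is of the form $X\ge c$. Let $\mathcal V=(V_1,\dots,V_n)$ be CQAC views over the base relations. $R$ is a *contained rewriting* of $Q$ using $\mathcal V$ if $R(\mathcal I)\subseteq Q(D)$ for every view instance $\mathcal I$ and every database $D$ with $\mathcal I\subseteq\mathcal V(D)$. The *AC-rectified* version of a CQAC rewriting $R$ is $R$ together with all ACs on its variables that lie in the closure of the ACs of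 its view-expansion (the ACs of $R$, the ACs of the views used in its subgoals, and the equations that unify each subgoal with the head of its view). **Algorithm MCR-RSI1.** Let $C$ be the set of constants of $Q$ and $\mathcal V$. 1. *CQ views.* $V_i^{CQ}$ has the head and the relational subgoals of $V_i$, a subgoal $U_{\theta c}(X)$ for each $X\,\theta\,c$ ($\theta\in\{\le,\ge\}$, $c\in C$) and a subgoal $U(X,Y)$ for each $X\le Y$ in the closure of the ACs of $V_i$. Add the auxiliary views $u_{\theta c}(X)\text{ :- }U_{\theta c}(X)$ ($c\in C$) and $u(X,Y)\text{ :- }U(X,Y)$. 2. *Datalog query.* $Q^{Datalog}$ has binary $U^{tr}$, and predicates $I_{\theta c},J_{\theta c}$ for the constants $c$ in the ACs of $Q$; these are unary for a Boolean $Q$, and in general carry the output tuple as additional arguments. $Q$ is put in normal form: each argument of a relational subgoal or of the head becomes a fresh variable $Z$, equated with the original term $t$ by $U^{tr}(Z,t),U^{tr}(t,Z)$. The rules are: * the query rule, in which each AC $X\,\theta\,c$ of $Q$ is replaced by $I_{\theta c}(X)$; * for each AC $X\,\theta\,c$ of $Q$ a mapping rule with head $J_{\theta c}(X)$, whose body is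 that of the query rule without this $I_{\theta c}(X)$; * for constants $c_1\le c_2$ in ACs of $Q$ the coupling rules $I_{\le c_2}(X)\text{ :- }J_{\ge c_1}(X)$; $I_{\ge c_1}(X)\text{ :- }J_{\le c_2}(X)$; $I_{\le c_2}(X)\text{ :- }J_{\ge c_1}(Y),U^{tr}(X,Y)$; $I_{\ge c_1}(X)\text{ :- }J_{\le c_2}(Y),U^{tr}(Y,X)$; * for $c\in C$ and $c_1$ in an AC of $Q$ the link rules $I_{\theta c_1}(X)\text{ :- }U_{\theta c}(X)$ whenever $X\,\theta\,c$ implies $X\,\theta\,c_1$, and the rules $J_{\ge c_1}(X)\text{ :- }U_{\le c}(Y),U^{tr}(X,Y)$ if $c\le c_1$, and $J_{\le c_1}(X)\text{ :- }U_{\ge c}(Y),U^{tr}(Y,X)$ if $c_1\le c$ (output variables that these rules leave unbound are bound by subgoals $U^{tr}(O,O)$); * $U^{tr}(X,Y)\text{ :- }U(X,Y)$; $U^{tr}(X,Y)\text{ :- }U(X,Z),U^{tr}(Z,Y)$; and $U^{tr}(X,Y)\text{ :- }U_{\le c}(X),U_{\ge c'}(Z),U^{tr}(Z,Y)$ for $c\le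 c'$ in $C$. 3. *Inverse rules.* Apply the inverse-rules algorithm to $Q^{Datalog}$ and the views of step 1: invert the views with Skolem functions for their existential variables, add the rules of $Q^{Datalog}$, and eliminate the function symbols by splitting predicates. 4. *Reverse transformation.* In the resulting program replace each $v_i^{CQ}$ by $v_i$, each $u_{\theta c}(s)$ by $s\,\theta\,c$ and each $u(s,t)$ by $s\le t$. The arguments $s,t$ of the replaced atoms are restricted to the active domain (the values in the view instance, and $C$), which is defined by additional rules. The result is $R_{MCR}$. **Theorem.** Let $Q$ be a CQAC that is RSI1 with closed ACs and let $\mathcal V$ be any finite family of CQAC views. Then the program $R_{MCR}$ produced by Algorithm MCR-RSI1 is a maximally contained rewriting of $Q$ using $\mathcal V$ in the language of Datalog with ACs. That is: * $R_{MCR}$ is a query in Datalog with ACs in terms of the views, and it is a contained rewriting of $Q$ using $\mathcal V$; * for every contained rewriting $P$ of $Q$ using $\mathcal V$ in Datalog with ACs, $P(\mathcal I)\subseteq R_{MCR}(\mathcal I)$ for every view instance $\mathcal I$ such that $\mathcal I\subseteq\mathcal V(D)$ for some database $D$; * for every CQAC contained rewriting $R$ of $Q$ using $\mathcal V$, the AC-rectified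 version of $R$ is contained in $R_{MCR}$, on all view instances. -/

import Mathlib

/-! ### Queries with arithmetic comparisons -/

/-- A term: a variable or a constant of the ordered domain `α`. -/
inductive Term (X α : Type) where
  | var (x : X)
  | const (c : α)
  deriving DecidableEq

namespace Term

variable {X Y α : Type}

def eval (h : X → α) : Term X α → α
  | var x => h x
  | const c => c

def rename (f : X → Y) : Term X α → Term Y α
  | var x => var (f x)
  | const c => const c

def vars : Term X α → List X
  | var x => [x]
  | const _ => []

def consts : Term X α → List α
  | var _ => []
  | const c => [c]

end Term

/-- A relational atom. -/
structure Atom (P X α : Type) where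
  pred : P
  args : List (Term X α)

namespace Atom

variable {P X Y α : Type}

def rename (f : X → Y) (a : Atom P X α) : Atom P Y α := ⟨a.pred, a.args.map (Term.rename f)⟩

def vars (a : Atom P X α) : List X := a.args.flatMap Term.vars

def consts (a : Atom P X α) : List α := a.args.flatMap Term.consts

end Atom

/-- The comparison symbols; `s ≥ t` and `s > t` are written `t ≤ s` and `t < s`. -/
inductive CmpOp where
  | le | lt | eq | ne

/-- An arithmetic comparison (AC) `lhs op rhs`. -/
structure AC (X α : Type) where
  lhs : Term X α
  op : CmpOp
  rhs : Term X α

namespace AC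

variable {X Y α : Type}

def rename (f : X → Y) (a : AC X α) : AC Y α := ⟨a.lhs.rename f, a.op, a.rhs.rename f⟩

def vars (a : AC X α) : List X := a.lhs.vars ++ a.rhs.vars

def consts (a : AC X α) : List α := a.lhs.consts ++ a.rhs.consts

def Holds [LinearOrder α] (h : X → α) (a : AC X α) : Prop :=
  match a.op with
  | .le => a.lhs.eval h ≤ a.rhs.eval h
  | .lt => a.lhs.eval h < a.rhs.eval h
  | .eq => a.lhs.eval h = a.rhs.eval h
  | .ne => a.lhs.eval h ≠ a.rhs.eval h

/-- The set `β` of ACs is not contradictory. -/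
def Consistent [LinearOrder α] (β : List (AC X α)) : Prop :=
  ∃ h : X → α, ∀ a ∈ β, a.Holds h

/-- `a` belongs to the closure of `β`, i.e. `β` logically implies `a`. -/
def Implies [LinearOrder α] (β : List (AC X α)) (a : AC X α) : Prop :=
  ∀ h : X → α, (∀ b ∈ β, b.Holds h) → a.Holds h

end AC

/-- A conjunctive query (CQ); the head is given by its tuple of terms. -/
structure CQ (P X α : Type) where
  head : List (Term X α)
  body : List (Atom P X α)

/-- A conjunctive query with arithmetic comparisons (CQAC). -/
structure CQAC (P X α : Type) extends CQ P X α where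
  acs : List (AC X α)

/-- A (database or view) instance: a set of facts `(predicate, tuple)`. -/
abbrev Instance (P α : Type) := Set (P × List α)

namespace CQAC

variable {P X α : Type}

/-- The variables of the relational subgoals. -/
def bodyVars (Q : CQAC P X α) : List X := Q.body.flatMap Atom.vars

def consts (Q : CQAC P X α) : List α :=
  Q.head.flatMap Term.consts ++ Q.body.flatMap Atom.consts ++ Q.acs.flatMap AC.consts

/-- The standing assumptions on CQACs: the query is safe, its comparisons are safe,
and its comparisons are not contradictory. -/
structure WellFormed [LinearOrder α] (Q : CQAC P X α) : Prop where
  safe_head : ∀ t ∈ Q.head, ∀ x ∈ t.vars, x ∈ Q.bodyVars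
  safe_acs : ∀ a ∈ Q.acs, ∀ x ∈ a.vars, x ∈ Q.bodyVars
  consistent : AC.Consistent Q.acs

/-- The answer `Q(D)`. -/
def eval [LinearOrder α] (Q : CQAC P X α) (D : Instance P α) : Set (List α) :=
  {t | ∃ h : X → α, (∀ a ∈ Q.body, (a.pred, a.args.map (Term.eval h)) ∈ D) ∧
    (∀ a ∈ Q.acs, a.Holds h) ∧ t = Q.head.map (Term.eval h)}

end CQAC

/-! ### Datalog, without and with arithmetic comparisons -/

/-- A Datalog rule with EDB predicates `E` and IDB predicates `I`. -/
structure Rule (E I X α : Type) where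
  head : Atom I X α
  body : List (Atom (E ⊕ I) X α)

/-- A Datalog query: finitely many rules and a query predicate. -/
structure Datalog (E I X α : Type) where
  rules : List (Rule E I X α)
  query : I

/-- A Datalog rule with arithmetic comparisons. -/
structure RuleAC (E I X α : Type) extends Rule E I X α where
  acs : List (AC X α)

/-- A Datalog query with arithmetic comparisons. -/
structure DatalogAC (E I X α : Type) where
  rules : List (RuleAC E I X α)
  query : I

/-- As every rule is a CQAC, it is safe, its comparisons are safe and not contradictory. -/
structure RuleAC.WellFormed {E I X α : Type} [LinearOrder α] (r : RuleAC E I X α) : Prop where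
  safe_head : ∀ x ∈ r.head.vars, x ∈ r.body.flatMap Atom.vars
  safe_acs : ∀ a ∈ r.acs, ∀ x ∈ a.vars, x ∈ r.body.flatMap Atom.vars
  consistent : AC.Consistent r.acs

namespace DatalogAC

variable {E I X α : Type} [LinearOrder α]

/-- `P.Derives D i t`: the fact `i(t)` is obtained by firing the rules of `P` on `D`. -/
inductive Derives (P : DatalogAC E I X α) (D : Instance E α) : I → List α → Prop where
  | fire (r : RuleAC E I X α) (hr : r ∈ P.rules) (h : X → α)
      (hE : ∀ e args, (⟨Sum.inl e, args⟩ : Atom (E ⊕ I) X α) ∈ r.body →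
        (e, args.map (Term.eval h)) ∈ D)
      (hI : ∀ i args, (⟨Sum.inr i, args⟩ : Atom (E ⊕ I) X α) ∈ r.body →
        Derives P D i (args.map (Term.eval h)))
      (hAC : ∀ a ∈ r.acs, a.Holds h) :
      Derives P D r.head.pred (r.head.args.map (Term.eval h))

/-- The answer of a Datalog query with ACs. -/
def eval (P : DatalogAC E I X α) (D : Instance E α) : Set (List α) :=
  {t | P.Derives D P.query t}

end DatalogAC

/-! ### Views and rewritings -/

section Views

variable {B I X α : Type} [LinearOrder α] {n : ℕ}

/-- The output `V(D)` of the views on the database `D`. -/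
def viewOutput (V : Fin n → CQAC B ℕ α) (D : Instance B α) : Instance (Fin n) α :=
  {f | f.2 ∈ (V f.1).eval D}

/-- Contained rewriting under the open world assumption, for a rewriting given by the function `R`
that it computes on view instances. -/
def IsContainedRewriting (V : Fin n → CQAC B ℕ α) (Q : CQAC B ℕ α)
    (R : Instance (Fin n) α → Set (List α)) : Prop :=
  ∀ (J : Instance (Fin n) α) (D : Instance B α), J ⊆ viewOutput V D → R J ⊆ Q.eval D

/-- `R` is a CQAC in terms of the views: it is well formed and gives each view its arity. -/
def IsCQACRewriting (V : Fin n → CQAC B ℕ α) (R : CQAC (Fin n) ℕ α) : Prop :=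
  R.WellFormed ∧ ∀ a ∈ R.body, a.args.length = (V a.pred).head.length

/-- `P` is a Datalog query with ACs in terms of the views. -/
def IsDatalogACRewriting (V : Fin n → CQAC B ℕ α) (P : DatalogAC (Fin n) I X α) : Prop :=
  ∀ r ∈ P.rules, r.WellFormed ∧
    ∀ i args, (⟨Sum.inl i, args⟩ : Atom (Fin n ⊕ I) X α) ∈ r.body →
      args.length = (V i).head.length

/-- The view-expansion of `R`. The variable `x` of the view used in the `k`-th subgoal becomes
`Sum.inr (k, x)`; the unification of a subgoal with the head of its view is expressed by equations. -/
def viewExpansion (V : Fin n → CQAC B ℕ α) (R : CQAC (Fin n) ℕ α) :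
    CQAC B (ℕ ⊕ ℕ × ℕ) α where
  head := R.head.map (Term.rename Sum.inl)
  body := R.body.zipIdx.flatMap fun p =>
    (V p.1.pred).body.map (Atom.rename fun x => Sum.inr (p.2, x))
  acs := R.acs.map (AC.rename Sum.inl) ++ R.body.zipIdx.flatMap fun p =>
    (V p.1.pred).acs.map (AC.rename fun x => Sum.inr (p.2, x)) ++
    List.zipWith (fun s t => ⟨s.rename Sum.inl, CmpOp.eq, t.rename fun x => Sum.inr (p.2, x)⟩)
      p.1.args (V p.1.pred).head

/-- The answer of the AC-rectified version of `R`: all ACs on the variables of `R` that are in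
the closure of the ACs of the view-expansion are added to `R`. -/
def rectifiedEval (V : Fin n → CQAC B ℕ α) (R : CQAC (Fin n) ℕ α) (J : Instance (Fin n) α) :
    Set (List α) :=
  {t | ∃ h : ℕ → α, (∀ a ∈ R.body, (a.pred, a.args.map (Term.eval h)) ∈ J) ∧
    (∀ a ∈ R.acs, a.Holds h) ∧
    (∀ a : AC ℕ α, AC.Implies (viewExpansion V R).acs (a.rename Sum.inl) → a.Holds h) ∧
    t = R.head.map (Term.eval h)}

end Views

/-! ### RSI1 queries -/

/-- The two kinds of closed semi-interval comparisons: `X ≤ c` (left) and `X ≥ c` (right). -/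
inductive Dir where
  | le | ge
  deriving DecidableEq

/-- A closed semi-interval AC `X θ c`. -/
structure SI (X α : Type) where
  var : X
  dir : Dir
  const : α

/-- Reads an AC as a closed semi-interval AC, if it is one. -/
def AC.toSI? {X α : Type} : AC X α → Option (SI X α)
  | ⟨.var x, .le, .const c⟩ => some ⟨x, .le, c⟩
  | ⟨.const c, .le, .var x⟩ => some ⟨x, .ge, c⟩
  | _ => none

/-- The closed semi-interval ACs of a query. -/
def CQAC.sis {P X α : Type} (Q : CQAC P X α) : List (SI X α) := Q.acs.filterMap AC.toSI?

/-- RSI1 query with closed ACs: all ACs are closed semi-intervals, (at most) one of them is a right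
one. -/
def CQAC.IsClosedRSI1 {P X α : Type} (Q : CQAC P X α) : Prop :=
  (∀ a ∈ Q.acs, a.toSI?.isSome) ∧ (Q.sis.filter fun s => s.dir = Dir.ge).length ≤ 1

/-! ### The vocabulary of the transformed views and query -/

/-- Base predicates together with the AC-predicates `U` and `U_{θ c}`. -/
inductive ExtPred (B α : Type) where
  | base (b : B)
  | U
  | Usi (θ : Dir) (c : α)

/-- The IDB predicates of the transformed query. -/
inductive QIdb (α : Type) where
  | Utr
  | I (θ : Dir) (c : α)
  | J (θ : Dir) (c : α)
  | query

/-- Variables of the transformed query and views: an original variable, the fresh variable for the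
`j`-th argument of the `k`-th relational subgoal, the `i`-th output variable, auxiliary variables. -/
inductive QVar where
  | orig (x : ℕ)
  | occ (k j : ℕ)
  | out (i : ℕ)
  | aux (m : ℕ)
  deriving DecidableEq

/-- Names of the transformed views: one for each view, and the auxiliary views. -/
inductive CQViewName (n : ℕ) (α : Type) where
  | view (i : Fin n)
  | u
  | usi (θ : Dir) (c : α)

section Transform

variable {B α : Type} [LinearOrder α] {n : ℕ}

/-- The constants that occur in the query or in the views. -/
def relevantConsts (Q : CQAC B ℕ α) (V : Fin n → CQAC B ℕ α) : List α :=
  Q.consts ++ (List.finRange n).flatMap fun i => (V i).consts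

/-- The AC `x θ c`. -/
def siAC {X : Type} (θ : Dir) (x : Term X α) (c : α) : AC X α :=
  match θ with
  | .le => ⟨x, .le, .const c⟩
  | .ge => ⟨.const c, .le, x⟩

open Classical in
/-- The CQ transformation of a CQAC: the relational subgoals, `U_{θ c}(X)` for each `X θ c` in the
closure of the ACs (`c` among the constants `C`), and `U(X, Y)` for each `X ≤ Y` in the closure. -/
noncomputable def cqTransform (C : List α) (Q : CQAC B ℕ α) : CQ (ExtPred B α) QVar α where
  head := Q.head.map (Term.rename QVar.orig)
  body :=
    (Q.body.map fun a => ⟨.base a.pred, a.args.map (Term.rename QVar.orig)⟩) ++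
    (Q.bodyVars.flatMap fun x => [Dir.le, Dir.ge].flatMap fun θ =>
      (C.filter fun c => AC.Implies Q.acs (siAC θ (.var x) c)).map fun c =>
        ⟨.Usi θ c, [.var (.orig x)]⟩) ++
    (Q.bodyVars.flatMap fun x =>
      (Q.bodyVars.filter fun y => AC.Implies Q.acs ⟨.var x, .le, .var y⟩).map fun y =>
        ⟨.U, [.var (.orig x), .var (.orig y)]⟩)

/-- The definitions of the transformed views and of the auxiliary views `u_{θ c}` and `u`. -/
noncomputable def cqViews (C : List α) (V : Fin n → CQAC B ℕ α) :
    CQViewName n α → CQ (ExtPred B α) QVar α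
  | .view i => cqTransform C (V i)
  | .u => ⟨[.var (.aux 0), .var (.aux 1)], [⟨.U, [.var (.aux 0), .var (.aux 1)]⟩]⟩
  | .usi θ c => ⟨[.var (.aux 0)], [⟨.Usi θ c, [.var (.aux 0)]⟩]⟩

/-- The (finitely many) transformed views. -/
def cqViewNames (C : List α) (n : ℕ) : List (CQViewName n α) :=
  (List.finRange n).map .view ++ [.u] ++ C.map (.usi .le) ++ C.map (.usi .ge)

/-! #### The Datalog query -/

abbrev QAtom (B α : Type) := Atom (ExtPred B α ⊕ QIdb α) QVar α
abbrev QRule (B α : Type) := Rule (ExtPred B α) (QIdb α) QVar α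

def utrAtom (s t : Term QVar α) : QAtom B α := ⟨.inr .Utr, [s, t]⟩

/-- The equation `s = t`, in the form `s ≤ t`, `t ≤ s`. -/
def eqAtoms (s t : Term QVar α) : List (QAtom B α) := [utrAtom s t, utrAtom t s]

/-- The relational part of the query in normal form: each argument of a relational subgoal and of
the head is a fresh variable, which is equated with the original term. -/
def coreBody (Q : CQAC B ℕ α) : List (QAtom B α) :=
  (Q.body.zipIdx.flatMap fun p =>
    (⟨.inl (.base p.1.pred), p.1.args.zipIdx.map fun q => .var (.occ p.2 q.2)⟩ : QAtom B α) ::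
    p.1.args.zipIdx.flatMap fun q => eqAtoms (.var (.occ p.2 q.2)) (q.1.rename .orig)) ++
  Q.head.zipIdx.flatMap fun q => eqAtoms (.var (.out q.2)) (q.1.rename .orig)

/-- The output tuple; it is empty for a Boolean query. -/
def outs (Q : CQAC B ℕ α) : List (Term QVar α) :=
  (List.range Q.head.length).map fun i => .var (.out i)

/-- `I_{θ c}(x)`. For a query with head variables all `I` and `J` atoms carry the output tuple. -/
def iAtom (Q : CQAC B ℕ α) (θ : Dir) (c : α) (x : Term QVar α) : Atom (QIdb α) QVar α :=
  ⟨.I θ c, x :: outs Q⟩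

/-- `J_{θ c}(x)`. -/
def jAtom (Q : CQAC B ℕ α) (θ : Dir) (c : α) (x : Term QVar α) : Atom (QIdb α) QVar α :=
  ⟨.J θ c, x :: outs Q⟩

/-- An IDB atom as a subgoal. -/
def asSubgoal (a : Atom (QIdb α) QVar α) : QAtom B α := ⟨.inr a.pred, a.args⟩

/-- The `I`-atom associated with an SI. -/
def siSubgoal (Q : CQAC B ℕ α) (s : SI ℕ α) : QAtom B α :=
  asSubgoal (iAtom Q s.dir s.const (.var (.orig s.var)))

def queryRule (Q : CQAC B ℕ α) : QRule B α :=
  ⟨⟨.query, outs Q⟩, coreBody Q ++ Q.sis.map (siSubgoal Q)⟩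

/-- One mapping rule for each SI of the query. -/
def mappingRules (Q : CQAC B ℕ α) : List (QRule B α) :=
  Q.sis.zipIdx.map fun p =>
    ⟨jAtom Q p.1.dir p.1.const (.var (.orig p.1.var)),
      coreBody Q ++ (Q.sis.eraseIdx p.2).map (siSubgoal Q)⟩

/-- The constants in the ACs of the query. -/
def siConsts (Q : CQAC B ℕ α) : List α := Q.sis.map SI.const

/-- Pairs `c₁ ≤ c₂` with `c₁` in the first list and `c₂` in the second. -/
def lePairs (C₁ C₂ : List α) : List (α × α) := (C₁ ×ˢ C₂).filter fun p => p.1 ≤ p.2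

def vX : Term QVar α := .var (.aux 0)
def vY : Term QVar α := .var (.aux 1)
def vZ : Term QVar α := .var (.aux 2)

/-- Coupling rules of the first and of the second kind. -/
def couplingRules (Q : CQAC B ℕ α) : List (QRule B α) :=
  (lePairs (siConsts Q) (siConsts Q)).flatMap fun p =>
    [⟨iAtom Q .le p.2 vX, [asSubgoal (jAtom Q .ge p.1 vX)]⟩,
     ⟨iAtom Q .ge p.1 vX, [asSubgoal (jAtom Q .le p.2 vX)]⟩,
     ⟨iAtom Q .le p.2 vX, [asSubgoal (jAtom Q .ge p.1 vY), utrAtom vX vY]⟩,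
     ⟨iAtom Q .ge p.1 vX, [asSubgoal (jAtom Q .le p.2 vY), utrAtom vY vX]⟩]

/-- Subgoals that bind the output variables (none for a Boolean query). -/
def guards (Q : CQAC B ℕ α) : List (QAtom B α) := (outs Q).map fun o => utrAtom o o

/-- Link rules. -/
def linkRules (C : List α) (Q : CQAC B ℕ α) : List (QRule B α) :=
  ((lePairs C (siConsts Q)).map fun p =>
    ⟨iAtom Q .le p.2 vX, ⟨.inl (.Usi .le p.1), [vX]⟩ :: guards Q⟩) ++
  ((lePairs (siConsts Q) C).map fun p =>
    ⟨iAtom Q .ge p.1 vX, ⟨.inl (.Usi .ge p.2), [vX]⟩ :: guards Q⟩)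

/-- Rules for the transitive closure of `≤`, also through constants. -/
def transitiveRules (C : List α) : List (QRule B α) :=
  [⟨⟨.Utr, [vX, vY]⟩, [⟨.inl .U, [vX, vY]⟩]⟩,
   ⟨⟨.Utr, [vX, vY]⟩, [⟨.inl .U, [vX, vZ]⟩, utrAtom vZ vY]⟩] ++
  (lePairs C C).map fun p =>
    ⟨⟨.Utr, [vX, vY]⟩,
      [⟨.inl (.Usi .le p.1), [vX]⟩, ⟨.inl (.Usi .ge p.2), [vZ]⟩, utrAtom vZ vY]⟩

/-- Rules that combine the transitive closure with SIs: `J_{≥ c₁}(X) :- U_{≤ c₂}(Y), U^tr(X, Y)` for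
`c₂ ≤ c₁`, and `J_{≤ c₁}(X) :- U_{≥ c₂}(Y), U^tr(Y, X)` for `c₁ ≤ c₂`. -/
def transitiveSIRules (C : List α) (Q : CQAC B ℕ α) : List (QRule B α) :=
  ((lePairs C (siConsts Q)).map fun p =>
    ⟨jAtom Q .ge p.2 vX, ⟨.inl (.Usi .le p.1), [vY]⟩ :: utrAtom vX vY :: guards Q⟩) ++
  ((lePairs (siConsts Q) C).map fun p =>
    ⟨jAtom Q .le p.1 vX, ⟨.inl (.Usi .ge p.2), [vY]⟩ :: utrAtom vY vX :: guards Q⟩)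

/-- The Datalog query `Q^Datalog`. -/
def queryDatalog (C : List α) (Q : CQAC B ℕ α) : Datalog (ExtPred B α) (QIdb α) QVar α where
  rules := queryRule Q :: mappingRules Q ++ couplingRules Q ++ linkRules C Q ++
    transitiveRules C ++ transitiveSIRules C Q
  query := .query

end Transform

/-! ### The inverse-rules algorithm -/

/-- Terms of a logic program whose function symbols `F` are applied to function-free terms. -/
inductive FTerm (F X α : Type) where
  | term (t : Term X α)
  | app (f : F) (args : List (Term X α))

/-- A rule whose head may contain function symbols. -/
structure FRule (W J F X α : Type) where
  headPred : J
  headArgs : List (FTerm F X α)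
  body : List (Atom (W ⊕ J) X α)

section InverseRules

variable {W E I J F X α : Type} [DecidableEq X] [DecidableEq α]

/-- An argument of a subgoal of the view `w` in the head of an inverse rule: an existential variable
`x` is replaced by the Skolem term `f_{w,x}(head of w)`. -/
def inverseTerm (def_ : W → CQ E X α) (w : W) : Term X α → FTerm (W × X) X α
  | .const c => .term (.const c)
  | .var x => if .var x ∈ (def_ w).head then .term (.var x) else .app (w, x) (def_ w).head

/-- The inverse rules of the view `w`. -/
def inverseRules (def_ : W → CQ E X α) (w : W) : List (FRule W (E ⊕ I) (W × X) X α) :=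
  (def_ w).body.map fun a =>
    ⟨.inl a.pred, a.args.map (inverseTerm def_ w), [⟨.inl w, (def_ w).head⟩]⟩

/-- A rule of the query, with all its predicates as IDB predicates. -/
def Rule.toFRule (r : Rule E I X α) : FRule W (E ⊕ I) (W × X) X α :=
  ⟨.inr r.head.pred, r.head.args.map .term, r.body.map fun a => ⟨.inr a.pred, a.args⟩⟩

/-- The logic program: the inverse rules of the views, and the rules of the query. -/
def inverseProgram (ws : List W) (def_ : W → CQ E X α) (P : Datalog E I X α) :
    List (FRule W (E ⊕ I) (W × X) X α) :=
  ws.flatMap (inverseRules def_) ++ P.rules.map Rule.toFRule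

/-! Elimination of the function symbols. A variable `x` with tag `σ x = some f` stands for a term
`f(x₀, …, x_{k-1})`, where `k` is the arity of `f`, and a variable with tag `none` for a constant. A
predicate is split according to the tags of its arguments. -/

def splitTerm (ar : F → ℕ) (σ : X → Option F) : Term X α → List (Term (X × ℕ) α)
  | .const c => [.const c]
  | .var x =>
    match σ x with
    | none => [.var (x, 0)]
    | some f => (List.range (ar f)).map fun j => .var (x, j)

def tagTerm (σ : X → Option F) : Term X α → Option F
  | .const _ => none
  | .var x => σ x

def splitFTerm (ar : F → ℕ) (σ : X → Option F) : FTerm F X α → List (Term (X × ℕ) α)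
  | .term t => splitTerm ar σ t
  | .app _ args => args.flatMap (splitTerm ar σ)

def tagFTerm (σ : X → Option F) : FTerm F X α → Option F
  | .term t => tagTerm σ t
  | .app f _ => some f

def splitAtom (ar : F → ℕ) (σ : X → Option F) (a : Atom (W ⊕ J) X α) :
    Atom (W ⊕ J × List (Option F)) (X × ℕ) α :=
  ⟨match a.pred with
    | .inl w => .inl w
    | .inr j => .inr (j, a.args.map (tagTerm σ)),
   a.args.flatMap (splitTerm ar σ)⟩

def splitRule (ar : F → ℕ) (σ : X → Option F) (r : FRule W J F X α) :
    Rule W (J × List (Option F)) (X × ℕ) α :=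
  ⟨⟨(r.headPred, r.headArgs.map (tagFTerm σ)), r.headArgs.flatMap (splitFTerm ar σ)⟩,
   r.body.map (splitAtom ar σ)⟩

/-- Variables that can only stand for constants: those in EDB subgoals or below a function symbol. -/
def FRule.constVars (r : FRule W J F X α) : List X :=
  (r.body.flatMap fun a => if a.pred.isLeft then a.vars else []) ++
  r.headArgs.flatMap fun
    | .term _ => []
    | .app _ args => args.flatMap Term.vars

/-- The variables of the rule that may stand for a function term. -/
def FRule.freeVars (r : FRule W J F X α) : List X :=
  ((r.body.flatMap Atom.vars).filter fun x => x ∉ r.constVars).dedup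

/-- All assignments of tags to the variables in `xs`; all other variables have the tag `none`. -/
def tagAssignments (fs : List F) (xs : List X) : List (X → Option F) :=
  (xs.map fun x => (none :: fs.map some).map fun o => (x, o)).sections.map fun l x =>
    (l.lookup x).getD none

/-- The function-free program, whose query predicate returns tuples of `k` constants. -/
def eliminateFunctions (fs : List F) (ar : F → ℕ) (rules : List (FRule W J F X α))
    (query : J) (k : ℕ) : Datalog W (J × List (Option F)) (X × ℕ) α where
  rules := rules.flatMap fun r =>
    (tagAssignments fs r.freeVars).map fun σ => splitRule ar σ r
  query := (query, List.replicate k none)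

/-- The inverse-rules algorithm for the Datalog query `P` of arity `k` and the CQ views `ws`. -/
def inverseRulesMCR (ws : List W) (def_ : W → CQ E X α) (P : Datalog E I X α) (k : ℕ) :
    Datalog W ((E ⊕ I) × List (Option (W × X))) (X × ℕ) α :=
  eliminateFunctions
    (ws.flatMap fun w => (((def_ w).body.flatMap Atom.vars).filter fun x =>
      .var x ∉ (def_ w).head).dedup.map fun x => (w, x))
    (fun f => (def_ f.1).head.length)
    (inverseProgram ws def_ P) (.inr P.query) k

end InverseRules

/-! ### The reverse transformation -/

/-- IDB predicates of the rewriting: those of the program before the reverse transformation, and the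
active domain, which makes the rules safe. -/
inductive RIdb (J : Type) where
  | adom
  | idb (j : J)

section Reverse

variable {B J Y α : Type} [LinearOrder α] {n : ℕ}

def adomAtom (t : Term Y α) : Atom (Fin n ⊕ RIdb J) Y α := ⟨.inr .adom, [t]⟩

/-- The subgoals that replace a subgoal. -/
def reverseAtom (a : Atom (CQViewName n α ⊕ J) Y α) : List (Atom (Fin n ⊕ RIdb J) Y α) :=
  match a.pred with
  | .inl (.view i) => [⟨.inl i, a.args⟩]
  | .inl .u => a.args.map adomAtom
  | .inl (.usi _ _) => a.args.map adomAtom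
  | .inr j => [⟨.inr (.idb j), a.args⟩]

/-- The ACs that replace a subgoal: `s ≤ t` for `u(s, t)`, and `s θ c` for `u_{θ c}(s)`. -/
def reverseACs (a : Atom (CQViewName n α ⊕ J) Y α) : List (AC Y α) :=
  match a.pred, a.args with
  | .inl .u, [s, t] => [⟨s, .le, t⟩]
  | .inl (.usi θ c), [s] => [siAC θ s c]
  | _, _ => []

def reverseRule (r : Rule (CQViewName n α) J Y α) : RuleAC (Fin n) (RIdb J) Y α where
  head := ⟨.idb r.head.pred, r.head.args⟩
  body := r.body.flatMap reverseAtom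
  acs := r.body.flatMap reverseACs

/-- The active domain: the constants `C` and the values in the view instance. -/
def adomRules (C : List α) (V : Fin n → CQAC B ℕ α) (fresh : ℕ → Y) :
    List (RuleAC (Fin n) (RIdb J) Y α) :=
  (C.map fun c => ⟨⟨⟨.adom, [.const c]⟩, []⟩, []⟩) ++
  (List.finRange n).flatMap fun i => (List.range (V i).head.length).map fun j =>
    ⟨⟨⟨.adom, [.var (fresh j)]⟩,
      [⟨.inl i, (List.range (V i).head.length).map fun m => .var (fresh m)⟩]⟩, []⟩

def reverseTransform (C : List α) (V : Fin n → CQAC B ℕ α) (fresh : ℕ → Y)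
    (P : Datalog (CQViewName n α) J Y α) : DatalogAC (Fin n) (RIdb J) Y α where
  rules := P.rules.map reverseRule ++ adomRules C V fresh
  query := .idb P.query

end Reverse

/-- Algorithm MCR-RSI1. -/
noncomputable def mcrRSI1 {B α : Type} [LinearOrder α] {n : ℕ}
    (Q : CQAC B ℕ α) (V : Fin n → CQAC B ℕ α) :
    DatalogAC (Fin n)
      (RIdb ((ExtPred B α ⊕ QIdb α) × List (Option (CQViewName n α × QVar)))) (QVar × ℕ) α :=
  let C := relevantConsts Q V
  reverseTransform C V (fun m => (.aux m, 0))
    (inverseRulesMCR (cqViewNames C n) (cqViews C V) (queryDatalog C Q) Q.head.length)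

/-!
The rewriting is analysed through the logic program of the inverse rules and the rules of the
Datalog query, whose facts are about ground terms: constants and Skolem terms. The program without
function symbols encodes the facts of its least model over the view instance, where the auxiliary
views `u` and `u_{θ c}` are read off the order of the active domain (`decodedFact_of_derives`,
`derives_of_modelDerives`).

*Containment.* If the view instance comes from a database `D`, each Skolem term has a value in
`D`. For these values `I_{θ c}(x)` means that `x θ c` holds or the output tuple is an answer on
`D`, and `J_{θ c}(x)` means that the complementary comparison, up to equality, holds or the output
tuple is an answer. All rules preserve this meaning (`sound_of_modelDerives`).

*Maximality.* It suffices that on a finite view instance all certain answers are derived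
(`modelDerives_of_certain`). If a tuple `t` is not derived, values of the Skolem terms are chosen
that satisfy the ACs of the views and falsify every match of `Q` with output `t`. For a query with
a single right semi-interval, the condition that all matches fail is a set of Horn clauses in the
upper bounds of the values, and the facts `I_{≤ c}`, `J_{≥ c}` for `t` are the bounds that these
clauses force. It is thus enough to make each value exceed all `c` for which `I_{≤ c}` is not
derived, and to keep it below those `c` for which `J_{≥ c}` is derived but `I_{≥ c}` is not. In a
dense order without endpoints such bounds and a preorder have a common solution as soon as every
chain of inequalities between two constants is true (`exists_valuation_of_bounds`), and the
remaining rules of the program derive what a false chain would contradict. The solution identifies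
no more terms than the program does, so the strict comparisons and the inequations of the views
hold as well.

A contained rewriting in Datalog with ACs returns certain answers of finite subinstances. A match
of an AC-rectified CQAC rewriting satisfies the closed comparisons that its expansion implies.
Hence it is the image, under a monotone map that fixes the constants, of a match that extends to
the expansion (`exists_solution_refining`, by the same lemma on valuations), and there the
rewriting returns a certain answer. Derivations are preserved by such maps (`QueryDerives.map`),
because all comparisons that the program uses are closed.
-/

/-! ### Valuations of finite preorders in dense orders -/

section OrderExtension

variable {N α : Type*} [LinearOrder α] [DenselyOrdered α] [NoMinOrder α] [NoMaxOrder α] [Nonempty α]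

theorem exists_between_avoiding (L U F : Finset α) (h : ∀ l ∈ L, ∀ u ∈ U, l < u) :
    ∃ m, (∀ l ∈ L, l < m) ∧ (∀ u ∈ U, m < u) ∧ m ∉ F := by
  classical
  obtain ⟨m, hL, hU⟩ := Order.exists_between_finsets L (U ∪ F.filter fun f => ∀ l ∈ L, l < f) (by
    intro l hl u hu
    rcases Finset.mem_union.1 hu with hu | hu
    · exact h l hl u hu
    · exact (Finset.mem_filter.1 hu).2 l hl)
  refine ⟨m, hL, fun u hu => hU u (Finset.mem_union_left _ hu), fun hm => ?_⟩
  exact lt_irrefl m (hU m (Finset.mem_union_right _ (Finset.mem_filter.2 ⟨hm, hL⟩)))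

/-- A finite preorder in which some points are constants of a dense order without endpoints has a
valuation that fixes the constants, is monotone and identifies only equivalent points. It can also
avoid finitely many values, except at points equivalent to a constant. -/
theorem exists_valuation_of_preorder (P : N → N → Prop)
    (htrans : ∀ x y z, P x y → P y z → P x z) (cst : α → N) (M F : Finset α)
    (hcst : ∀ a ∈ M, ∀ b ∈ M, P (cst a) (cst b) ↔ a ≤ b) (S : Finset N) (hrefl : ∀ x ∈ S, P x x) :
    ∃ ν : N → α, (∀ a ∈ M, ν (cst a) = a) ∧
      ∀ x, (x ∈ S ∨ ∃ a ∈ M, x = cst a) →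
        (∀ y, (y ∈ S ∨ ∃ a ∈ M, y = cst a) → (P x y → ν x ≤ ν y) ∧ (ν x = ν y → P x y)) ∧
        (ν x ∈ F → ∃ a ∈ M, P x (cst a) ∧ P (cst a) x) := by
  classical
  induction S using Finset.induction_on with
  | empty =>
    have hinj : ∀ a ∈ M, ∀ b ∈ M, cst a = cst b → a = b := fun a ha b hb hab =>
      le_antisymm ((hcst a ha b hb).1 (hab ▸ (hcst a ha a ha).2 le_rfl))
        ((hcst b hb a ha).1 (hab ▸ (hcst a ha a ha).2 le_rfl))
    let ν : N → α := fun x =>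
      if h : ∃ a ∈ M, x = cst a then h.choose else Classical.arbitrary α
    have hν : ∀ a ∈ M, ν (cst a) = a := by
      intro a ha
      have h : ∃ b ∈ M, cst a = cst b := ⟨a, ha, rfl⟩
      have : ν (cst a) = h.choose := dif_pos h
      rw [this]
      exact (hinj a ha _ h.choose_spec.1 h.choose_spec.2).symm
    refine ⟨ν, hν, ?_⟩
    rintro x (hx | ⟨a, ha, rfl⟩)
    · simp at hx
    refine ⟨?_, fun _ => ⟨a, ha, ?_, ?_⟩⟩
    · rintro y (hy | ⟨b, hb, rfl⟩)
      · simp at hy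
      rw [hν a ha, hν b hb]
      exact ⟨(hcst a ha b hb).1, fun h => (hcst a ha b hb).2 h.le⟩
    all_goals exact (hcst a ha a ha).2 le_rfl
  | insert z S hz ih =>
    obtain ⟨ν, hν, hS⟩ := ih fun x hx => hrefl x (Finset.mem_insert_of_mem hx)
    have hPz : P z z := hrefl z (Finset.mem_insert_self _ _)
    by_cases hzc : ∃ a ∈ M, z = cst a
    · refine ⟨ν, hν, ?_⟩
      have key : ∀ x, (x ∈ insert z S ∨ ∃ a ∈ M, x = cst a) → (x ∈ S ∨ ∃ a ∈ M, x = cst a) := by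
        rintro x (hx | hx)
        · rcases Finset.mem_insert.1 hx with rfl | hx
          · exact Or.inr hzc
          · exact Or.inl hx
        · exact Or.inr hx
      exact fun x hx => ⟨fun y hy => (hS x (key x hx)).1 y (key y hy), (hS x (key x hx)).2⟩
    set K : Finset N := S ∪ M.image cst with hK
    have memK : ∀ x, x ∈ K ↔ (x ∈ S ∨ ∃ a ∈ M, x = cst a) := by
      intro x
      simp only [hK, Finset.mem_union, Finset.mem_image]
      exact or_congr Iff.rfl ⟨fun ⟨a, h, e⟩ => ⟨a, h, e.symm⟩, fun ⟨a, h, e⟩ => ⟨a, h, e.symm⟩⟩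
    have hzK : z ∉ K := fun h => ((memK z).1 h).elim hz hzc
    -- It suffices to find a suitable value for the new point `z`.
    suffices h : ∃ m, (∀ s ∈ K, (P s z → ν s ≤ m) ∧ (P z s → m ≤ ν s) ∧ (ν s = m → P s z ∧ P z s)) ∧
        (m ∈ F → ∃ a ∈ M, P z (cst a) ∧ P (cst a) z) by
      obtain ⟨m, hm, hF⟩ := h
      have hne : ∀ s ∈ K, Function.update ν z m s = ν s := fun s hs =>
        Function.update_of_ne (by rintro rfl; exact hzK hs) _ _
      refine ⟨Function.update ν z m, fun a ha => ?_, ?_⟩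
      · rw [hne _ ((memK _).2 (Or.inr ⟨a, ha, rfl⟩)), hν a ha]
      have key : ∀ x, (x ∈ insert z S ∨ ∃ a ∈ M, x = cst a) → x = z ∨ x ∈ K := by
        rintro x (hx | hx)
        · rcases Finset.mem_insert.1 hx with rfl | hx
          · exact Or.inl rfl
          · exact Or.inr ((memK x).2 (Or.inl hx))
        · exact Or.inr ((memK x).2 (Or.inr hx))
      intro x hx
      replace hx := key x hx
      rcases hx with rfl | hx
      · rw [Function.update_self]
        refine ⟨fun y hy => ?_, hF⟩
        rcases key y hy with rfl | hy
        · rw [Function.update_self]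
          exact ⟨fun _ => le_rfl, fun _ => hPz⟩
        · rw [hne y hy]
          exact ⟨(hm y hy).2.1, fun e => ((hm y hy).2.2 e.symm).2⟩
      · rw [hne x hx]
        refine ⟨fun y hy => ?_, (hS x ((memK x).1 hx)).2⟩
        replace hy := key y hy
        rcases hy with rfl | hy
        · rw [Function.update_self]
          exact ⟨(hm x hx).1, fun e => ((hm x hx).2.2 e).1⟩
        · rw [hne y hy]
          exact (hS x ((memK x).1 hx)).1 y ((memK y).1 hy)
    by_cases hs : ∃ s ∈ K, P s z ∧ P z s
    · obtain ⟨s, hsK, hsz, hzs⟩ := hs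
      have hsS := hS s ((memK s).1 hsK)
      refine ⟨ν s, fun x hx => ?_, fun hF => ?_⟩
      · have hxS := hS x ((memK x).1 hx)
        refine ⟨fun h => (hxS.1 s ((memK s).1 hsK)).1 (htrans _ _ _ h hzs),
          fun h => (hsS.1 x ((memK x).1 hx)).1 (htrans _ _ _ hsz h), fun h => ⟨?_, ?_⟩⟩
        · exact htrans _ _ _ ((hxS.1 s ((memK s).1 hsK)).2 h) hsz
        · exact htrans _ _ _ hzs ((hsS.1 x ((memK x).1 hx)).2 h.symm)
      · obtain ⟨a, ha, h1, h2⟩ := hsS.2 hF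
        exact ⟨a, ha, htrans _ _ _ hzs h1, htrans _ _ _ h2 hsz⟩
    · obtain ⟨m, hL, hU, hF⟩ := exists_between_avoiding ((K.filter fun s => P s z).image ν)
        ((K.filter fun s => P z s).image ν) (F ∪ K.image ν) (by
          intro l hl u hu
          obtain ⟨x, hx, rfl⟩ := Finset.mem_image.1 hl
          obtain ⟨y, hy, rfl⟩ := Finset.mem_image.1 hu
          obtain ⟨hxK, hxz⟩ := Finset.mem_filter.1 hx
          obtain ⟨hyK, hzy⟩ := Finset.mem_filter.1 hy
          have hxS := hS x ((memK x).1 hxK)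
          have hyS := hS y ((memK y).1 hyK)
          refine lt_of_le_of_ne ((hxS.1 y ((memK y).1 hyK)).1 (htrans _ _ _ hxz hzy)) fun e => ?_
          exact hs ⟨x, hxK, hxz, htrans _ _ _ hzy ((hyS.1 x ((memK x).1 hxK)).2 e.symm)⟩)
      rw [Finset.mem_union, not_or] at hF
      refine ⟨m, fun s hsK => ⟨fun h => ?_, fun h => ?_, fun h => ?_⟩, fun h => absurd h hF.1⟩
      · exact (hL _ (Finset.mem_image_of_mem _ (Finset.mem_filter.2 ⟨hsK, h⟩))).le
      · exact (hU _ (Finset.mem_image_of_mem _ (Finset.mem_filter.2 ⟨hsK, h⟩))).le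
      · exact absurd (h ▸ Finset.mem_image_of_mem ν hsK) hF.2

/-- Strict upper bounds `A` (`A a x` asks for `ν x < a`) and strict lower bounds `B` (`B b x` asks
for `b < ν x`) by constants can be added to a preorder `P`, if each chain of inequalities from a
constant `b` to a constant `a` that they create is true. -/
theorem exists_valuation_of_bounds (P : N → N → Prop)
    (htrans : ∀ x y z, P x y → P y z → P x z) (cst : α → N) (A B : α → N → Prop) (M F : Finset α)
    (hcst : ∀ a ∈ M, ∀ b ∈ M, a ≤ b → P (cst a) (cst b))
    (hle : ∀ b a, P (cst b) (cst a) → b ≤ a)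
    (hA : ∀ b a x, P (cst b) x → A a x → b < a)
    (hB : ∀ b a x, B b x → P x (cst a) → b < a)
    (hBA : ∀ b a x y, B b x → P x y → A a y → b < a)
    (S : Finset N) (hrefl : ∀ x ∈ S, P x x) :
    ∃ ν : N → α, (∀ a ∈ M, ν (cst a) = a) ∧
      (∀ x ∈ S, ∀ y ∈ S, (P x y → ν x ≤ ν y) ∧ (ν x = ν y → P x y)) ∧
      (∀ x ∈ S, ν x ∈ F → ∃ a ∈ M, P x (cst a) ∧ P (cst a) x) ∧
      (∀ x ∈ S, ∀ a ∈ M, A a x → ν x < a) ∧ (∀ x ∈ S, ∀ b ∈ M, B b x → b < ν x) := by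
  -- `Up x a` and `Lo b x`: the value of `x` is forced to be at most `a`, at least `b`. A chain that
  -- uses a new bound runs through constants, so it splits into an upper and a lower bound.
  let Up : N → α → Prop := fun x a => P x (cst a) ∨ ∃ y, A a y ∧ P x y
  let Lo : α → N → Prop := fun b x => P (cst b) x ∨ ∃ y, B b y ∧ P y x
  let R : N → N → Prop := fun x y => P x y ∨ ∃ a b, a ≤ b ∧ Up x a ∧ Lo b y
  have key : ∀ b x a, Lo b x → Up x a → b ≤ a ∧ (b = a → P (cst b) x ∧ P x (cst a)) := by
    rintro b x a (h1 | ⟨y, hy, h1⟩) (h2 | ⟨z, hz, h2⟩)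
    · exact ⟨hle _ _ (htrans _ _ _ h1 h2), fun _ => ⟨h1, h2⟩⟩
    · have := hA _ _ _ (htrans _ _ _ h1 h2) hz
      exact ⟨this.le, fun e => absurd e this.ne⟩
    · have := hB _ _ _ hy (htrans _ _ _ h1 h2)
      exact ⟨this.le, fun e => absurd e this.ne⟩
    · have := hBA _ _ _ _ hy (htrans _ _ _ h1 h2) hz
      exact ⟨this.le, fun e => absurd e this.ne⟩
  have upP : ∀ x y a, P x y → Up y a → Up x a := by
    rintro x y a h (h1 | ⟨z, hz, h1⟩)
    · exact Or.inl (htrans _ _ _ h h1)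
    · exact Or.inr ⟨z, hz, htrans _ _ _ h h1⟩
  have loP : ∀ x y b, Lo b x → P x y → Lo b y := by
    rintro x y a (h1 | ⟨z, hz, h1⟩) h
    · exact Or.inl (htrans _ _ _ h1 h)
    · exact Or.inr ⟨z, hz, htrans _ _ _ h1 h⟩
  have Rtrans : ∀ x y z, R x y → R y z → R x z := by
    rintro x y z (h1 | ⟨a, b, hab, hu, hl⟩) (h2 | ⟨a', b', hab', hu', hl'⟩)
    · exact Or.inl (htrans _ _ _ h1 h2)
    · exact Or.inr ⟨a', b', hab', upP _ _ _ h1 hu', hl'⟩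
    · exact Or.inr ⟨a, b, hab, hu, loP _ _ _ hl h2⟩
    · exact Or.inr ⟨a, b', (hab.trans (key _ _ _ hl hu').1).trans hab', hu, hl'⟩
  -- No new equivalences arise.
  have Ranti : ∀ x y, R x y → R y x → P x y := by
    rintro x y (h1 | ⟨a, b, hab, hu, hl⟩) h2
    · exact h1
    rcases h2 with h2 | ⟨a', b', hab', hu', hl'⟩
    · have k := key b x a (loP _ _ _ hl h2) hu
      have e := le_antisymm hab k.1
      have k1 := (k.2 e.symm)
      have k2 := (key b y a hl (upP _ _ _ h2 hu)).2 e.symm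
      exact htrans _ _ _ k1.2 (e ▸ k2.1)
    · have k := key _ _ _ hl hu'
      have k' := key _ _ _ hl' hu
      have e1 : b = a' := le_antisymm k.1 (hab'.trans (k'.1.trans hab))
      have e2 : b' = a := le_antisymm k'.1 (hab.trans (k.1.trans hab'))
      have e3 : a = b := le_antisymm hab (e2 ▸ e1 ▸ hab')
      exact htrans _ _ _ (k'.2 e2).2 (e3 ▸ (k.2 e1).1)
  have hRcst : ∀ a ∈ M, ∀ b ∈ M, R (cst a) (cst b) ↔ a ≤ b := by
    refine fun a ha b hb => ⟨?_, fun h => Or.inl (hcst a ha b hb h)⟩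
    rintro (h | ⟨a', b', hab, hu, hl⟩)
    · exact hle _ _ h
    · exact ((key a (cst a) a' (Or.inl (hcst a ha a ha le_rfl)) hu).1.trans hab).trans
        (key b' (cst b) b hl (Or.inl (hcst b hb b hb le_rfl))).1
  obtain ⟨ν, hν, hS⟩ := exists_valuation_of_preorder R Rtrans cst M F hRcst S
    fun x hx => Or.inl (hrefl x hx)
  have hmono : ∀ x ∈ S, ∀ y ∈ S, (P x y → ν x ≤ ν y) ∧ (ν x = ν y → P x y) := by
    intro x hx y hy
    have hxy := (hS x (Or.inl hx)).1 y (Or.inl hy)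
    have hyx := (hS y (Or.inl hy)).1 x (Or.inl hx)
    exact ⟨fun h => hxy.1 (Or.inl h), fun e => Ranti _ _ (hxy.2 e) (hyx.2 e.symm)⟩
  refine ⟨ν, hν, hmono, fun x hx hF => ?_, fun x hx a ha hax => ?_, fun x hx b hb hbx => ?_⟩
  · obtain ⟨a, ha, h1, h2⟩ := (hS x (Or.inl hx)).2 hF
    exact ⟨a, ha, Ranti _ _ h1 h2, Ranti _ _ h2 h1⟩
  · have haa := hcst a ha a ha le_rfl
    have h1 := (hS x (Or.inl hx)).1 (cst a) (Or.inr ⟨a, ha, rfl⟩)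
    have h2 := (hS (cst a) (Or.inr ⟨a, ha, rfl⟩)).1 x (Or.inl hx)
    have hR : R x (cst a) := Or.inr ⟨a, a, le_rfl, Or.inr ⟨x, hax, hrefl x hx⟩, Or.inl haa⟩
    rw [hν a ha] at h1 h2
    exact lt_of_le_of_ne (h1.1 hR) fun e =>
      lt_irrefl _ (hA _ _ _ (Ranti _ _ (h2.2 e.symm) hR) hax)
  · have hbb := hcst b hb b hb le_rfl
    have h1 := (hS x (Or.inl hx)).1 (cst b) (Or.inr ⟨b, hb, rfl⟩)
    have h2 := (hS (cst b) (Or.inr ⟨b, hb, rfl⟩)).1 x (Or.inl hx)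
    have hR : R (cst b) x := Or.inr ⟨b, b, le_rfl, Or.inl hbb, Or.inr ⟨x, hbx, hrefl x hx⟩⟩
    rw [hν b hb] at h1 h2
    exact lt_of_le_of_ne (h2.1 hR) fun e =>
      lt_irrefl _ (hB _ _ _ hbx (Ranti _ _ (h1.2 e.symm) hR))

end OrderExtension

/-! ### The logic program and its encoding without function symbols -/

/-- A ground term of the logic program: a constant, or a function symbol applied to constants. -/
inductive GTerm (F α : Type) where
  | const (c : α)
  | app (f : F) (args : List α)

namespace GTerm

variable {F α : Type}

/-- The tag by which the elimination of function symbols records the shape of a term. -/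
def tag : GTerm F α → Option F
  | const _ => none
  | app f _ => some f

/-- The constants by which the elimination of function symbols represents a term. -/
def flat : GTerm F α → List α
  | const c => [c]
  | app _ l => l

/-- Function symbols are applied to as many constants as their arity says. -/
def HasArity (ar : F → ℕ) : GTerm F α → Prop
  | const _ => True
  | app f l => l.length = ar f

theorem eq_of_tag_of_flat {g g' : GTerm F α} (ht : g.tag = g'.tag)
    (hf : g.flat = g'.flat) : g = g' := by
  cases g <;> cases g' <;> simp_all [tag, flat]

theorem length_flat_eq {ar : F → ℕ} {g g' : GTerm F α} (hg : g.HasArity ar)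
    (hg' : g'.HasArity ar) (ht : g.tag = g'.tag) : g.flat.length = g'.flat.length := by
  cases g <;> cases g' <;> simp_all [tag, flat, HasArity]

/-- A list of ground terms is determined by its tags and its flattened arguments. -/
theorem list_ext {ar : F → ℕ} : ∀ {l l' : List (GTerm F α)}, (∀ g ∈ l, g.HasArity ar) →
    (∀ g ∈ l', g.HasArity ar) → l.map tag = l'.map tag → l.flatMap flat = l'.flatMap flat → l = l'
  | [], [], _, _, _, _ => rfl
  | [], _ :: _, _, _, h, _ => by simp at h
  | _ :: _, [], _, _, h, _ => by simp at h
  | g :: l, g' :: l', hl, hl', ht, hf => by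
    simp only [List.map_cons, List.cons.injEq] at ht
    simp only [List.flatMap_cons] at hf
    obtain ⟨h1, h2⟩ := List.append_inj hf
      (length_flat_eq (hl g (by simp)) (hl' g' (by simp)) ht.1)
    rw [eq_of_tag_of_flat ht.1 h1, list_ext (fun x hx => hl x (by simp [hx]))
      (fun x hx => hl' x (by simp [hx])) ht.2 h2]

end GTerm

section Ground

variable {W E I F X α : Type}

/-- The value of a term under an assignment of ground terms to the variables. -/
def Term.ground (g : X → GTerm F α) : Term X α → GTerm F α
  | .var x => g x
  | .const c => .const c

/-- The value of a term with function symbols under an assignment of constants. -/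
def FTerm.ground (h : X → α) : FTerm F X α → GTerm F α
  | .term t => .const (t.eval h)
  | .app f args => .app f (args.map (Term.eval h))

/-- The least model of the logic program formed by the inverse rules of the views and the rules of
the query, over the instance `D` of the views. -/
inductive LogicDerives [DecidableEq X] [DecidableEq α] (ws : List W) (def_ : W → CQ E X α)
    (P : Datalog E I X α) (D : Instance W α) : E ⊕ I → List (GTerm (W × X) α) → Prop where
  | inverse (w : W) (hw : w ∈ ws) (h : X → α) (hD : (w, (def_ w).head.map (Term.eval h)) ∈ D)
      (a : Atom E X α) (ha : a ∈ (def_ w).body) :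
      LogicDerives ws def_ P D (.inl a.pred)
        (a.args.map fun t => (inverseTerm def_ w t).ground h)
  | rule (r : Rule E I X α) (hr : r ∈ P.rules) (g : X → GTerm (W × X) α)
      (hb : ∀ a ∈ r.body, LogicDerives ws def_ P D a.pred (a.args.map (Term.ground g))) :
      LogicDerives ws def_ P D (.inr r.head.pred) (r.head.args.map (Term.ground g))

/-- The assignment of ground terms that is encoded by tags and an assignment of constants. -/
def groundOf (ar : F → ℕ) (σ : X → Option F) (h : X × ℕ → α) (x : X) : GTerm F α :=
  match σ x with
  | none => .const (h (x, 0))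
  | some f => .app f ((List.range (ar f)).map fun j => h (x, j))

theorem hasArity_groundOf (ar : F → ℕ) (σ : X → Option F) (h : X × ℕ → α) (t : Term X α) :
    (t.ground (groundOf ar σ h)).HasArity ar := by
  cases t with
  | const c => trivial
  | var x =>
    simp only [Term.ground, groundOf]
    split <;> simp [GTerm.HasArity]

theorem tagTerm_eq_tag (ar : F → ℕ) (σ : X → Option F) (h : X × ℕ → α) (t : Term X α) :
    tagTerm σ t = (t.ground (groundOf ar σ h)).tag := by
  cases t with
  | const c => rfl
  | var x =>
    simp only [Term.ground, groundOf, tagTerm]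
    split <;> simp [GTerm.tag, *]

theorem map_eval_splitTerm (ar : F → ℕ) (σ : X → Option F) (h : X × ℕ → α) (t : Term X α) :
    (splitTerm ar σ t).map (Term.eval h) = (t.ground (groundOf ar σ h)).flat := by
  cases t with
  | const c => rfl
  | var x =>
    simp only [Term.ground, groundOf, splitTerm]
    cases σ x with
    | none => rfl
    | some f => simp only [GTerm.flat, List.map_map]; rfl

theorem map_eval_flatMap_splitTerm (ar : F → ℕ) (σ : X → Option F) (h : X × ℕ → α)
    (l : List (Term X α)) : (l.flatMap (splitTerm ar σ)).map (Term.eval h) =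
      (l.map (Term.ground (groundOf ar σ h))).flatMap GTerm.flat := by
  simp only [List.map_flatMap, List.flatMap_map, map_eval_splitTerm]

theorem splitTerm_none (ar : F → ℕ) (t : Term X α) :
    splitTerm ar (fun _ => none) t = [t.rename fun x => (x, 0)] := by
  cases t <;> rfl

theorem flatMap_splitTerm_none (ar : F → ℕ) (l : List (Term X α)) :
    l.flatMap (splitTerm ar fun _ => none) = l.map (Term.rename fun x => (x, 0)) := by
  rw [show splitTerm ar (fun _ : X => (none : Option F)) = _ from
    funext (splitTerm_none (α := α) ar)]
  exact List.flatMap_pure_eq_map _ _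

theorem Term.eval_rename {Y : Type} (f : X → Y) (h : Y → α) (t : Term X α) :
    (t.rename f).eval h = t.eval fun x => h (f x) := by
  cases t <;> rfl

theorem Term.map_eval_map_rename {Y : Type} (f : X → Y) (h : Y → α) (l : List (Term X α)) :
    (l.map (Term.rename f)).map (Term.eval h) = l.map (Term.eval fun x => h (f x)) := by
  simp [Term.eval_rename]

theorem Term.ground_congr {h h' : X → GTerm F α} {t : Term X α} (H : ∀ x ∈ t.vars, h x = h' x) :
    t.ground h = t.ground h' := by
  cases t with
  | const c => rfl
  | var x => exact H x (by simp [Term.vars])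

theorem tagFTerm_eq_tag (h : X × ℕ → α) (t : FTerm F X α) :
    tagFTerm (fun _ => none) t = (t.ground fun x => h (x, 0)).tag := by
  rcases t with (t | t) | t <;> rfl

theorem map_eval_splitFTerm (ar : F → ℕ) (h : X × ℕ → α) (t : FTerm F X α) :
    (splitFTerm ar (fun _ => none) t).map (Term.eval h) = (t.ground fun x => h (x, 0)).flat := by
  rcases t with t | ⟨f, l⟩
  · simp [splitFTerm, splitTerm_none, FTerm.ground, GTerm.flat, Term.eval_rename]
  · simp only [splitFTerm, flatMap_splitTerm_none, FTerm.ground, GTerm.flat,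
      Term.map_eval_map_rename]

theorem mem_map_lookup_sections {O : Type} [DecidableEq X] (os : List O) (σ : X → O) (d : O) :
    ∀ (xs : List X), (∀ x ∈ xs, σ x ∈ os) → (∀ x ∉ xs, σ x = d) →
    σ ∈ ((xs.map fun x => os.map fun o => (x, o)).sections.map fun l x =>
      (l.lookup x).getD d) := by
  intro xs h1 h2
  rw [List.mem_map]
  refine ⟨xs.map fun x => (x, σ x), ?_, ?_⟩
  · rw [List.mem_sections]
    induction xs with
    | nil => simp
    | cons x xs ih =>
      simp only [List.map_cons, List.forall₂_cons]
      refine ⟨List.mem_map_of_mem (h1 x (by simp)), ?_⟩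
      clear ih h2
      have : ∀ y ∈ xs, σ y ∈ os := fun y hy => h1 y (by simp [hy])
      clear h1
      induction xs with
      | nil => simp
      | cons y ys ih =>
        simp only [List.map_cons, List.forall₂_cons]
        exact ⟨List.mem_map_of_mem (this y (by simp)), ih fun z hz => this z (by simp [hz])⟩
  · funext x
    by_cases hx : x ∈ xs
    · have : (xs.map fun x => (x, σ x)).lookup x = some (σ x) := by
        clear h1 h2
        induction xs with
        | nil => simp at hx
        | cons y ys ih =>
          rw [List.map_cons, List.lookup_cons]
          by_cases e : x = y
          · subst e; simp
          · have : (x == y) = false := by simpa using e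
            rw [this]
            exact ih ((List.mem_cons.1 hx).resolve_left e)
      rw [this]; rfl
    · have : (xs.map fun x => (x, σ x)).lookup x = none := by
        rw [List.lookup_eq_none_iff]
        intro p hp
        obtain ⟨y, hy, rfl⟩ := List.mem_map.1 hp
        simp only [bne_iff_ne, ne_eq]
        rintro rfl
        exact hx hy
      rw [this, h2 x hx]; rfl

theorem mem_tagAssignments [DecidableEq X] {fs : List F} {xs : List X} {σ : X → Option F}
    (h1 : ∀ x ∈ xs, ∀ f, σ x = some f → f ∈ fs) (h2 : ∀ x ∉ xs, σ x = none) :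
    σ ∈ tagAssignments fs xs := by
  refine mem_map_lookup_sections _ σ none xs (fun x hx => ?_) h2
  cases hf : σ x with
  | none => simp
  | some f => simp [h1 x hx f hf]

theorem tagAssignments_nil [DecidableEq X] (fs : List F) :
    tagAssignments fs ([] : List X) = [fun _ => none] := by
  rfl

theorem freeVars_toFRule [DecidableEq X] (r : Rule E I X α) :
    (r.toFRule (W := W)).freeVars = (r.body.flatMap Atom.vars).dedup := by
  have h : (r.toFRule (W := W)).constVars = [] := by
    simp [FRule.constVars, Rule.toFRule, List.flatMap_map]
  rw [FRule.freeVars, h]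
  simp [Rule.toFRule, List.flatMap_map]
  rfl

theorem mem_atom_vars {P : Type} {a : Atom P X α} {x : X} : x ∈ a.vars ↔ .var x ∈ a.args := by
  simp only [Atom.vars, List.mem_flatMap]
  constructor
  · rintro ⟨t | t, ht, h⟩
    · rw [List.mem_singleton.1 h]; exact ht
    · simp [Term.vars] at h
  · exact fun h => ⟨_, h, by simp [Term.vars]⟩

theorem eq_map_const_of_tag_eq_none {gs : List (GTerm F α)}
    (h : ∀ g ∈ gs, g.tag = none) : gs = (gs.flatMap GTerm.flat).map GTerm.const := by
  induction gs with
  | nil => rfl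
  | cons g gs ih =>
    cases g with
    | const c =>
      rw [List.flatMap_cons, List.map_append, ← ih fun g hg => h g (List.mem_cons_of_mem _ hg)]
      rfl
    | app f l => exact absurd (h _ List.mem_cons_self) (by simp [GTerm.tag])

end Ground

/-! ### The rewriting computes the least model of the logic program -/

section Model

variable {B α : Type} [LinearOrder α] {n : ℕ}

/-- The comparison `x θ c` of values. -/
def SIHolds (θ : Dir) (x c : α) : Prop :=
  match θ with
  | .le => x ≤ c
  | .ge => c ≤ x

theorem siAC_holds {X : Type} (h : X → α) (θ : Dir) (t : Term X α) (c : α) :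
    (siAC θ t c).Holds h ↔ SIHolds θ (t.eval h) c := by
  cases θ <;> rfl

/-- The constants `C` and the values in the view instance `J`. -/
def activeDomain (C : List α) (V : Fin n → CQAC B ℕ α) (J : Instance (Fin n) α) : Set α :=
  {a | a ∈ C ∨ ∃ i l, (i, l) ∈ J ∧ l.length = (V i).head.length ∧ a ∈ l}

/-- The instance of the transformed views that the reverse transformation reads off a view
instance `J`: the auxiliary views are interpreted by the comparisons of the active domain. -/
def cqInstance (C : List α) (V : Fin n → CQAC B ℕ α) (J : Instance (Fin n) α) :
    Instance (CQViewName n α) α :=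
  {f | match f.1 with
    | .view i => (i, f.2) ∈ J
    | .u => ∃ a b, f.2 = [a, b] ∧ a ∈ activeDomain C V J ∧ b ∈ activeDomain C V J ∧ a ≤ b
    | .usi θ c => ∃ a, f.2 = [a] ∧ a ∈ activeDomain C V J ∧ SIHolds θ a c}

/-- The facts derived by the inverse rules and the rules of `P` on the view instance `J`. -/
abbrev ModelDerives (C : List α) (V : Fin n → CQAC B ℕ α)
    (P : Datalog (ExtPred B α) (QIdb α) QVar α) (J : Instance (Fin n) α) :
    ExtPred B α ⊕ QIdb α → List (GTerm (CQViewName n α × QVar) α) → Prop :=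
  LogicDerives (cqViewNames C n) (cqViews C V) P (cqInstance C V J)

/-- The last two steps of the algorithm, for any Datalog query. -/
noncomputable def rewritingOf (C : List α) (V : Fin n → CQAC B ℕ α)
    (P : Datalog (ExtPred B α) (QIdb α) QVar α) (k : ℕ) :
    DatalogAC (Fin n)
      (RIdb ((ExtPred B α ⊕ QIdb α) × List (Option (CQViewName n α × QVar)))) (QVar × ℕ) α :=
  reverseTransform C V (fun m => (.aux m, 0))
    (inverseRulesMCR (cqViewNames C n) (cqViews C V) P k)

/-- The arities of the Skolem functions. -/
noncomputable def skolemArity (C : List α) (V : Fin n → CQAC B ℕ α)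
    (f : CQViewName n α × QVar) : ℕ :=
  (cqViews C V f.1).head.length

/-- The Skolem functions of the transformed views. -/
noncomputable def skolemFunctions (C : List α) (V : Fin n → CQAC B ℕ α) :
    List (CQViewName n α × QVar) :=
  (cqViewNames C n).flatMap fun w =>
    (((cqViews C V w).body.flatMap Atom.vars).filter fun x =>
      .var x ∉ (cqViews C V w).head).dedup.map fun x => (w, x)

/-- The inverse rule of the view `w` for its subgoal `a`. -/
noncomputable def inverseRule (C : List α) (V : Fin n → CQAC B ℕ α) (w : CQViewName n α)
    (a : Atom (ExtPred B α) QVar α) :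
    FRule (CQViewName n α) (ExtPred B α ⊕ QIdb α) (CQViewName n α × QVar) QVar α :=
  ⟨.inl a.pred, a.args.map (inverseTerm (cqViews C V) w), [⟨.inl w, (cqViews C V w).head⟩]⟩

theorem freeVars_inverseRule (C : List α) (V : Fin n → CQAC B ℕ α) (w : CQViewName n α)
    (a : Atom (ExtPred B α) QVar α) : (inverseRule C V w a).freeVars = [] := by
  have : (((inverseRule C V w a).body.flatMap Atom.vars).filter
      fun x => x ∉ (inverseRule C V w a).constVars) = [] := by
    rw [List.filter_eq_nil_iff]
    intro x hx
    simp only [inverseRule, List.flatMap_cons, List.flatMap_nil, List.append_nil] at hx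
    simp [FRule.constVars, inverseRule, hx]
  rw [FRule.freeVars, this]; rfl

theorem mem_rules_rewritingOf {C : List α} {V : Fin n → CQAC B ℕ α}
    {P : Datalog (ExtPred B α) (QIdb α) QVar α} {k : ℕ}
    {r : RuleAC (Fin n) (RIdb ((ExtPred B α ⊕ QIdb α) × List (Option (CQViewName n α × QVar))))
      (QVar × ℕ) α} :
    r ∈ (rewritingOf C V P k).rules ↔
      (∃ w ∈ cqViewNames C n, ∃ a ∈ (cqViews C V w).body,
        r = reverseRule (splitRule (skolemArity C V) (fun _ => none) (inverseRule C V w a))) ∨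
      (∃ r₀ ∈ P.rules, ∃ σ ∈ tagAssignments (skolemFunctions C V) (r₀.body.flatMap Atom.vars).dedup,
        r = reverseRule (splitRule (skolemArity C V) σ r₀.toFRule)) ∨
      r ∈ adomRules C V fun m => (.aux m, 0) := by
  have h0 : (rewritingOf C V P k).rules =
      ((inverseProgram (cqViewNames C n) (cqViews C V) P).flatMap fun r =>
        (tagAssignments (skolemFunctions C V) r.freeVars).map fun σ =>
          splitRule (skolemArity C V) σ r).map reverseRule ++
        adomRules C V fun m => (.aux m, 0) := rfl
  rw [h0, List.mem_append, ← or_assoc]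
  refine or_congr_left ?_
  simp only [List.mem_map, List.mem_flatMap, inverseProgram, List.mem_append]
  constructor
  · rintro ⟨_, ⟨r₁, ⟨w, hw, hr₁⟩ | ⟨r₀, hr₀, rfl⟩, σ, hσ, rfl⟩, rfl⟩
    · obtain ⟨a, ha, rfl⟩ := List.mem_map.1 hr₁
      change σ ∈ tagAssignments _ (inverseRule C V w a).freeVars at hσ
      rw [freeVars_inverseRule, tagAssignments_nil, List.mem_singleton] at hσ
      subst hσ
      exact Or.inl ⟨w, hw, a, ha, rfl⟩
    · rw [freeVars_toFRule] at hσ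
      exact Or.inr ⟨r₀, hr₀, σ, hσ, rfl⟩
  · rintro (⟨w, hw, a, ha, rfl⟩ | ⟨r₀, hr₀, σ, hσ, rfl⟩)
    · refine ⟨_, ⟨inverseRule C V w a, Or.inl ⟨w, hw, List.mem_map.2 ⟨a, ha, rfl⟩⟩, _, ?_, rfl⟩,
        rfl⟩
      rw [freeVars_inverseRule, tagAssignments_nil, List.mem_singleton]
    · refine ⟨_, ⟨_, Or.inr ⟨r₀, hr₀, rfl⟩, σ, ?_, rfl⟩, rfl⟩
      rwa [freeVars_toFRule]

/-- A fact of the rewriting, read as a fact about the active domain or about ground terms. -/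
def DecodedFact (C : List α) (V : Fin n → CQAC B ℕ α)
    (P : Datalog (ExtPred B α) (QIdb α) QVar α) (J : Instance (Fin n) α) :
    RIdb ((ExtPred B α ⊕ QIdb α) × List (Option (CQViewName n α × QVar))) → List α → Prop
  | .adom, l => ∃ a, l = [a] ∧ a ∈ activeDomain C V J
  | .idb p, l => ∃ gs, gs.map GTerm.tag = p.2 ∧ gs.flatMap GTerm.flat = l ∧
      (∀ g ∈ gs, g.HasArity (skolemArity C V)) ∧ ModelDerives C V P J p.1 gs

theorem body_inverseRule_view (C : List α) (V : Fin n → CQAC B ℕ α) (i : Fin n)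
    (a : Atom (ExtPred B α) QVar α) :
    (reverseRule (splitRule (skolemArity C V) (fun _ => none) (inverseRule C V (.view i) a))).body =
      [⟨.inl i, (cqViews C V (.view i)).head.map (Term.rename fun x => (x, 0))⟩] := by
  simp only [reverseRule, splitRule, inverseRule, splitAtom, reverseAtom, List.map_cons,
    List.map_nil, List.flatMap_cons, List.flatMap_nil, List.append_nil, flatMap_splitTerm_none]

theorem acs_inverseRule_view (C : List α) (V : Fin n → CQAC B ℕ α) (i : Fin n)
    (a : Atom (ExtPred B α) QVar α) :
    (reverseRule (splitRule (skolemArity C V) (fun _ => none) (inverseRule C V (.view i) a))).acs =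
      [] := by
  simp only [reverseRule, splitRule, inverseRule, splitAtom, reverseACs, List.map_cons,
    List.map_nil, List.flatMap_cons, List.flatMap_nil, List.append_nil]

theorem body_reverseRule_toFRule (C : List α) (V : Fin n → CQAC B ℕ α)
    (σ : QVar → Option (CQViewName n α × QVar)) (r : Rule (ExtPred B α) (QIdb α) QVar α) :
    (reverseRule (splitRule (skolemArity C V) σ (r.toFRule (W := CQViewName n α)))).body =
      r.body.map fun a => (⟨.inr (.idb (a.pred, a.args.map (tagTerm σ))),
        a.args.flatMap (splitTerm (skolemArity C V) σ)⟩ : Atom _ _ α) := by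
  change ((r.body.map _).map _).flatMap _ = _
  rw [List.map_map, List.flatMap_map, ← List.flatMap_pure_eq_map]
  rfl

theorem acs_reverseRule_toFRule (C : List α) (V : Fin n → CQAC B ℕ α)
    (σ : QVar → Option (CQViewName n α × QVar)) (r : Rule (ExtPred B α) (QIdb α) QVar α) :
    (reverseRule (splitRule (skolemArity C V) σ (r.toFRule (W := CQViewName n α)))).acs = [] := by
  simp [reverseRule, splitRule, Rule.toFRule, reverseACs, splitAtom]

/-- The body of an inverse rule after the reverse transformation says that the head of the view is
in `cqInstance`. -/
theorem derives_inverse_iff (C : List α) (V : Fin n → CQAC B ℕ α) (J : Instance (Fin n) α)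
    (Idb : RIdb ((ExtPred B α ⊕ QIdb α) × List (Option (CQViewName n α × QVar))) → List α → Prop)
    (hIdb : ∀ a, Idb .adom [a] ↔ a ∈ activeDomain C V J)
    (w : CQViewName n α) (a : Atom (ExtPred B α) QVar α) (h : QVar × ℕ → α) :
    let r := reverseRule (splitRule (skolemArity C V) (fun _ => none) (inverseRule C V w a))
    ((∀ e args, (⟨Sum.inl e, args⟩ : Atom _ _ α) ∈ r.body → (e, args.map (Term.eval h)) ∈ J) ∧
      (∀ i args, (⟨Sum.inr i, args⟩ : Atom _ _ α) ∈ r.body → Idb i (args.map (Term.eval h))) ∧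
      (∀ b ∈ r.acs, b.Holds h)) ↔
    (w, (cqViews C V w).head.map (Term.eval fun x => h (x, 0))) ∈ cqInstance C V J := by
  cases w with
  | view i =>
    intro r
    simp only [r]
    rw [body_inverseRule_view, acs_inverseRule_view]
    simp [cqInstance, Function.comp_def, Term.eval_rename]
  | u =>
    intro r
    have hb : r.body = [⟨.inr .adom, [.var (.aux 0, 0)]⟩, ⟨.inr .adom, [.var (.aux 1, 0)]⟩] := rfl
    have ha : r.acs = [⟨.var (.aux 0, 0), .le, .var (.aux 1, 0)⟩] := rfl
    rw [hb, ha]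
    simp [cqInstance, cqViews, Term.eval, AC.Holds, ← hIdb, and_assoc]
    constructor
    · rintro ⟨h1, h2⟩
      exact ⟨h1 _ _ (Or.inl ⟨rfl, rfl⟩), h1 _ _ (Or.inr ⟨rfl, rfl⟩), h2⟩
    · rintro ⟨h1, h2, h3⟩
      refine ⟨?_, h3⟩
      rintro _ _ (⟨rfl, rfl⟩ | ⟨rfl, rfl⟩) <;> assumption
  | usi θ c =>
    intro r
    have hb : r.body = [⟨.inr .adom, [.var (.aux 0, 0)]⟩] := rfl
    have ha : r.acs = [siAC θ (.var (.aux 0, 0)) c] := rfl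
    rw [hb, ha]
    simp [cqInstance, cqViews, Term.eval, siAC_holds, hIdb]

/-- Each fact that the rewriting derives encodes a fact of the logic program. -/
theorem decodedFact_of_derives {C : List α} {V : Fin n → CQAC B ℕ α}
    {P : Datalog (ExtPred B α) (QIdb α) QVar α} {k : ℕ} {J : Instance (Fin n) α}
    {i : RIdb ((ExtPred B α ⊕ QIdb α) × List (Option (CQViewName n α × QVar)))} {l : List α}
    (H : (rewritingOf C V P k).Derives J i l) : DecodedFact C V P J i l := by
  induction H with
  | fire r hr h hE hI hAC ih =>
    clear hI
    rcases mem_rules_rewritingOf.1 hr with ⟨w, hw, a, ha, rfl⟩ | ⟨r₀, hr₀, σ, hσ, rfl⟩ | hr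
    · have hf := (derives_inverse_iff C V J (DecodedFact C V P J)
        (fun a => by simp [DecodedFact]) w a h).1 ⟨hE, ih, hAC⟩
      refine ⟨a.args.map fun t => (inverseTerm (cqViews C V) w t).ground fun x => h (x, 0),
        ?_, ?_, ?_, .inverse w hw _ hf a ha⟩
      · simp only [List.map_map, splitRule, inverseRule, Function.comp_def,
          tagFTerm_eq_tag h]
      · simp only [List.flatMap_map, reverseRule, splitRule, inverseRule, List.map_flatMap,
          map_eval_splitFTerm]
      · intro g hg
        obtain ⟨t, -, rfl⟩ := List.mem_map.1 hg
        cases t with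
        | const c => trivial
        | var x =>
          simp only [inverseTerm]
          split <;> simp [FTerm.ground, GTerm.HasArity, skolemArity]
    · set g := groundOf (skolemArity C V) σ h with hg
      refine ⟨r₀.head.args.map (Term.ground g), ?_, ?_, ?_, .rule r₀ hr₀ g fun a ha => ?_⟩
      · simp only [List.map_map, splitRule, Rule.toFRule, Function.comp_def,
          tagFTerm, tagTerm_eq_tag (skolemArity C V) σ h, hg]
      · simp only [List.flatMap_map, reverseRule, splitRule, Rule.toFRule, List.map_flatMap,
          splitFTerm, map_eval_splitTerm, hg]
      · intro x hx
        obtain ⟨t, -, rfl⟩ := List.mem_map.1 hx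
        exact hasArity_groundOf _ _ _ _
      · obtain ⟨gs, h1, h2, h3, h4⟩ := ih (.idb (a.pred, a.args.map (tagTerm σ)))
          (a.args.flatMap (splitTerm (skolemArity C V) σ)) (by
            simp only [reverseRule, splitRule, Rule.toFRule, List.mem_flatMap, List.mem_map]
            exact ⟨_, ⟨_, ⟨a, ha, rfl⟩, rfl⟩, by simp [reverseAtom, splitAtom]⟩)
        have : gs = a.args.map (Term.ground g) := by
          refine GTerm.list_ext h3 ?_ ?_ ?_
          · intro x hx
            obtain ⟨t, -, rfl⟩ := List.mem_map.1 hx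
            exact hasArity_groundOf _ _ _ _
          · rw [h1]
            simp only [List.map_map, Function.comp_def, hg, ← tagTerm_eq_tag (skolemArity C V) σ h]
          · rw [h2, map_eval_flatMap_splitTerm]
        exact this ▸ h4
    · simp only [adomRules, List.mem_append, List.mem_map, List.mem_flatMap, List.mem_range] at hr
      rcases hr with ⟨c, hc, rfl⟩ | ⟨i, -, j, hj, rfl⟩
      · exact ⟨c, rfl, Or.inl hc⟩
      · refine ⟨_, rfl, Or.inr ⟨i, _, hE i _ (List.mem_singleton.2 rfl), by simp, ?_⟩⟩
        simp only [List.map_map, List.mem_map, List.mem_range]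
        exact ⟨j, hj, rfl⟩

/-- The ground terms that occur in derived facts. -/
def IsNode (C : List α) (V : Fin n → CQAC B ℕ α) (J : Instance (Fin n) α) :
    GTerm (CQViewName n α × QVar) α → Prop
  | .const a => a ∈ activeDomain C V J
  | .app f l => f ∈ skolemFunctions C V ∧ (f.1, l) ∈ cqInstance C V J ∧
      l.length = skolemArity C V f

/-- Each argument of the head of a rule is a variable that is an argument of a subgoal. -/
def HasSafeHeads {E I X : Type} (P : Datalog E I X α) : Prop :=
  ∀ r ∈ P.rules, ∀ t ∈ r.head.args, (∃ x, t = .var x) ∧ ∃ a ∈ r.body, t ∈ a.args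

theorem mem_skolemFunctions {C : List α} {V : Fin n → CQAC B ℕ α} {f : CQViewName n α × QVar} :
    f ∈ skolemFunctions C V ↔ f.1 ∈ cqViewNames C n ∧
      (∃ a ∈ (cqViews C V f.1).body, f.2 ∈ a.vars) ∧ .var f.2 ∉ (cqViews C V f.1).head := by
  obtain ⟨w, x⟩ := f
  simp only [skolemFunctions, List.mem_flatMap, List.mem_map, List.mem_dedup, List.mem_filter]
  constructor
  · rintro ⟨w, hw, x, ⟨hx, hx'⟩, h⟩
    cases h
    exact ⟨hw, hx, by simpa using hx'⟩
  · rintro ⟨hw, hx, hx'⟩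
    exact ⟨w, hw, x, ⟨hx, by simpa using hx'⟩, rfl⟩

theorem mem_of_const_mem_cqViews {C : List α} {V : Fin n → CQAC B ℕ α}
    (hC : ∀ i, ∀ c ∈ (V i).consts, c ∈ C) {w : CQViewName n α} {a : Atom (ExtPred B α) QVar α}
    (ha : a ∈ (cqViews C V w).body) {c : α} (hc : .const c ∈ a.args) : c ∈ C := by
  cases w with
  | view i =>
    simp only [cqViews, cqTransform, List.mem_append, List.mem_map, List.mem_flatMap] at ha
    rcases ha with (⟨b, hb, rfl⟩ | ⟨x, hx, θ, hθ, c', hc', rfl⟩) | ⟨x, hx, y, hy, rfl⟩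
    · obtain ⟨t, ht, htc⟩ := List.mem_map.1 hc
      cases t with
      | var x => cases htc
      | const c' =>
        cases htc
        refine hC i c ?_
        simp only [CQAC.consts, List.mem_append, List.mem_flatMap, Atom.consts]
        exact Or.inl (Or.inr ⟨b, hb, _, ht, by simp [Term.consts]⟩)
    · simp at hc
    · simp at hc
  | u => simp [cqViews] at ha; subst ha; simp at hc
  | usi θ c' => simp [cqViews] at ha; subst ha; simp at hc

theorem mem_activeDomain_of_mem {C : List α} {V : Fin n → CQAC B ℕ α} {J : Instance (Fin n) α}
    {w : CQViewName n α} {l : List α} (h : (w, l) ∈ cqInstance C V J)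
    (hl : l.length = (cqViews C V w).head.length) {a : α} (ha : a ∈ l) :
    a ∈ activeDomain C V J := by
  cases w with
  | view i => exact Or.inr ⟨i, l, h, by simpa [cqViews, cqTransform] using hl, ha⟩
  | u =>
    obtain ⟨b, c, rfl, hb, hc, -⟩ := h
    simp at ha
    rcases ha with rfl | rfl <;> assumption
  | usi θ c =>
    obtain ⟨b, rfl, hb, -⟩ := h
    simp at ha
    exact ha ▸ hb

theorem isNode_of_modelDerives {C : List α} {V : Fin n → CQAC B ℕ α}
    (hC : ∀ i, ∀ c ∈ (V i).consts, c ∈ C) {P : Datalog (ExtPred B α) (QIdb α) QVar α}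
    (hP : HasSafeHeads P) {J : Instance (Fin n) α} {p : ExtPred B α ⊕ QIdb α}
    {gs : List (GTerm (CQViewName n α × QVar) α)} (H : ModelDerives C V P J p gs) :
    ∀ g ∈ gs, IsNode C V J g := by
  induction H with
  | inverse w hw h hD a ha =>
    intro g hg
    obtain ⟨t, ht, rfl⟩ := List.mem_map.1 hg
    cases t with
    | const c => exact Or.inl (mem_of_const_mem_cqViews hC ha ht)
    | var x =>
      simp only [inverseTerm]
      split
      · rename_i hx
        exact mem_activeDomain_of_mem hD (by simp) (List.mem_map_of_mem hx)
      · rename_i hx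
        exact ⟨mem_skolemFunctions.2 ⟨hw, ⟨a, ha, mem_atom_vars.2 ht⟩, hx⟩, hD, by
          simp [skolemArity]⟩
  | rule r hr g hb ih =>
    intro y hy
    obtain ⟨t, ht, rfl⟩ := List.mem_map.1 hy
    obtain ⟨-, a, ha, hta⟩ := hP r hr t ht
    exact ih a ha _ (List.mem_map_of_mem hta)

theorem derives_adom_iff {C : List α} {V : Fin n → CQAC B ℕ α}
    {P : Datalog (ExtPred B α) (QIdb α) QVar α} {k : ℕ} {J : Instance (Fin n) α} (a : α) :
    (rewritingOf C V P k).Derives J .adom [a] ↔ a ∈ activeDomain C V J := by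
  constructor
  · intro h
    obtain ⟨b, hb, h'⟩ := decodedFact_of_derives h
    cases hb
    exact h'
  · rintro (h | ⟨i, l, hJ, hl, ha⟩)
    · exact .fire (r := ⟨⟨⟨.adom, [.const a]⟩, []⟩, []⟩) (mem_rules_rewritingOf.2 (Or.inr (Or.inr
        (List.mem_append_left _ (List.mem_map.2 ⟨a, h, rfl⟩))))) (fun _ => a) (by simp) (by simp)
        (by simp)
    · obtain ⟨j, hj, rfl⟩ := List.mem_iff_getElem.1 ha
      let h : QVar × ℕ → α := fun y => match y.1 with
        | .aux m => l.getD m l[j]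
        | _ => l[j]
      have hh : (Term.var (QVar.aux j, 0) : Term _ α).eval h = l[j] := by
        simp [h, Term.eval, hj]
      rw [← hh]
      refine .fire (r := ⟨⟨⟨.adom, [.var (.aux j, 0)]⟩,
        [⟨.inl i, (List.range (V i).head.length).map fun m => .var (.aux m, 0)⟩]⟩, []⟩)
        (mem_rules_rewritingOf.2 (Or.inr (Or.inr (List.mem_append_right _ ?_)))) h ?_ (by simp)
        (by simp)
      · simp only [List.mem_flatMap, List.mem_map, List.mem_range]
        exact ⟨i, List.mem_finRange i, j, hl ▸ hj, rfl⟩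
      · intro e args he
        simp only [List.mem_singleton, Atom.mk.injEq, Sum.inl.injEq] at he
        obtain ⟨rfl, rfl⟩ := he
        convert hJ
        apply List.ext_getElem
        · simp [hl]
        · intro m h1 h2
          simp [h, Term.eval, h2]

theorem map_tag_inverse (C : List α) (V : Fin n → CQAC B ℕ α) (w : CQViewName n α)
    (h : QVar × ℕ → α) (l : List (Term QVar α)) :
    (l.map fun t => (inverseTerm (cqViews C V) w t).ground fun x => h (x, 0)).map GTerm.tag =
      (l.map (inverseTerm (cqViews C V) w)).map (tagFTerm fun _ => none) := by
  simp only [List.map_map, Function.comp_def, tagFTerm_eq_tag h]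

/-- The rewriting derives each fact of the logic program, with its function symbols encoded in the
predicates. -/
theorem derives_of_modelDerives {C : List α} {V : Fin n → CQAC B ℕ α}
    (hC : ∀ i, ∀ c ∈ (V i).consts, c ∈ C) {P : Datalog (ExtPred B α) (QIdb α) QVar α}
    (hP : HasSafeHeads P) {k : ℕ} {J : Instance (Fin n) α} {p : ExtPred B α ⊕ QIdb α}
    {gs : List (GTerm (CQViewName n α × QVar) α)} [Nonempty α] (H : ModelDerives C V P J p gs) :
    (rewritingOf C V P k).Derives J (.idb (p, gs.map GTerm.tag)) (gs.flatMap GTerm.flat) := by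
  induction H with
  | inverse w hw h hD a ha =>
    have hf := (derives_inverse_iff C V J ((rewritingOf C V P k).Derives J) derives_adom_iff w a
      fun y => h y.1).2 hD
    have := DatalogAC.Derives.fire (P := rewritingOf C V P k) _
      (mem_rules_rewritingOf.2 (Or.inl ⟨w, hw, a, ha, rfl⟩)) _ hf.1 hf.2.1 hf.2.2
    rw [map_tag_inverse C V w (fun y => h y.1)]
    have hs : ∀ t, (splitFTerm (skolemArity C V) (fun _ => none) t).map (Term.eval fun y => h y.1) =
        (t.ground h).flat := map_eval_splitFTerm _ fun y => h y.1
    simpa only [List.flatMap_map, reverseRule, splitRule, inverseRule, List.map_flatMap, hs]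
      using this
  | rule r hr g hb ih =>
    have hnode : ∀ a ∈ r.body, ∀ x ∈ a.vars, IsNode C V J (g x) := fun a ha x hx =>
      isNode_of_modelDerives hC hP (hb a ha) _ (List.mem_map.2 ⟨_, mem_atom_vars.1 hx, rfl⟩)
    -- The rule fires in the copy whose tags are the shapes of the values of its variables.
    let σ : QVar → Option (CQViewName n α × QVar) := fun x =>
      if x ∈ (r.body.flatMap Atom.vars).dedup then (g x).tag else none
    let h : QVar × ℕ → α := fun y => ((g y.1).flat[y.2]?).getD (Classical.arbitrary α)
    have hg : ∀ a ∈ r.body, ∀ x ∈ a.vars, groundOf (skolemArity C V) σ h x = g x := by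
      intro a ha x hx
      have hx' : x ∈ (r.body.flatMap Atom.vars).dedup :=
        List.mem_dedup.2 (List.mem_flatMap.2 ⟨a, ha, hx⟩)
      have hn := hnode a ha x hx
      simp only [groundOf, σ, if_pos hx', h]
      cases hgx : g x with
      | const c => simp [GTerm.tag, GTerm.flat]
      | app f l =>
        rw [hgx] at hn
        simp only [GTerm.tag, GTerm.flat, GTerm.app.injEq, true_and]
        apply List.ext_getElem
        · simp [hn.2.2]
        · intro m h1 h2
          simp [h2]
    have hg' : ∀ a ∈ r.body, ∀ t ∈ a.args, t.ground (groundOf (skolemArity C V) σ h) = t.ground g :=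
      fun a ha t ht => Term.ground_congr fun x hx =>
        hg a ha x (List.mem_flatMap.2 ⟨t, ht, hx⟩)
    have hσ : σ ∈ tagAssignments (skolemFunctions C V) (r.body.flatMap Atom.vars).dedup := by
      refine mem_tagAssignments (fun x hx f hf => ?_) fun x hx => if_neg hx
      obtain ⟨a, ha, hxa⟩ := List.mem_flatMap.1 (List.mem_dedup.1 hx)
      have hn := hnode a ha x hxa
      simp only [σ, if_pos hx] at hf
      cases hgx : g x with
      | const c => rw [hgx] at hf; cases hf
      | app f' l =>
        rw [hgx] at hf hn
        cases hf
        exact hn.1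
    have hhead : ∀ t ∈ r.head.args, t.ground (groundOf (skolemArity C V) σ h) = t.ground g := by
      intro t ht
      obtain ⟨-, a, ha, hta⟩ := hP r hr t ht
      exact hg' a ha t hta
    have hbody := body_reverseRule_toFRule C V σ r
    have hacs := acs_reverseRule_toFRule C V σ r
    have := DatalogAC.Derives.fire (P := rewritingOf C V P k) (D := J) _
      (mem_rules_rewritingOf.2 (Or.inr (Or.inl ⟨r, hr, σ, hσ, rfl⟩))) h (by simp [hbody]) (by
        intro i args hi
        rw [hbody, List.mem_map] at hi
        obtain ⟨a, ha, hai⟩ := hi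
        cases hai
        have := ih a ha
        rw [map_eval_flatMap_splitTerm]
        rw [← List.map_congr_left (hg' a ha)] at this
        simpa only [List.map_map, Function.comp_def, ← tagTerm_eq_tag] using this) (by simp [hacs])
    rw [← List.map_congr_left hhead]
    simpa only [List.map_map, Function.comp_def, reverseRule, splitRule, Rule.toFRule, tagFTerm,
      ← tagTerm_eq_tag, List.flatMap_map, splitFTerm, List.map_flatMap, map_eval_splitTerm]
      using this

/-- The answers of the rewriting are the tuples of constants that the logic program derives. -/
theorem modelDerives_of_mem_eval {C : List α} {V : Fin n → CQAC B ℕ α}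
    {P : Datalog (ExtPred B α) (QIdb α) QVar α} {k : ℕ} {J : Instance (Fin n) α} {t : List α}
    (h : t ∈ (rewritingOf C V P k).eval J) :
    ModelDerives C V P J (.inr P.query) (t.map GTerm.const) := by
  obtain ⟨gs, h1, h2, -, h4⟩ := decodedFact_of_derives h
  rw [← h2, ← eq_map_const_of_tag_eq_none fun g hg => ?_]
  · exact h4
  · have : g.tag ∈ gs.map GTerm.tag := List.mem_map_of_mem hg
    rw [show gs.map GTerm.tag = List.replicate k none from h1] at this
    exact (List.mem_replicate.1 this).2

theorem mem_eval_of_modelDerives {C : List α} {V : Fin n → CQAC B ℕ α} [Nonempty α]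
    (hC : ∀ i, ∀ c ∈ (V i).consts, c ∈ C) {P : Datalog (ExtPred B α) (QIdb α) QVar α}
    (hP : HasSafeHeads P) {J : Instance (Fin n) α} {t : List α}
    (h : ModelDerives C V P J (.inr P.query) (t.map GTerm.const)) :
    t ∈ (rewritingOf C V P t.length).eval J := by
  have := derives_of_modelDerives hC hP (k := t.length) h
  have htag : (t.map (GTerm.const (F := CQViewName n α × QVar))).map GTerm.tag =
      List.replicate t.length none := by
    simp [Function.comp_def, GTerm.tag]
  have hflat : (t.map (GTerm.const (F := CQViewName n α × QVar))).flatMap GTerm.flat = t := by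
    simp [List.flatMap_map, GTerm.flat]
  rwa [htag, hflat] at this

end Model

/-! ### The rules of the Datalog query -/

section QueryRules

variable {B α : Type}

theorem eq_siAC_of_toSI? {X : Type} {a : AC X α} {s : SI X α} (h : a.toSI? = some s) :
    a = siAC s.dir (.var s.var) s.const := by
  rcases a with ⟨x | x, op, y | y⟩ <;> cases op <;> simp [AC.toSI?] at h <;> subst h <;> rfl

theorem forall_mem_coreBody {Q : CQAC B ℕ α} {p : QAtom B α → Prop} :
    (∀ a ∈ coreBody Q, p a) ↔
      (∀ k a, Q.body[k]? = some a →
        p ⟨.inl (.base a.pred), a.args.zipIdx.map fun q => .var (.occ k q.2)⟩ ∧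
        ∀ j t, a.args[j]? = some t → p (utrAtom (.var (.occ k j)) (t.rename .orig)) ∧
          p (utrAtom (t.rename .orig) (.var (.occ k j)))) ∧
      ∀ j t, Q.head[j]? = some t → p (utrAtom (.var (.out j)) (t.rename .orig)) ∧
          p (utrAtom (t.rename .orig) (.var (.out j))) := by
  simp only [coreBody, List.mem_append, or_imp, forall_and, List.mem_flatMap, forall_exists_index,
    and_imp, List.mem_cons, eqAtoms, List.not_mem_nil, or_false, Prod.forall,
    List.mem_zipIdx_iff_getElem?]
  grind

theorem mem_outs {Q : CQAC B ℕ α} {t : Term QVar α} :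
    t ∈ outs Q ↔ ∃ i < Q.head.length, t = .var (.out i) := by
  simp [outs, eq_comm]

theorem exists_mem_guards_of_mem_outs {Q : CQAC B ℕ α} {t : Term QVar α} (ht : t ∈ outs Q) :
    ∃ a ∈ guards Q, t ∈ a.args :=
  ⟨_, List.mem_map_of_mem ht, by simp [utrAtom]⟩

theorem mem_vars_splitTerm {F X : Type} {ar : F → ℕ} {σ : X → Option F} {t : Term X α} {y : X × ℕ}
    {l : List (Term X α)} (ht : t ∈ l) (hy : y ∈ (splitTerm ar σ t).flatMap Term.vars) :
    y ∈ (l.flatMap (splitTerm ar σ)).flatMap Term.vars := by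
  simp only [List.mem_flatMap] at hy ⊢
  obtain ⟨s, hs, hys⟩ := hy
  exact ⟨s, ⟨t, ht, hs⟩, hys⟩

theorem siAC_mem_of_mem_sis {Q : CQAC B ℕ α} {s : SI ℕ α} (hs : s ∈ Q.sis) :
    siAC s.dir (.var s.var) s.const ∈ Q.acs := by
  obtain ⟨a, ha, h⟩ := List.mem_filterMap.1 hs
  exact eq_siAC_of_toSI? h ▸ ha

variable [LinearOrder α] {n : ℕ}

theorem var_mem_bodyVars_of_mem_sis {Q : CQAC B ℕ α} (hQ : Q.WellFormed) {s : SI ℕ α}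
    (hs : s ∈ Q.sis) : s.var ∈ Q.bodyVars := by
  refine hQ.safe_acs _ (siAC_mem_of_mem_sis hs) _ ?_
  cases s.dir <;> simp [AC.vars, siAC, Term.vars]

/-- The ACs of an RSI1 query hold if its semi-intervals do. -/
theorem acs_hold_iff_sis {Q : CQAC B ℕ α} (hQ : ∀ a ∈ Q.acs, a.toSI?.isSome) (h : ℕ → α) :
    (∀ a ∈ Q.acs, a.Holds h) ↔ ∀ s ∈ Q.sis, SIHolds s.dir (h s.var) s.const := by
  constructor
  · exact fun H s hs => (siAC_holds h _ _ _).1 (H _ (siAC_mem_of_mem_sis hs))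
  · intro H a ha
    obtain ⟨s, hs⟩ := Option.isSome_iff_exists.1 (hQ a ha)
    rw [eq_siAC_of_toSI? hs, siAC_holds]
    exact H s (List.mem_filterMap.2 ⟨a, ha, hs⟩)

theorem mem_queryDatalog_rules {C : List α} {Q : CQAC B ℕ α} {r : QRule B α} :
    r ∈ (queryDatalog C Q).rules ↔ r = queryRule Q ∨ r ∈ mappingRules Q ∨ r ∈ couplingRules Q ∨
      r ∈ linkRules C Q ∨ r ∈ transitiveRules C ∨ r ∈ transitiveSIRules C Q := by
  simp [queryDatalog]

theorem exists_mem_coreBody_of_mem_bodyVars {Q : CQAC B ℕ α} {x : ℕ} (hx : x ∈ Q.bodyVars) :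
    ∃ a ∈ coreBody Q, .var (.orig x) ∈ a.args := by
  by_contra hcon
  push Not at hcon
  obtain ⟨a, ha, hxa⟩ := List.mem_flatMap.1 hx
  obtain ⟨k, hk⟩ := List.mem_iff_getElem?.1 ha
  obtain ⟨j, hj⟩ := List.mem_iff_getElem?.1 (mem_atom_vars.1 hxa)
  refine (((forall_mem_coreBody (p := fun a => .var (.orig x) ∉ a.args)).1 hcon).1 k a hk).2 j _ hj
    |>.1 ?_
  simp [utrAtom, Term.rename]

theorem exists_mem_coreBody_of_mem_outs {Q : CQAC B ℕ α} {t : Term QVar α} (ht : t ∈ outs Q) :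
    ∃ a ∈ coreBody Q, t ∈ a.args := by
  obtain ⟨i, hi, rfl⟩ := mem_outs.1 ht
  by_contra hcon
  push Not at hcon
  refine ((forall_mem_coreBody (p := fun a => .var (.out i) ∉ a.args)).1 hcon).2 i _
    (List.getElem?_eq_getElem hi) |>.1 ?_
  simp [utrAtom]

theorem mem_lePairs {C₁ C₂ : List α} {p : α × α} :
    p ∈ lePairs C₁ C₂ ↔ p.1 ∈ C₁ ∧ p.2 ∈ C₂ ∧ p.1 ≤ p.2 := by
  obtain ⟨a, b⟩ := p
  simp [lePairs, List.mem_filter, and_assoc]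

theorem hasSafeHeads_queryDatalog (C : List α) {Q : CQAC B ℕ α} (hQ : Q.WellFormed) :
    HasSafeHeads (queryDatalog C Q) := by
  intro r hr t ht
  have hout : t ∈ outs Q → ∃ x, t = .var x := fun h =>
    let ⟨i, _, e⟩ := mem_outs.1 h
    ⟨_, e⟩
  rcases mem_queryDatalog_rules.1 hr with rfl | hr | hr | hr | hr | hr
  · obtain ⟨a, ha, hta⟩ := exists_mem_coreBody_of_mem_outs ht
    exact ⟨hout ht, a, List.mem_append_left _ ha, hta⟩
  · obtain ⟨⟨s, j⟩, hs, rfl⟩ := List.mem_map.1 hr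
    rcases List.mem_cons.1 ht with rfl | ht
    · have hs' : s ∈ Q.sis := List.mem_of_getElem? (List.mem_zipIdx_iff_getElem?.1 hs)
      obtain ⟨a, ha, hta⟩ :=
        exists_mem_coreBody_of_mem_bodyVars (var_mem_bodyVars_of_mem_sis hQ hs')
      exact ⟨⟨_, rfl⟩, a, List.mem_append_left _ ha, hta⟩
    · obtain ⟨a, ha, hta⟩ := exists_mem_coreBody_of_mem_outs ht
      exact ⟨hout ht, a, List.mem_append_left _ ha, hta⟩
  · obtain ⟨p, -, hr⟩ := List.mem_flatMap.1 hr
    simp only [List.mem_cons, List.not_mem_nil, or_false] at hr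
    rcases hr with rfl | rfl | rfl | rfl <;> rcases List.mem_cons.1 ht with rfl | ht
    all_goals
      first
      | exact ⟨⟨_, rfl⟩, by simp [asSubgoal, utrAtom, jAtom]⟩
      | exact ⟨hout ht, _, List.mem_cons_self, List.mem_cons_of_mem _ ht⟩
  · rcases List.mem_append.1 hr with hr | hr <;> obtain ⟨p, -, rfl⟩ := List.mem_map.1 hr <;>
      rcases List.mem_cons.1 ht with rfl | ht
    all_goals
      first
      | exact ⟨⟨_, rfl⟩, _, List.mem_cons_self, List.mem_cons_self⟩
      | obtain ⟨a, ha, hta⟩ := exists_mem_guards_of_mem_outs ht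
        exact ⟨hout ht, a, List.mem_cons_of_mem _ ha, hta⟩
  · simp only [transitiveRules, List.mem_append, List.mem_cons, List.not_mem_nil, or_false,
      List.mem_map] at hr
    rcases hr with (rfl | rfl) | ⟨p, -, rfl⟩ <;>
      simp only [List.mem_cons, List.not_mem_nil, or_false] at ht <;> rcases ht with rfl | rfl <;>
      exact ⟨⟨_, rfl⟩, by simp [utrAtom]⟩
  · rcases List.mem_append.1 hr with hr | hr <;> obtain ⟨p, -, rfl⟩ := List.mem_map.1 hr <;>
      rcases List.mem_cons.1 ht with rfl | ht
    all_goals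
      first
      | exact ⟨⟨_, rfl⟩, _, List.mem_cons_of_mem _ List.mem_cons_self, by simp [utrAtom]⟩
      | obtain ⟨a, ha, hta⟩ := exists_mem_guards_of_mem_outs ht
        exact ⟨hout ht, a, List.mem_cons_of_mem _ (List.mem_cons_of_mem _ ha), hta⟩

/-! ### Well-formedness -/

theorem wellFormed_inverseRule [Nonempty α] (C : List α) (V : Fin n → CQAC B ℕ α)
    (w : CQViewName n α) (a : Atom (ExtPred B α) QVar α) :
    (reverseRule
      (splitRule (skolemArity C V) (fun _ => none) (inverseRule C V w a))).WellFormed := by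
  set r := reverseRule (splitRule (skolemArity C V) (fun _ => none) (inverseRule C V w a)) with hr
  have hhead : ∀ x, .var x ∈ (cqViews C V w).head → (x, 0) ∈ r.body.flatMap Atom.vars := by
    intro x hx
    cases w with
    | view i =>
      rw [hr, body_inverseRule_view]
      refine List.mem_flatMap.2 ⟨_, List.mem_singleton.2 rfl, mem_atom_vars.2 ?_⟩
      exact List.mem_map.2 ⟨_, hx, rfl⟩
    | u =>
      simp [cqViews] at hx
      rcases hx with rfl | rfl
      · exact List.mem_cons_self
      · exact List.mem_cons_of_mem _ List.mem_cons_self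
    | usi θ c =>
      simp [cqViews] at hx
      subst hx
      exact List.mem_cons_self
  have hvars : ∀ t : Term QVar α, t ∈ (cqViews C V w).head →
      ∀ y ∈ (splitTerm (skolemArity C V) (fun _ => none) t).flatMap Term.vars,
        y ∈ r.body.flatMap Atom.vars := by
    intro t ht y hy
    cases t with
    | const c => simp [splitTerm, Term.vars] at hy
    | var x =>
      simp [splitTerm, Term.vars] at hy
      exact hy ▸ hhead x ht
  refine ⟨fun y hy => ?_, ?_, ?_⟩
  · simp only [Atom.vars, hr, reverseRule, splitRule, inverseRule, List.mem_flatMap] at hy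
    obtain ⟨s, ⟨ft, hft, hs⟩, hy⟩ := hy
    obtain ⟨t, ht, rfl⟩ := List.mem_map.1 hft
    cases t with
    | const c =>
      simp [inverseTerm, splitFTerm, splitTerm] at hs
      simp [hs, Term.vars] at hy
    | var x =>
      simp only [inverseTerm] at hs
      split at hs
      · rename_i hx
        exact hvars _ hx y (List.mem_flatMap.2 ⟨s, hs, hy⟩)
      · obtain ⟨t, ht', hs⟩ := List.mem_flatMap.1 hs
        exact hvars t ht' y (List.mem_flatMap.2 ⟨s, hs, hy⟩)
  · cases w with
    | view i => rw [hr, acs_inverseRule_view]; simp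
    | u =>
      have hb : r.body = [⟨.inr .adom, [.var (.aux 0, 0)]⟩, ⟨.inr .adom, [.var (.aux 1, 0)]⟩] := rfl
      have ha : r.acs = [⟨.var (.aux 0, 0), .le, .var (.aux 1, 0)⟩] := rfl
      rw [hb, ha]
      simp [AC.vars, Term.vars, Atom.vars]
    | usi θ c =>
      have hb : r.body = [⟨.inr .adom, [.var (.aux 0, 0)]⟩] := rfl
      have ha : r.acs = [siAC θ (.var (.aux 0, 0)) c] := rfl
      rw [hb, ha]
      cases θ <;> simp [AC.vars, Term.vars, Atom.vars, siAC]
  · cases w with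
    | view i =>
      rw [hr, acs_inverseRule_view]
      exact ⟨fun _ => Classical.arbitrary α, by simp⟩
    | u =>
      have ha : r.acs = [⟨.var (.aux 0, 0), .le, .var (.aux 1, 0)⟩] := rfl
      rw [ha]
      exact ⟨fun _ => Classical.arbitrary α, by simp [AC.Holds, Term.eval]⟩
    | usi θ c =>
      have ha : r.acs = [siAC θ (.var (.aux 0, 0)) c] := rfl
      rw [ha]
      exact ⟨fun _ => c, by cases θ <;> simp [siAC_holds, SIHolds, Term.eval]⟩

theorem isDatalogACRewriting_rewritingOf [Nonempty α] (C : List α) (V : Fin n → CQAC B ℕ α)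
    {P : Datalog (ExtPred B α) (QIdb α) QVar α} (hP : HasSafeHeads P) (k : ℕ) :
    IsDatalogACRewriting V (rewritingOf C V P k) := by
  intro r hr
  rcases mem_rules_rewritingOf.1 hr with ⟨w, hw, a, ha, rfl⟩ | ⟨r₀, hr₀, σ, hσ, rfl⟩ | hr
  · refine ⟨wellFormed_inverseRule C V w a, fun i args hi => ?_⟩
    cases w with
    | view i =>
      rw [body_inverseRule_view] at hi
      simp only [List.mem_singleton, Atom.mk.injEq, Sum.inl.injEq] at hi
      obtain ⟨rfl, rfl⟩ := hi
      simp [cqViews, cqTransform]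
    | u =>
      have hb : (reverseRule (splitRule (skolemArity C V) (fun _ => none)
        (inverseRule C V .u a))).body =
          [⟨.inr .adom, [.var (.aux 0, 0)]⟩, ⟨.inr .adom, [.var (.aux 1, 0)]⟩] := rfl
      rw [hb] at hi
      simp at hi
    | usi θ c =>
      have hb : (reverseRule (splitRule (skolemArity C V) (fun _ => none)
        (inverseRule C V (.usi θ c) a))).body = [⟨.inr .adom, [.var (.aux 0, 0)]⟩] := rfl
      rw [hb] at hi
      simp at hi
  · refine ⟨⟨fun y hy => ?_, ?_, ?_⟩, fun i args hi => ?_⟩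
    · simp only [Atom.vars, reverseRule, splitRule, Rule.toFRule, List.mem_flatMap] at hy
      obtain ⟨s, ⟨ft, hft, hs⟩, hy⟩ := hy
      obtain ⟨t, ht, rfl⟩ := List.mem_map.1 hft
      obtain ⟨-, a, ha, hta⟩ := hP r₀ hr₀ t ht
      rw [body_reverseRule_toFRule]
      exact List.mem_flatMap.2 ⟨_, List.mem_map.2 ⟨a, ha, rfl⟩,
        mem_vars_splitTerm hta (List.mem_flatMap.2 ⟨s, hs, hy⟩)⟩
    · rw [acs_reverseRule_toFRule]; simp
    · rw [acs_reverseRule_toFRule]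
      exact ⟨fun _ => Classical.arbitrary α, by simp⟩
    · rw [body_reverseRule_toFRule] at hi
      simp at hi
  · simp only [adomRules, List.mem_append, List.mem_map, List.mem_flatMap, List.mem_range] at hr
    rcases hr with ⟨c, hc, rfl⟩ | ⟨i, -, j, hj, rfl⟩
    · exact ⟨⟨by simp [Atom.vars, Term.vars], by simp, fun _ => c, by simp⟩, by simp⟩
    · refine ⟨⟨?_, by simp, fun _ => Classical.arbitrary α, by simp⟩, ?_⟩
      · simp [Atom.vars, Term.vars, List.flatMap_map, hj]
      · intro e args he
        simp only [List.mem_singleton, Atom.mk.injEq, Sum.inl.injEq] at he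
        obtain ⟨rfl, rfl⟩ := he
        simp

end QueryRules

/-! ### Soundness -/

section Soundness

variable {B α : Type} [LinearOrder α] {n : ℕ}

/-- The meaning of the predicates over a database `D`. The fact `J_{≥ c}(x)` only promises `x ≤ c`
and not `x < c`, as it also comes from `U_{≤ c}`; dually for `J_{≤ c}(x)`. -/
def Sound (Q : CQAC B ℕ α) (D : Instance B α) : ExtPred B α ⊕ QIdb α → List α → Prop
  | .inl (.base b), l => (b, l) ∈ D
  | .inl .U, l => ∀ x y, l = [x, y] → x ≤ y
  | .inl (.Usi θ c), l => ∀ x, l = [x] → SIHolds θ x c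
  | .inr .Utr, l => ∀ x y, l = [x, y] → x ≤ y
  | .inr (.I θ c), l => ∀ x o, l = x :: o → o ∈ Q.eval D ∨ SIHolds θ x c
  | .inr (.J .le c), l => ∀ x o, l = x :: o → o ∈ Q.eval D ∨ c ≤ x
  | .inr (.J .ge c), l => ∀ x o, l = x :: o → o ∈ Q.eval D ∨ x ≤ c
  | .inr .query, l => l ∈ Q.eval D

variable {C : List α} {Q : CQAC B ℕ α} {D : Instance B α} {h : QVar → α}

/-- A sound match of the relational part of the query is a match of the original subgoals, whose
head is the output tuple. -/
theorem sound_coreBody (H : ∀ a ∈ coreBody Q, Sound Q D a.pred (a.args.map (Term.eval h))) :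
    (∀ a ∈ Q.body, (a.pred, a.args.map (Term.eval fun x => h (.orig x))) ∈ D) ∧
      (outs Q).map (Term.eval h) = Q.head.map (Term.eval fun x => h (.orig x)) := by
  rw [forall_mem_coreBody] at H
  have heq : ∀ (x : QVar) (t : Term ℕ α),
      Sound Q D (utrAtom (B := B) (.var x) (t.rename .orig)).pred
        ((utrAtom (B := B) (.var x) (t.rename .orig)).args.map (Term.eval h)) ∧
      Sound Q D (utrAtom (B := B) (t.rename .orig) (.var x)).pred
        ((utrAtom (B := B) (t.rename .orig) (.var x)).args.map (Term.eval h)) →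
      h x = t.eval fun x => h (.orig x) := by
    intro x t ⟨h1, h2⟩
    rw [← Term.eval_rename]
    exact le_antisymm (h1 _ _ rfl) (h2 _ _ rfl)
  constructor
  · intro a ha
    obtain ⟨k, hk⟩ := List.mem_iff_getElem?.1 ha
    obtain ⟨h1, h2⟩ := H.1 k a hk
    have : ((a.args.zipIdx.map fun q => (.var (.occ k q.2) : Term QVar α)).map (Term.eval h)) =
        a.args.map (Term.eval fun x => h (.orig x)) := by
      apply List.ext_getElem
      · simp
      · intro j hj hj'
        simp only [List.length_map] at hj'
        simpa [Term.eval] using heq _ _ (h2 j _ (List.getElem?_eq_getElem hj'))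
    exact this ▸ h1
  · apply List.ext_getElem
    · simp [outs]
    · intro j hj hj'
      simp only [List.length_map] at hj'
      simpa [Term.eval, outs] using heq _ _ (H.2 j _ (List.getElem?_eq_getElem hj'))

theorem sound_query_rules (hQ : ∀ a ∈ Q.acs, a.toSI?.isSome) {r : QRule B α}
    (hr : r ∈ (queryDatalog C Q).rules)
    (H : ∀ a ∈ r.body, Sound Q D a.pred (a.args.map (Term.eval h))) :
    Sound Q D (.inr r.head.pred) (r.head.args.map (Term.eval h)) := by
  rcases mem_queryDatalog_rules.1 hr with rfl | hr | hr | hr | hr | hr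
  · obtain ⟨h1, h2⟩ := sound_coreBody fun a ha => H a (List.mem_append_left _ ha)
    change (outs Q).map (Term.eval h) ∈ Q.eval D
    by_contra hcon
    refine hcon ⟨_, h1, (acs_hold_iff_sis hQ _).2 fun s hs => ?_, h2⟩
    exact (H _ (List.mem_append_right _ (List.mem_map_of_mem hs)) _ _ rfl).resolve_left hcon
  · obtain ⟨⟨s, j⟩, hs, rfl⟩ := List.mem_map.1 hr
    obtain ⟨h1, h2⟩ := sound_coreBody fun a ha => H a (List.mem_append_left _ ha)
    have key : (outs Q).map (Term.eval h) ∈ Q.eval D ∨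
        ¬ SIHolds s.dir (h (.orig s.var)) s.const := by
      by_contra! hcon
      refine hcon.1 ⟨_, h1, (acs_hold_iff_sis hQ _).2 fun s' hs' => ?_, h2⟩
      obtain ⟨m, hm⟩ := List.mem_iff_getElem?.1 hs'
      rw [List.mem_zipIdx_iff_getElem?] at hs
      by_cases hmj : m = j
      · subst hmj
        rw [hs] at hm
        cases hm
        exact hcon.2
      · have : s' ∈ Q.sis.eraseIdx j := List.mem_eraseIdx_iff_getElem?.2 ⟨m, hmj, hm⟩
        exact (H _ (List.mem_append_right _ (List.mem_map_of_mem this)) _ _ rfl).resolve_left hcon.1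
    obtain ⟨x, θ, c⟩ := s
    cases θ <;> rintro x' o ⟨⟩ <;> exact key.imp_right fun hn => (not_le.1 hn).le
  · obtain ⟨p, hp, hr⟩ := List.mem_flatMap.1 hr
    obtain ⟨-, -, hp⟩ := mem_lePairs.1 hp
    simp only [List.mem_cons, List.not_mem_nil, or_false] at hr
    rcases hr with rfl | rfl | rfl | rfl <;> rintro x o ⟨⟩
    · exact (H _ List.mem_cons_self _ _ rfl).imp_right fun hx => hx.trans hp
    · exact (H _ List.mem_cons_self _ _ rfl).imp_right fun hx => hp.trans hx
    · have h2 := H _ (List.mem_cons_of_mem _ List.mem_cons_self) _ _ rfl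
      exact (H _ List.mem_cons_self _ _ rfl).imp_right fun hx => (h2.trans hx).trans hp
    · have h2 := H _ (List.mem_cons_of_mem _ List.mem_cons_self) _ _ rfl
      exact (H _ List.mem_cons_self _ _ rfl).imp_right fun hx => (hp.trans hx).trans h2
  · rcases List.mem_append.1 hr with hr | hr <;> obtain ⟨p, hp, rfl⟩ := List.mem_map.1 hr <;>
      obtain ⟨-, -, hp⟩ := mem_lePairs.1 hp <;> rintro x o ⟨⟩ <;> right
    · exact (H _ List.mem_cons_self _ rfl : _ ≤ _).trans hp
    · exact hp.trans (H _ List.mem_cons_self _ rfl : _ ≤ _)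
  · simp only [transitiveRules, List.mem_append, List.mem_cons, List.not_mem_nil, or_false,
      List.mem_map] at hr
    rcases hr with (rfl | rfl) | ⟨p, hp, rfl⟩ <;> rintro x y ⟨⟩
    · exact H _ List.mem_cons_self _ _ rfl
    · exact (H _ List.mem_cons_self _ _ rfl).trans
        (H _ (List.mem_cons_of_mem _ List.mem_cons_self) _ _ rfl)
    · obtain ⟨-, -, hp⟩ := mem_lePairs.1 hp
      have h1 : _ ≤ _ := H _ List.mem_cons_self _ rfl
      have h2 : _ ≤ _ := H _ (List.mem_cons_of_mem _ List.mem_cons_self) _ rfl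
      have h3 := H _ (List.mem_cons_of_mem _ (List.mem_cons_of_mem _ List.mem_cons_self)) _ _ rfl
      exact ((h1.trans hp).trans h2).trans h3
  · rcases List.mem_append.1 hr with hr | hr <;> obtain ⟨p, hp, rfl⟩ := List.mem_map.1 hr <;>
      obtain ⟨-, -, hp⟩ := mem_lePairs.1 hp <;> rintro x o ⟨⟩ <;> right <;>
      have h1 : _ ≤ _ := H _ List.mem_cons_self _ rfl <;>
      have h2 := H _ (List.mem_cons_of_mem _ List.mem_cons_self) _ _ rfl
    · exact (h2.trans h1).trans hp
    · exact (hp.trans h1).trans h2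

open Classical in
/-- A valuation of the variables of the view `V i` that yields the tuple `l`, if there is one. -/
noncomputable def witness [Nonempty α] (V : Fin n → CQAC B ℕ α) (D : Instance B α) (i : Fin n)
    (l : List α) : ℕ → α :=
  if H : l ∈ (V i).eval D then H.choose else fun _ => Classical.arbitrary α

theorem witness_spec [Nonempty α] {V : Fin n → CQAC B ℕ α} {i : Fin n} {l : List α}
    (H : l ∈ (V i).eval D) :
    (∀ a ∈ (V i).body, (a.pred, a.args.map (Term.eval (witness V D i l))) ∈ D) ∧
    (∀ a ∈ (V i).acs, a.Holds (witness V D i l)) ∧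
    l = (V i).head.map (Term.eval (witness V D i l)) := by
  have : witness V D i l = H.choose := dif_pos H
  rw [this]
  exact H.choose_spec

/-- The value of a ground term in `D`: a Skolem term stands for a witness of its view tuple. -/
noncomputable def GTerm.value [Nonempty α] (V : Fin n → CQAC B ℕ α) (D : Instance B α) :
    GTerm (CQViewName n α × QVar) α → α
  | .const c => c
  | .app (.view i, .orig x) l => witness V D i l x
  | .app _ _ => Classical.arbitrary α

/-- The ground term for a term of the view `V i`, for the tuple given by `h`. -/
noncomputable def skolemize (C : List α) (V : Fin n → CQAC B ℕ α) (i : Fin n) (h : QVar → α)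
    (t : Term ℕ α) : GTerm (CQViewName n α × QVar) α :=
  (inverseTerm (cqViews C V) (.view i) (t.rename .orig)).ground h

theorem var_mem_head_cqViews {V : Fin n → CQAC B ℕ α} {i : Fin n} {x : ℕ} :
    .var (.orig x) ∈ (cqViews C V (.view i)).head ↔ .var x ∈ (V i).head := by
  simp only [cqViews, cqTransform, List.mem_map]
  constructor
  · rintro ⟨t | t, ht, h⟩
    · cases h; exact ht
    · cases h
  · exact fun h => ⟨_, h, rfl⟩

theorem map_eval_head_cqViews {V : Fin n → CQAC B ℕ α} (i : Fin n) (h : QVar → α) :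
    (cqViews C V (.view i)).head.map (Term.eval h) =
      (V i).head.map (Term.eval fun x => h (.orig x)) :=
  Term.map_eval_map_rename _ _ _

theorem skolemize_var_of_mem {V : Fin n → CQAC B ℕ α} {i : Fin n} {x : ℕ} (h : QVar → α)
    (hx : .var x ∈ (V i).head) : skolemize C V i h (.var x) = .const (h (.orig x)) := by
  simp only [skolemize, Term.rename, inverseTerm, var_mem_head_cqViews, hx, if_true]
  rfl

theorem skolemize_var_of_notMem {V : Fin n → CQAC B ℕ α} {i : Fin n} {x : ℕ} (h : QVar → α)
    (hx : .var x ∉ (V i).head) : skolemize C V i h (.var x) =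
      .app (.view i, .orig x) ((V i).head.map (Term.eval fun x => h (.orig x))) := by
  simp only [skolemize, Term.rename, inverseTerm, var_mem_head_cqViews, hx, if_false, FTerm.ground,
    map_eval_head_cqViews]

theorem value_skolemize [Nonempty α] {V : Fin n → CQAC B ℕ α} {i : Fin n} (h : QVar → α)
    (H : (V i).head.map (Term.eval fun x => h (.orig x)) ∈ (V i).eval D) (t : Term ℕ α) :
    (skolemize C V i h t).value V D =
      t.eval (witness V D i ((V i).head.map (Term.eval fun x => h (.orig x)))) := by
  cases t with
  | const c => rfl
  | var x =>
    by_cases hx : .var x ∈ (V i).head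
    · rw [skolemize_var_of_mem h hx]
      exact List.map_inj_left.1 (witness_spec H).2.2 _ hx
    · rw [skolemize_var_of_notMem h hx]
      rfl

theorem forall_mem_body_cqViews {V : Fin n → CQAC B ℕ α} {i : Fin n}
    {p : Atom (ExtPred B α) QVar α → Prop} :
    (∀ a ∈ (cqViews C V (.view i)).body, p a) ↔
      (∀ a ∈ (V i).body, p ⟨.base a.pred, a.args.map (Term.rename .orig)⟩) ∧
      (∀ x ∈ (V i).bodyVars, ∀ θ, ∀ c ∈ C, AC.Implies (V i).acs (siAC θ (.var x) c) →
        p ⟨.Usi θ c, [.var (.orig x)]⟩) ∧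
      ∀ x ∈ (V i).bodyVars, ∀ y ∈ (V i).bodyVars, AC.Implies (V i).acs ⟨.var x, .le, .var y⟩ →
        p ⟨.U, [.var (.orig x), .var (.orig y)]⟩ := by
  simp only [cqViews, cqTransform, List.mem_append, List.mem_map, List.mem_flatMap, or_imp,
    forall_and, forall_exists_index, and_imp, forall_apply_eq_imp_iff₂, List.mem_filter,
    decide_eq_true_eq, and_assoc]
  refine and_congr_right fun _ => and_congr ⟨?_, ?_⟩ ⟨?_, ?_⟩
  · intro H x hx θ c hc hi
    exact H _ x hx θ (by cases θ <;> simp) c hc hi rfl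
  · rintro H _ x hx θ - c hc hi rfl
    exact H x hx θ c hc hi
  · exact fun H x hx y hy hi => H _ x hx y hy hi rfl
  · rintro H _ x hx y hy hi rfl
    exact H x hx y hy hi

/-- The logic program derives only facts that are sound in each database that yields `J`. -/
theorem sound_of_modelDerives [Nonempty α] {V : Fin n → CQAC B ℕ α}
    (hQ : ∀ a ∈ Q.acs, a.toSI?.isSome) {J : Instance (Fin n) α} (hJ : J ⊆ viewOutput V D)
    {p : ExtPred B α ⊕ QIdb α} {gs : List (GTerm (CQViewName n α × QVar) α)}
    (H : ModelDerives C V (queryDatalog C Q) J p gs) :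
    Sound Q D p (gs.map (GTerm.value V D)) := by
  induction H with
  | inverse w hw h hD a ha =>
    cases w with
    | view i =>
      have hD' : (i, (V i).head.map (Term.eval fun x => h (.orig x))) ∈ J := by
        rw [← map_eval_head_cqViews (C := C)]; exact hD
      have hD'' := hJ hD'
      obtain ⟨h1, h2, h3⟩ := witness_spec hD''
      have hval := value_skolemize (C := C) h hD''
      revert a
      rw [forall_mem_body_cqViews]
      refine ⟨fun a ha => ?_, fun x hx θ c hc hi => ?_, fun x hx y hy hi => ?_⟩
      · have := h1 a ha
        simp only [List.map_map]
        rw [← List.map_congr_left fun t _ => hval t] at this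
        exact this
      · rintro x' hx'
        have hx'' : (skolemize C V i h (.var x)).value V D = x' := (List.cons.inj hx').1
        rw [← hx'', hval]
        exact (siAC_holds _ _ _ _).1 (hi _ h2)
      · rintro x' y' hxy
        have hx'' : (skolemize C V i h (.var x)).value V D = x' := (List.cons.inj hxy).1
        have hy'' : (skolemize C V i h (.var y)).value V D = y' :=
          (List.cons.inj (List.cons.inj hxy).2).1
        rw [← hx'', ← hy'', hval, hval]
        exact hi _ h2
    | u =>
      simp only [cqViews, List.mem_singleton] at ha
      subst ha
      obtain ⟨x, y, hxy, -, -, hle⟩ := hD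
      rintro x' y' ⟨⟩
      cases hxy
      exact hle
    | usi θ c =>
      simp only [cqViews, List.mem_singleton] at ha
      subst ha
      obtain ⟨x, hx, -, hle⟩ := hD
      rintro x' hx'
      cases hx
      rw [← (List.cons.inj hx').1]
      exact hle
  | rule r hr g hb ih =>
    have hground : ∀ l : List (Term QVar α), (l.map (Term.ground g)).map (GTerm.value V D) =
        l.map (Term.eval fun x => (g x).value V D) := by
      intro l
      rw [List.map_map]
      refine List.map_congr_left fun t _ => ?_
      cases t <;> rfl
    rw [hground]
    exact sound_query_rules hQ hr fun a ha => hground a.args ▸ ih a ha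

end Soundness

/-! ### Derived facts of the logic program -/

section Derivations

variable {B α : Type}

/-- Values for the auxiliary and the output variables of the rules. -/
def ruleVal {T : Type} (x y z : T) (o : List T) : QVar → T
  | .aux 0 => x
  | .aux 1 => y
  | .aux 2 => z
  | .out i => o.getD i x
  | _ => x

theorem map_ground_outs {Q : CQAC B ℕ α} {F : Type} {x : GTerm F α} {o : List (GTerm F α)}
    {g : QVar → GTerm F α} (ho : o.length = Q.head.length) (hg : ∀ i, g (.out i) = o.getD i x) :
    (outs Q).map (Term.ground g) = o := by
  apply List.ext_getElem
  · simp [outs, ho]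
  · intro i h1 h2
    simp [outs, Term.ground, hg, h2]

theorem finite_activeDomain {n : ℕ} {C : List α} {V : Fin n → CQAC B ℕ α} {J : Instance (Fin n) α}
    (hJ : J.Finite) : (activeDomain C V J).Finite := by
  refine ((List.finite_toSet C).union (hJ.biUnion fun f _ => List.finite_toSet f.2)).subset ?_
  rintro a (h | ⟨i, l, h, -, ha⟩)
  · exact Or.inl h
  · exact Or.inr (Set.mem_biUnion h ha)

variable [LinearOrder α] {n : ℕ} {C : List α} {Q : CQAC B ℕ α}
  {V : Fin n → CQAC B ℕ α} {J : Instance (Fin n) α}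

/-- The facts derived from `J` by the inverse rules and the Datalog query of `Q`. -/
abbrev QueryDerives (C : List α) (Q : CQAC B ℕ α) (V : Fin n → CQAC B ℕ α)
    (J : Instance (Fin n) α) :
    ExtPred B α ⊕ QIdb α → List (GTerm (CQViewName n α × QVar) α) → Prop :=
  ModelDerives C V (queryDatalog C Q) J

/-- `U^tr(x, y)` is derived. On the terms that occur in facts it is a preorder. -/
abbrev UtrDerives (C : List α) (Q : CQAC B ℕ α) (V : Fin n → CQAC B ℕ α) (J : Instance (Fin n) α)
    (x y : GTerm (CQViewName n α × QVar) α) : Prop :=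
  QueryDerives C Q V J (.inr .Utr) [x, y]

local notation "Der" => QueryDerives C Q V J
local notation "Utr" => UtrDerives C Q V J

variable {x y z : GTerm (CQViewName n α × QVar) α} {o : List (GTerm (CQViewName n α × QVar) α)}

theorem utr_of_u (h : Der (.inl .U) [x, y]) : Utr x y := by
  refine LogicDerives.rule (r := ⟨⟨.Utr, [vX, vY]⟩, [⟨.inl .U, [vX, vY]⟩]⟩)
    (mem_queryDatalog_rules.2 (by simp [transitiveRules])) (ruleVal x y y []) ?_
  exact List.forall_mem_singleton.2 h

theorem utr_of_u_of_utr (h : Der (.inl .U) [x, z]) (h' : Utr z y) : Utr x y := by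
  refine LogicDerives.rule (r := ⟨⟨.Utr, [vX, vY]⟩, [⟨.inl .U, [vX, vZ]⟩, utrAtom vZ vY]⟩)
    (mem_queryDatalog_rules.2 (by simp [transitiveRules])) (ruleVal x y z []) ?_
  simpa using ⟨h, h'⟩

theorem utr_of_usi {c c' : α} (hc : c ∈ C) (hc' : c' ∈ C) (hcc' : c ≤ c')
    (h : Der (.inl (.Usi .le c)) [x]) (h' : Der (.inl (.Usi .ge c')) [z]) (h'' : Utr z y) :
    Utr x y := by
  refine LogicDerives.rule (r := ⟨⟨.Utr, [vX, vY]⟩,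
      [⟨.inl (.Usi .le c), [vX]⟩, ⟨.inl (.Usi .ge c'), [vZ]⟩, utrAtom vZ vY]⟩)
    (mem_queryDatalog_rules.2 ?_) (ruleVal x y z []) ?_
  · have : (c, c') ∈ lePairs C C := mem_lePairs.2 ⟨hc, hc', hcc'⟩
    simp [transitiveRules]
    grind
  · simpa using ⟨h, h', h''⟩

theorem forall_mem_guards (ho : o.length = Q.head.length) (hoo : ∀ g ∈ o, Utr g g)
    {g : QVar → GTerm (CQViewName n α × QVar) α} (hg : ∀ i, g (.out i) = o.getD i x) :
    ∀ a ∈ guards Q, Der a.pred (a.args.map (Term.ground g)) := by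
  intro a ha
  obtain ⟨t, ht, rfl⟩ := List.mem_map.1 ha
  have := map_ground_outs ho hg
  exact hoo (t.ground g) (this ▸ List.mem_map_of_mem ht)

theorem j_ge_of_usi {c c₁ : α} (hc : c ∈ C) (hc₁ : c₁ ∈ siConsts Q) (hcc : c ≤ c₁)
    (ho : o.length = Q.head.length) (hoo : ∀ g ∈ o, Utr g g)
    (h : Der (.inl (.Usi .le c)) [y]) (h' : Utr x y) : Der (.inr (.J .ge c₁)) (x :: o) := by
  have ho' := map_ground_outs (g := ruleVal x y y o) (x := x) ho fun i => rfl
  have := LogicDerives.rule (ws := cqViewNames C n) (def_ := cqViews C V) (P := queryDatalog C Q)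
    (D := cqInstance C V J)
    ⟨jAtom Q .ge c₁ vX, ⟨.inl (.Usi .le c), [vY]⟩ :: utrAtom vX vY :: guards Q⟩
    (mem_queryDatalog_rules.2 (by
      simp only [transitiveSIRules, List.mem_append, List.mem_map]
      have : (c, c₁) ∈ lePairs C (siConsts Q) := mem_lePairs.2 ⟨hc, hc₁, hcc⟩
      grind)) (ruleVal x y y o) (by
      simp only [List.forall_mem_cons]
      exact ⟨h, h', forall_mem_guards (x := x) ho hoo fun i => rfl⟩)
  simp only [jAtom, List.map_cons, ho'] at this
  exact this

theorem j_le_of_usi {c c₁ : α} (hc : c ∈ C) (hc₁ : c₁ ∈ siConsts Q) (hcc : c₁ ≤ c)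
    (ho : o.length = Q.head.length) (hoo : ∀ g ∈ o, Utr g g)
    (h : Der (.inl (.Usi .ge c)) [y]) (h' : Utr y x) : Der (.inr (.J .le c₁)) (x :: o) := by
  have ho' := map_ground_outs (g := ruleVal x y y o) (x := x) ho fun i => rfl
  have := LogicDerives.rule (ws := cqViewNames C n) (def_ := cqViews C V) (P := queryDatalog C Q)
    (D := cqInstance C V J)
    ⟨jAtom Q .le c₁ vX, ⟨.inl (.Usi .ge c), [vY]⟩ :: utrAtom vY vX :: guards Q⟩
    (mem_queryDatalog_rules.2 (by
      simp only [transitiveSIRules, List.mem_append, List.mem_map]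
      have : (c₁, c) ∈ lePairs (siConsts Q) C := mem_lePairs.2 ⟨hc₁, hc, hcc⟩
      grind)) (ruleVal x y y o) (by
      simp only [List.forall_mem_cons]
      exact ⟨h, h', forall_mem_guards (x := x) ho hoo fun i => rfl⟩)
  simp only [jAtom, List.map_cons, ho'] at this
  exact this

theorem i_ge_of_j_le {c : α} (hc : c ∈ siConsts Q) (ho : o.length = Q.head.length)
    (h : Der (.inr (.J .le c)) (x :: o)) : Der (.inr (.I .ge c)) (x :: o) := by
  have ho' := map_ground_outs (g := ruleVal x x x o) (x := x) ho fun i => rfl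
  have := LogicDerives.rule (ws := cqViewNames C n) (def_ := cqViews C V) (P := queryDatalog C Q)
    (D := cqInstance C V J)
    ⟨iAtom Q .ge c vX, [asSubgoal (jAtom Q .le c vX)]⟩
    (mem_queryDatalog_rules.2 (by
      have : (c, c) ∈ lePairs (siConsts Q) (siConsts Q) := mem_lePairs.2 ⟨hc, hc, le_rfl⟩
      have : _ ∈ couplingRules Q := List.mem_flatMap.2 ⟨_, this, List.mem_cons_of_mem _
        List.mem_cons_self⟩
      exact Or.inr (Or.inr (Or.inl this)))) (ruleVal x x x o) (by
      simp only [List.forall_mem_singleton, asSubgoal, jAtom, List.map_cons, ho']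
      exact h)
  simp only [iAtom, List.map_cons, ho'] at this
  exact this

theorem i_le_of_j_ge {c c' : α} (hc : c ∈ siConsts Q) (hc' : c' ∈ siConsts Q) (hcc : c ≤ c')
    (ho : o.length = Q.head.length) (h : Der (.inr (.J .ge c)) (y :: o)) (h' : Utr x y) :
    Der (.inr (.I .le c')) (x :: o) := by
  have ho' := map_ground_outs (g := ruleVal x y x o) (x := x) ho fun i => rfl
  have := LogicDerives.rule (ws := cqViewNames C n) (def_ := cqViews C V) (P := queryDatalog C Q)
    (D := cqInstance C V J)
    ⟨iAtom Q .le c' vX, [asSubgoal (jAtom Q .ge c vY), utrAtom vX vY]⟩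
    (mem_queryDatalog_rules.2 (by
      have : (c, c') ∈ lePairs (siConsts Q) (siConsts Q) := mem_lePairs.2 ⟨hc, hc', hcc⟩
      have : _ ∈ couplingRules Q := List.mem_flatMap.2 ⟨_, this, List.mem_cons_of_mem _
        (List.mem_cons_of_mem _ List.mem_cons_self)⟩
      exact Or.inr (Or.inr (Or.inl this)))) (ruleVal x y x o) (by
      simp only [List.forall_mem_cons, asSubgoal, jAtom, List.map_cons, ho']
      exact ⟨h, h', by simp⟩)
  simp only [iAtom, List.map_cons, ho'] at this
  exact this

theorem i_le_of_j_ge_self {c : α} (hc : c ∈ siConsts Q)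
    (ho : o.length = Q.head.length) (h : Der (.inr (.J .ge c)) (x :: o)) :
    Der (.inr (.I .le c)) (x :: o) := by
  have ho' := map_ground_outs (g := ruleVal x x x o) (x := x) ho fun i => rfl
  have := LogicDerives.rule (ws := cqViewNames C n) (def_ := cqViews C V) (P := queryDatalog C Q)
    (D := cqInstance C V J)
    ⟨iAtom Q .le c vX, [asSubgoal (jAtom Q .ge c vX)]⟩
    (mem_queryDatalog_rules.2 (by
      have : (c, c) ∈ lePairs (siConsts Q) (siConsts Q) := mem_lePairs.2 ⟨hc, hc, le_rfl⟩
      have : _ ∈ couplingRules Q := List.mem_flatMap.2 ⟨_, this, List.mem_cons_self⟩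
      exact Or.inr (Or.inr (Or.inl this)))) (ruleVal x x x o) (by
      simp only [List.forall_mem_singleton, asSubgoal, jAtom, List.map_cons, ho']
      exact h)
  simp only [iAtom, List.map_cons, ho'] at this
  exact this

theorem query_of_coreBody {g : QVar → GTerm (CQViewName n α × QVar) α}
    (ho : (outs Q).map (Term.ground g) = o)
    (h : ∀ a ∈ coreBody Q, Der a.pred (a.args.map (Term.ground g)))
    (h' : ∀ s ∈ Q.sis, Der (.inr (.I s.dir s.const)) (g (.orig s.var) :: o)) :
    Der (.inr .query) o := by
  have := LogicDerives.rule (ws := cqViewNames C n) (def_ := cqViews C V) (P := queryDatalog C Q)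
    (D := cqInstance C V J) (queryRule Q) (mem_queryDatalog_rules.2 (Or.inl rfl)) g (by
      intro a ha
      rcases List.mem_append.1 ha with ha | ha
      · exact h a ha
      · obtain ⟨s, hs, rfl⟩ := List.mem_map.1 ha
        have := h' s hs
        rw [← ho] at this
        exact this)
  rw [← ho]
  exact this

theorem j_of_coreBody {g : QVar → GTerm (CQViewName n α × QVar) α}
    (ho : (outs Q).map (Term.ground g) = o)
    (h : ∀ a ∈ coreBody Q, Der a.pred (a.args.map (Term.ground g))) {j : ℕ} {s : SI ℕ α}
    (hj : Q.sis[j]? = some s)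
    (h' : ∀ s ∈ Q.sis.eraseIdx j, Der (.inr (.I s.dir s.const)) (g (.orig s.var) :: o)) :
    Der (.inr (.J s.dir s.const)) (g (.orig s.var) :: o) := by
  have := LogicDerives.rule (ws := cqViewNames C n) (def_ := cqViews C V) (P := queryDatalog C Q)
    (D := cqInstance C V J) _ (mem_queryDatalog_rules.2 (Or.inr (Or.inl
      (List.mem_map.2 ⟨(s, j), List.mem_zipIdx_iff_getElem?.2 hj, rfl⟩)))) g (by
      intro a ha
      rcases List.mem_append.1 ha with ha | ha
      · exact h a ha
      · obtain ⟨s, hs, rfl⟩ := List.mem_map.1 ha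
        have := h' s hs
        rw [← ho] at this
        exact this)
  rw [← ho]
  exact this

theorem u_const {a b : α} (ha : a ∈ activeDomain C V J) (hb : b ∈ activeDomain C V J)
    (hab : a ≤ b) : Der (.inl .U) [.const a, .const b] := by
  have := LogicDerives.inverse (ws := cqViewNames C n) (def_ := cqViews C V)
    (P := queryDatalog C Q) (D := cqInstance C V J) .u (by simp [cqViewNames])
    (ruleVal a b b []) ⟨a, b, rfl, ha, hb, hab⟩ _ (List.mem_singleton.2 rfl)
  simp only [inverseTerm, cqViews, List.map_cons, List.map_nil, List.mem_cons,
    true_or, or_true, if_true] at this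
  exact this

theorem usi_const {θ : Dir} {a c : α} (hc : c ∈ C) (ha : a ∈ activeDomain C V J)
    (h : SIHolds θ a c) : Der (.inl (.Usi θ c)) [.const a] := by
  have := LogicDerives.inverse (ws := cqViewNames C n) (def_ := cqViews C V)
    (P := queryDatalog C Q) (D := cqInstance C V J) (.usi θ c)
    (by cases θ <;> simp [cqViewNames, hc])
    (ruleVal a a a []) ⟨a, rfl, ha, h⟩ _ (List.mem_singleton.2 rfl)
  simp only [inverseTerm, cqViews, List.map_cons, List.map_nil, List.mem_cons,
    true_or, if_true] at this
  exact this

theorem mem_transitiveRules_of_head {r : QRule B α} (hr : r ∈ (queryDatalog C Q).rules)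
    (h : r.head.pred = .Utr) : r ∈ transitiveRules C := by
  rcases mem_queryDatalog_rules.1 hr with rfl | hr | hr | hr | hr | hr
  · cases h
  · obtain ⟨p, -, rfl⟩ := List.mem_map.1 hr
    cases h
  · obtain ⟨p, -, hr⟩ := List.mem_flatMap.1 hr
    simp only [List.mem_cons, List.not_mem_nil, or_false] at hr
    rcases hr with rfl | rfl | rfl | rfl <;> cases h
  · rcases List.mem_append.1 hr with hr | hr <;> obtain ⟨p, -, rfl⟩ := List.mem_map.1 hr <;> cases h
  · exact hr
  · rcases List.mem_append.1 hr with hr | hr <;> obtain ⟨p, -, rfl⟩ := List.mem_map.1 hr <;> cases h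

theorem utr_trans (h : Utr x y) (h' : Utr y z) : Utr x z := by
  have key : ∀ p gs, Der p gs → p = .inr .Utr → ∀ x y, gs = [x, y] → Utr y z → Utr x z := by
    intro p gs H
    induction H with
    | inverse w hw h hD a ha => exact fun e => by cases e
    | rule r hr g hb ih =>
      intro e x y hxy hyz
      have hr' := mem_transitiveRules_of_head hr (Sum.inr_injective e)
      clear e
      simp only [transitiveRules, List.mem_append, List.mem_cons, List.not_mem_nil, or_false,
        List.mem_map] at hr'
      rcases hr' with (rfl | rfl) | ⟨p, hp, rfl⟩ <;> cases hxy
      · exact utr_of_u_of_utr (hb _ List.mem_cons_self) hyz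
      · exact utr_of_u_of_utr (hb _ List.mem_cons_self)
          (ih _ (List.mem_cons_of_mem _ List.mem_cons_self) rfl _ _ rfl hyz)
      · obtain ⟨h1, h2, h3⟩ := mem_lePairs.1 hp
        exact utr_of_usi h1 h2 h3 (hb _ List.mem_cons_self)
          (hb _ (List.mem_cons_of_mem _ List.mem_cons_self))
          (ih _ (List.mem_cons_of_mem _ (List.mem_cons_of_mem _ List.mem_cons_self)) rfl _ _ rfl
            hyz)
  exact key _ _ h rfl _ _ rfl h'

theorem utr_const {a b : α} (ha : a ∈ activeDomain C V J) (hb : b ∈ activeDomain C V J)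
    (hab : a ≤ b) : Utr (.const a) (.const b) :=
  utr_of_u (u_const ha hb hab)

/-- A valuation of the transformed view that extends a valuation of the original one. -/
def origVal (h : ℕ → α) : QVar → α
  | .orig x => h x
  | _ => h 0

theorem modelDerives_view {i : Fin n} {h : ℕ → α}
    (hJ : (i, (V i).head.map (Term.eval h)) ∈ J) :
    (∀ a ∈ (V i).body, Der (.inl (.base a.pred)) (a.args.map (skolemize C V i (origVal h)))) ∧
      (∀ x ∈ (V i).bodyVars, ∀ θ, ∀ c ∈ C, AC.Implies (V i).acs (siAC θ (.var x) c) →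
        Der (.inl (.Usi θ c)) [skolemize C V i (origVal h) (.var x)]) ∧
      ∀ x ∈ (V i).bodyVars, ∀ y ∈ (V i).bodyVars, AC.Implies (V i).acs ⟨.var x, .le, .var y⟩ →
        Der (.inl .U)
          [skolemize C V i (origVal h) (.var x), skolemize C V i (origVal h) (.var y)] := by
  have hD : (CQViewName.view i, (cqViews C V (.view i)).head.map (Term.eval (origVal h))) ∈
      cqInstance C V J := by
    rw [map_eval_head_cqViews]
    exact hJ
  have key := (forall_mem_body_cqViews (C := C) (V := V) (i := i) (p := fun a => Der (.inl a.pred)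
    (a.args.map fun t => (inverseTerm (cqViews C V) (.view i) t).ground (origVal h)))).1 fun a ha =>
      LogicDerives.inverse (CQViewName.view i) (by simp [cqViewNames]) (origVal h) hD a ha
  refine ⟨fun a ha => ?_, key.2.1, key.2.2⟩
  have := key.1 a ha
  rw [List.map_map] at this
  exact this

/-- Each comparison `s ≤ t` of terms that the ACs of a view imply is derived. -/
theorem utr_of_implies (hC : ∀ i, ∀ c ∈ (V i).consts, c ∈ C) {i : Fin n} (hV : (V i).WellFormed)
    {h : ℕ → α} (hJ : (i, (V i).head.map (Term.eval h)) ∈ J) {s t : Term ℕ α}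
    (hs : ∀ x ∈ s.vars, x ∈ (V i).bodyVars) (hs' : ∀ c ∈ s.consts, c ∈ (V i).consts)
    (ht : ∀ x ∈ t.vars, x ∈ (V i).bodyVars) (ht' : ∀ c ∈ t.consts, c ∈ (V i).consts)
    (hst : AC.Implies (V i).acs ⟨s, .le, t⟩) :
    Utr (skolemize C V i (origVal h) s) (skolemize C V i (origVal h) t) := by
  obtain ⟨-, h1, h2⟩ := modelDerives_view (C := C) (Q := Q) hJ
  have hrefl : ∀ x ∈ (V i).bodyVars, Utr (skolemize C V i (origVal h) (.var x))
      (skolemize C V i (origVal h) (.var x)) := fun x hx =>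
    utr_of_u (h2 x hx x hx fun _ _ => le_rfl)
  have hadom : ∀ c ∈ (V i).consts, c ∈ activeDomain C V J := fun c hc => Or.inl (hC i c hc)
  rcases s with x | c <;> rcases t with y | d <;> simp only [Term.vars, Term.consts,
    List.mem_singleton, forall_eq, List.not_mem_nil, false_imp_iff, implies_true] at hs hs' ht ht'
  · exact utr_of_u (h2 x hs y ht hst)
  -- A comparison with a constant `d` becomes `U^tr` by the rule for chains through constants,
  -- with `d ≥ d` from the active domain.
  · exact utr_of_usi (hC i d ht') (hC i d ht') le_rfl (h1 x hs .le d (hC i d ht') hst)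
      (usi_const (hC i d ht') (hadom d ht') le_rfl) (utr_const (hadom d ht') (hadom d ht') le_rfl)
  · exact utr_of_usi (hC i c hs') (hC i c hs') le_rfl
      (usi_const (hC i c hs') (hadom c hs') le_rfl) (h1 y ht .ge c (hC i c hs') hst) (hrefl y ht)
  · obtain ⟨v, hv⟩ := hV.consistent
    exact utr_const (hadom c hs') (hadom d ht') (hst v hv)

/-- Only the views `V i` have Skolem terms, as the auxiliary views have no existential variables. -/
theorem isNode_app {f : CQViewName n α × QVar} {l : List α} (h : IsNode C V J (.app f l)) :
    ∃ i x, f = (.view i, .orig x) ∧ x ∈ (V i).bodyVars ∧ .var x ∉ (V i).head ∧ (i, l) ∈ J := by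
  obtain ⟨w, x⟩ := f
  obtain ⟨hf, hl, -⟩ := h
  obtain ⟨-, ⟨a, ha, hxa⟩, hx⟩ := mem_skolemFunctions.1 hf
  cases w with
  | view i =>
    have : ∀ a ∈ (cqViews C V (.view i)).body, ∀ y ∈ a.vars, ∃ z ∈ (V i).bodyVars, y = .orig z := by
      rw [forall_mem_body_cqViews]
      refine ⟨fun a ha y hy => ?_, ?_, ?_⟩
      · obtain ⟨t, ht, hty⟩ := List.mem_map.1 (mem_atom_vars.1 hy)
        cases t with
        | const c => cases hty
        | var z =>
          cases hty
          exact ⟨z, List.mem_flatMap.2 ⟨a, ha, mem_atom_vars.2 ht⟩, rfl⟩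
      · rintro x hx θ c - - y hy
        exact ⟨x, hx, by simpa [Atom.vars, Term.vars] using hy⟩
      · rintro x hx z hz - y hy
        simp only [Atom.vars, Term.vars, List.flatMap_cons, List.flatMap_nil, List.mem_append,
          List.mem_singleton, List.not_mem_nil, or_false] at hy
        rcases hy with rfl | rfl
        exacts [⟨x, hx, rfl⟩, ⟨z, hz, rfl⟩]
    obtain ⟨z, hz, rfl⟩ := this a ha x hxa
    exact ⟨i, z, rfl, hz, fun h => hx (var_mem_head_cqViews.2 h), hl⟩
  | u =>
    exfalso
    simp [cqViews, mem_atom_vars] at ha hxa hx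
    subst ha
    simp at hxa
    tauto
  | usi θ c =>
    exfalso
    simp [cqViews, mem_atom_vars] at ha hxa hx
    subst ha
    simp at hxa
    tauto

theorem utr_refl (hC : ∀ i, ∀ c ∈ (V i).consts, c ∈ C) (hV : ∀ i, (V i).WellFormed)
    {D : Instance B α} (hJ : J ⊆ viewOutput V D) (hx : IsNode C V J x) : Utr x x := by
  cases x with
  | const a => exact utr_const hx hx le_rfl
  | app f l =>
    obtain ⟨i, x, rfl, hxb, hx', hl⟩ := isNode_app hx
    obtain ⟨h, -, -, hlh⟩ := hJ hl
    obtain rfl : l = (V i).head.map (Term.eval h) := hlh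
    have := utr_of_implies (Q := Q) hC (hV i) hl (s := .var x) (t := .var x)
      (by simpa [Term.vars] using hxb) (by simp [Term.consts]) (by simpa [Term.vars] using hxb)
      (by simp [Term.consts]) fun _ _ => le_rfl
    rwa [skolemize_var_of_notMem _ hx'] at this

theorem finite_isNode (hJ : J.Finite) : {g | IsNode C V J g}.Finite := by
  refine (((finite_activeDomain (C := C) (V := V) hJ).image GTerm.const).union
    (((List.finite_toSet (skolemFunctions C V)).prod (hJ.image Prod.snd)).image
      fun p => GTerm.app p.1 p.2)).subset ?_
  rintro (a | ⟨f, l⟩) h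
  · exact Or.inl ⟨a, h, rfl⟩
  · obtain ⟨i, x, -, -, -, hl⟩ := isNode_app h
    exact Or.inr ⟨(f, l), ⟨h.1, ⟨_, hl, rfl⟩⟩, rfl⟩

end Derivations

/-! ### Completeness on finite view instances -/

section Completeness

variable {B α : Type} [LinearOrder α] {n : ℕ} {C : List α} {Q : CQAC B ℕ α}
  {V : Fin n → CQAC B ℕ α} {J : Instance (Fin n) α}

local notation "Der" => QueryDerives C Q V J
local notation "Utr" => UtrDerives C Q V J

/-- The database that a valuation `ν` of the ground terms makes of the derived base facts. -/
def canonicalDatabase (C : List α) (Q : CQAC B ℕ α) (V : Fin n → CQAC B ℕ α)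
    (J : Instance (Fin n) α) (ν : GTerm (CQViewName n α × QVar) α → α) : Instance B α :=
  {f | ∃ gs, QueryDerives C Q V J (.inl (.base f.1)) gs ∧ f.2 = gs.map ν}

/-- A valuation of the ground terms that fixes the constants, is monotone for the derived
comparisons and identifies only terms that are derived to be equal. -/
structure IsGenericValuation (C : List α) (Q : CQAC B ℕ α) (V : Fin n → CQAC B ℕ α)
    (J : Instance (Fin n) α) (ν : GTerm (CQViewName n α × QVar) α → α) : Prop where
  const : ∀ a ∈ activeDomain C V J, ν (.const a) = a
  mono : ∀ x y, UtrDerives C Q V J x y → ν x ≤ ν y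
  inj : ∀ x y, IsNode C V J x → IsNode C V J y → ν x = ν y → UtrDerives C Q V J x y

variable {ν : GTerm (CQViewName n α × QVar) α → α}

/-- Under a generic valuation also the strict comparisons and the inequations of the views hold:
two terms with equal values are derived to be equal, so they have equal values in any database
that yields `J`. -/
theorem subset_viewOutput_canonicalDatabase [Nonempty α] (hC : ∀ i, ∀ c ∈ (V i).consts, c ∈ C)
    (hQ : Q.WellFormed) (hRSI : Q.IsClosedRSI1)
    (hV : ∀ i, (V i).WellFormed) {D : Instance B α} (hJ : J ⊆ viewOutput V D)
    (hν : IsGenericValuation C Q V J ν) : J ⊆ viewOutput V (canonicalDatabase C Q V J ν) := by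
  rintro ⟨i, l⟩ hl
  obtain ⟨-, hacs, hlw⟩ := witness_spec (hJ hl)
  obtain ⟨h, hh⟩ : ∃ h, h = witness V D i l := ⟨_, rfl⟩
  rw [← hh] at hacs hlw
  obtain rfl : l = (V i).head.map (Term.eval h) := hlw
  obtain ⟨h1, -, -⟩ := modelDerives_view (C := C) (Q := Q) hl
  have hP := hasSafeHeads_queryDatalog C hQ
  have hterm : ∀ t : Term ℕ α, (∀ c ∈ t.consts, c ∈ (V i).consts) →
      ν (skolemize C V i (origVal h) t) =
        t.eval fun x => ν (skolemize C V i (origVal h) (.var x)) := by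
    intro t ht
    cases t with
    | var x => rfl
    | const c => exact hν.const c (Or.inl (hC i c (ht c (by simp [Term.consts]))))
  refine ⟨fun x => ν (skolemize C V i (origVal h) (.var x)), fun a ha => ?_, fun a ha => ?_, ?_⟩
  · refine ⟨_, h1 a ha, ?_⟩
    simp only [List.map_map]
    refine List.map_congr_left fun t ht => (hterm t fun c hc => ?_).symm
    simp only [CQAC.consts, List.mem_append, List.mem_flatMap, Atom.consts]
    exact Or.inl (Or.inr ⟨a, ha, t, ht, hc⟩)
  · obtain ⟨s, op, t⟩ := a
    have hsv : ∀ x ∈ s.vars, x ∈ (V i).bodyVars := fun x hx =>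
      (hV i).safe_acs _ ha x (List.mem_append_left _ hx)
    have htv : ∀ x ∈ t.vars, x ∈ (V i).bodyVars := fun x hx =>
      (hV i).safe_acs _ ha x (List.mem_append_right _ hx)
    have hsc : ∀ c ∈ s.consts, c ∈ (V i).consts := fun c hc => by
      simp only [CQAC.consts, List.mem_append, List.mem_flatMap, AC.consts]
      exact Or.inr ⟨_, ha, Or.inl hc⟩
    have htc : ∀ c ∈ t.consts, c ∈ (V i).consts := fun c hc => by
      simp only [CQAC.consts, List.mem_append, List.mem_flatMap, AC.consts]
      exact Or.inr ⟨_, ha, Or.inr hc⟩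
    have hval := value_skolemize (C := C) (origVal h) (hJ hl)
    have hval' : ∀ t, (skolemize C V i (origVal h) t).value V D = t.eval h := by
      intro t
      rw [hval t]
      congr 1
      exact hh.symm
    -- Derived comparisons hold in the given database.
    have hsound : ∀ s t : Term ℕ α, Utr (skolemize C V i (origVal h) s)
        (skolemize C V i (origVal h) t) → s.eval h ≤ t.eval h := by
      intro s t hst
      rw [← hval' s, ← hval' t]
      exact sound_of_modelDerives hRSI.1 hJ hst _ _ rfl
    have hle : AC.Implies (V i).acs ⟨s, .le, t⟩ → Utr (skolemize C V i (origVal h) s)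
        (skolemize C V i (origVal h) t) := utr_of_implies hC (hV i) hl hsv hsc htv htc
    have hge : AC.Implies (V i).acs ⟨t, .le, s⟩ → Utr (skolemize C V i (origVal h) t)
        (skolemize C V i (origVal h) s) := utr_of_implies hC (hV i) hl htv htc hsv hsc
    have hnode : ∀ t : Term ℕ α, (∀ x ∈ t.vars, x ∈ (V i).bodyVars) →
        (∀ c ∈ t.consts, c ∈ (V i).consts) → IsNode C V J (skolemize C V i (origVal h) t) := by
      intro t ht ht'
      exact isNode_of_modelDerives hC hP (utr_of_implies (Q := Q) hC (hV i) hl ht ht' ht ht'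
        fun _ _ => le_rfl) _ List.mem_cons_self
    have hse := hterm s hsc
    have hte := hterm t htc
    have hns := hnode s hsv hsc
    have hnt := hnode t htv htc
    have ha' : AC.Holds h _ := hacs _ ha
    cases op with
    | le =>
      have := hν.mono _ _ (hle fun v hv => hv _ ha)
      rwa [hse, hte] at this
    | lt =>
      have := hν.mono _ _ (hle fun v hv => le_of_lt (hv _ ha))
      refine lt_of_le_of_ne (by rwa [hse, hte] at this) fun e => ?_
      have e' := hν.inj _ _ hnt hns (by rw [hse, hte]; exact e.symm)
      exact absurd (hsound t s e') (not_le.2 ha')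
    | eq =>
      have h1 := hν.mono _ _ (hle fun v hv => le_of_eq (hv _ ha))
      have h2 := hν.mono _ _ (hge fun v hv => ge_of_eq (hv _ ha))
      rw [hse, hte] at h1 h2
      exact le_antisymm h1 h2
    | ne =>
      intro e
      have e1 := hν.inj _ _ hnt hns (by rw [hse, hte]; exact e.symm)
      have e2 := hν.inj _ _ hns hnt (by rw [hse, hte]; exact e)
      exact ha' (le_antisymm (hsound s t e2) (hsound t s e1))
  · refine List.map_congr_left fun t ht => ?_
    cases t with
    | const c => rfl
    | var x =>
      have := skolemize_var_of_mem (C := C) (V := V) (origVal h) ht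
      simp only [Term.eval, this]
      refine (hν.const (h x) (Or.inr ⟨i, _, hl, by simp, ?_⟩)).symm
      exact List.mem_map.2 ⟨_, ht, rfl⟩

/-- An assignment for the variables of the query rule: `g` on the original variables, the arguments
of the matched facts `gs k` on the fresh variables, and the output tuple. -/
def matchVal {T : Type} (d : T) (g : ℕ → T) (gs : ℕ → List T) (o : List T) : QVar → T
  | .orig x => g x
  | .occ k j => (gs k).getD j d
  | .out i => o.getD i d
  | .aux _ => d

/-- A match of the query in the canonical database lifts to a match among the derived facts. -/
theorem exists_lift [Nonempty α] (hCQ : ∀ c ∈ Q.consts, c ∈ C)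
    (hC : ∀ i, ∀ c ∈ (V i).consts, c ∈ C)
    (hQ : Q.WellFormed) (hν : IsGenericValuation C Q V J ν) {h : ℕ → α}
    (hb : ∀ a ∈ Q.body, (a.pred, a.args.map (Term.eval h)) ∈ canonicalDatabase C Q V J ν)
    (ho : ∀ a ∈ Q.head.map (Term.eval h), a ∈ activeDomain C V J) :
    ∃ G : QVar → GTerm (CQViewName n α × QVar) α,
      (outs Q).map (Term.ground G) = (Q.head.map (Term.eval h)).map .const ∧
      (∀ a ∈ coreBody Q, Der a.pred (a.args.map (Term.ground G))) ∧
      ∀ x ∈ Q.bodyVars, IsNode C V J (G (.orig x)) ∧ ν (G (.orig x)) = h x := by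
  have hP := hasSafeHeads_queryDatalog C hQ
  have hgs : ∀ k : ℕ, ∃ gs, ∀ a : Atom B ℕ α, Q.body[k]? = some a →
      Der (.inl (.base a.pred)) gs ∧ a.args.map (Term.eval h) = gs.map ν := by
    intro k
    cases hk : Q.body[k]? with
    | none => exact ⟨[], by simp⟩
    | some a =>
      obtain ⟨gs, hgs⟩ := hb a (List.mem_of_getElem? hk)
      exact ⟨gs, by rintro _ ⟨⟩; exact hgs⟩
  choose gs hgs using hgs
  have hg : ∀ x, ∃ τ, x ∈ Q.bodyVars → IsNode C V J τ ∧ ν τ = h x := by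
    intro x
    by_cases hx : x ∈ Q.bodyVars
    · obtain ⟨a, ha, hxa⟩ := List.mem_flatMap.1 hx
      obtain ⟨k, hk⟩ := List.mem_iff_getElem?.1 ha
      obtain ⟨h1, h2⟩ := hgs k a hk
      have : h x ∈ a.args.map (Term.eval h) := List.mem_map.2 ⟨_, mem_atom_vars.1 hxa, rfl⟩
      rw [h2] at this
      obtain ⟨τ, hτ, e⟩ := List.mem_map.1 this
      exact ⟨τ, fun _ => ⟨isNode_of_modelDerives hC hP h1 τ hτ, e⟩⟩
    · exact ⟨.const (Classical.arbitrary α), fun h => absurd h hx⟩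
  choose g hg using hg
  set t := Q.head.map (Term.eval h) with ht
  let G : QVar → GTerm (CQViewName n α × QVar) α :=
    matchVal (.const (Classical.arbitrary α)) g gs (t.map .const)
  have hterm : ∀ s : Term ℕ α, (∀ x ∈ s.vars, x ∈ Q.bodyVars) → (∀ c ∈ s.consts, c ∈ Q.consts) →
      IsNode C V J ((s.rename .orig).ground G) ∧ ν ((s.rename .orig).ground G) = s.eval h := by
    intro s hs hs'
    cases s with
    | var x => exact hg x (hs x (by simp [Term.vars]))
    | const c =>
      have hc : c ∈ activeDomain C V J := Or.inl (hCQ c (hs' c (by simp [Term.consts])))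
      exact ⟨hc, hν.const c hc⟩
  have heq : ∀ x y, IsNode C V J x → IsNode C V J y → ν x = ν y → Utr x y ∧ Utr y x :=
    fun x y hx hy e => ⟨hν.inj x y hx hy e, hν.inj y x hy hx e.symm⟩
  refine ⟨G, map_ground_outs (by simp [ht]) fun i => rfl, ?_, hg⟩
  rw [forall_mem_coreBody]
  constructor
  · intro k a hk
    obtain ⟨h1, h2⟩ := hgs k a hk
    have hlen : (gs k).length = a.args.length := by simpa using (congrArg List.length h2).symm
    have ha := List.mem_of_getElem? hk
    constructor
    · have : (a.args.zipIdx.map fun q => (.var (.occ k q.2) : Term QVar α)).map (Term.ground G) =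
          gs k := by
        apply List.ext_getElem
        · simp [hlen]
        · intro j _ hj'
          simp [Term.ground, G, matchVal, hj']
      rw [this]
      exact h1
    · intro j s hj
      have hs := List.mem_of_getElem? hj
      obtain ⟨hjl, rfl⟩ := List.getElem?_eq_some_iff.1 hj
      have hG : G (.occ k j) = (gs k)[j] := by simp [G, matchVal, hlen, hjl]
      have h3 := hterm a.args[j] (fun x hx => List.mem_flatMap.2 ⟨a, ha,
        List.mem_flatMap.2 ⟨_, hs, hx⟩⟩) (fun c hc => by
          simp only [CQAC.consts, List.mem_append, List.mem_flatMap, Atom.consts]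
          exact Or.inl (Or.inr ⟨a, ha, _, hs, hc⟩))
      have h4 : IsNode C V J (G (.occ k j)) := by
        rw [hG]
        exact isNode_of_modelDerives hC hP h1 _ (List.getElem_mem _)
      have h5 : ν (G (.occ k j)) = a.args[j].eval h := by
        rw [hG]
        have := List.getElem_of_eq h2 (i := j) (by simpa using hjl)
        rw [List.getElem_map, List.getElem_map] at this
        exact this.symm
      exact heq _ _ h4 h3.1 (h5.trans h3.2.symm)
  · intro j s hj
    have hs := List.mem_of_getElem? hj
    obtain ⟨hjl, rfl⟩ := List.getElem?_eq_some_iff.1 hj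
    have hG : G (.out j) = .const (Q.head[j].eval h) := by
      simp [G, matchVal, ht, hjl]
    have h3 := hterm Q.head[j] (fun x hx => hQ.safe_head _ hs x hx) (fun c hc => by
      simp only [CQAC.consts, List.mem_append, List.mem_flatMap]
      exact Or.inl (Or.inl ⟨_, hs, hc⟩))
    have h4 : Q.head[j].eval h ∈ activeDomain C V J := ho _ (List.mem_map_of_mem hs)
    have h5 : IsNode C V J (G (.out j)) := by rw [hG]; exact h4
    have h6 : ν (G (.out j)) = Q.head[j].eval h := by rw [hG, hν.const _ h4]
    exact heq _ _ h5 h3.1 (h6.trans h3.2.symm)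

theorem not_mem_eraseIdx_of_length_filter_le_one {β : Type} {l : List β} {p : β → Bool}
    (hl : (l.filter p).length ≤ 1) {j : ℕ} {a b : β} (hj : l[j]? = some a) (ha : p a)
    (hb : b ∈ l.eraseIdx j) : ¬ p b := by
  intro hpb
  obtain ⟨hjl, rfl⟩ := List.getElem?_eq_some_iff.1 hj
  have := ((List.getElem_cons_eraseIdx_perm hjl).filter p).length_eq
  rw [List.filter_cons_of_pos ha, List.length_cons] at this
  have hpos := List.length_pos_of_mem (List.mem_filter.2 ⟨hb, hpb⟩)
  omega

variable [DenselyOrdered α] [NoMinOrder α] [NoMaxOrder α] [Nonempty α]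

/-- If `t` is not derived, a valuation exists under which the canonical database does not return
`t`. It satisfies the upper bounds which the facts `J_{≥ a}` for `t` force and exceeds each
constant `b` for which `I_{≤ b}` is not derived. The coupling rules and the rules that combine
`U^tr` with semi-intervals are what makes these bounds consistent. -/
theorem modelDerives_of_certain_of_subset (hCQ : ∀ c ∈ Q.consts, c ∈ C)
    (hC : ∀ i, ∀ c ∈ (V i).consts, c ∈ C) (hQ : Q.WellFormed) (hRSI : Q.IsClosedRSI1)
    (hV : ∀ i, (V i).WellFormed) (hfin : J.Finite) {D : Instance B α} (hJ : J ⊆ viewOutput V D)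
    {t : List α} (htlen : t.length = Q.head.length)
    (ht : ∀ D, J ⊆ viewOutput V D → t ∈ Q.eval D) (hta : ∀ a ∈ t, a ∈ activeDomain C V J) :
    Der (.inr .query) (t.map .const) := by
  classical
  have hP := hasSafeHeads_queryDatalog C hQ
  set o : List (GTerm (CQViewName n α × QVar) α) := t.map .const with ho
  have holen : o.length = Q.head.length := by simp [ho, htlen]
  have hoo : ∀ g ∈ o, Utr g g := by
    intro g hg
    obtain ⟨a, ha, rfl⟩ := List.mem_map.1 hg
    exact utr_const (hta a ha) (hta a ha) le_rfl
  have hsi : ∀ c ∈ siConsts Q, c ∈ C := by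
    intro c hc
    obtain ⟨s, hs, rfl⟩ := List.mem_map.1 hc
    refine hCQ _ ?_
    simp only [CQAC.consts, List.mem_append, List.mem_flatMap]
    refine Or.inr ⟨_, siAC_mem_of_mem_sis hs, ?_⟩
    cases s.dir <;> simp [AC.consts, siAC, Term.consts]
  by_contra hcon
  have hnode : ∀ {x y}, Utr x y → IsNode C V J x ∧ IsNode C V J y := fun h =>
    ⟨isNode_of_modelDerives hC hP h _ (by simp), isNode_of_modelDerives hC hP h _ (by simp)⟩
  have hfinA := finite_activeDomain (C := C) (V := V) hfin
  have hfinN := finite_isNode (C := C) (V := V) hfin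
  -- Where `J_{≥ a}` but not `I_{≥ a}` is derived, the value has to be below `a`; where `I_{≤ b}` is
  -- not derived, the value can be above `b`.
  obtain ⟨ν, h1, h2, -, h3, h4⟩ := exists_valuation_of_bounds (N := GTerm (CQViewName n α × QVar) α)
    (α := α) Utr (fun _ _ _ => utr_trans) .const
    (fun a x => a ∈ siConsts Q ∧ Der (.inr (.J .ge a)) (x :: o) ∧ ¬ Der (.inr (.I .ge a)) (x :: o))
    (fun b x => b ∈ siConsts Q ∧ ¬ Der (.inr (.I .le b)) (x :: o)) hfinA.toFinset ∅
    (fun a ha b hb hab => utr_const (hfinA.mem_toFinset.1 ha) (hfinA.mem_toFinset.1 hb) hab)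
    (fun b a h => sound_of_modelDerives hRSI.1 hJ h _ _ rfl)
    (fun b a x hbx ha => by
      by_contra! hab
      exact ha.2.2 (i_ge_of_j_le ha.1 holen (j_le_of_usi (hsi a ha.1) ha.1 le_rfl holen hoo
        (usi_const (hsi a ha.1) (hnode hbx).1 hab) hbx)))
    (fun b a x hb hxa => by
      by_contra! hab
      exact hb.2 (i_le_of_j_ge_self hb.1 holen (j_ge_of_usi (hsi b hb.1) hb.1 le_rfl holen hoo
        (usi_const (hsi b hb.1) (hnode hxa).2 hab) hxa)))
    (fun b a x y hb hxy ha => by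
      by_contra! hab
      exact hb.2 (i_le_of_j_ge ha.1 hb.1 hab holen ha.2.1 hxy))
    hfinN.toFinset (fun x hx => utr_refl hC hV hJ (hfinN.mem_toFinset.1 hx))
  simp only [Set.Finite.mem_toFinset, Set.mem_ofPred_eq] at h1 h2 h3 h4
  have hν : IsGenericValuation C Q V J ν := ⟨h1,
    fun x y h => (h2 x (hnode h).1 y (hnode h).2).1 h, fun x y hx hy => (h2 x hx y hy).2⟩
  obtain ⟨h, hb, hacs, hth⟩ := ht _ (subset_viewOutput_canonicalDatabase hC hQ hRSI hV hJ hν)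
  obtain ⟨G, hG1, hG2, hG3⟩ := exists_lift hCQ hC hQ hν hb (hth ▸ hta)
  rw [← hth, ← ho] at hG1
  rw [acs_hold_iff_sis hRSI.1] at hacs
  have hmemC : ∀ s ∈ Q.sis, s.const ∈ siConsts Q := fun s hs => List.mem_map_of_mem hs
  have hle : ∀ s ∈ Q.sis, s.dir = .le → Der (.inr (.I s.dir s.const)) (G (.orig s.var) :: o) := by
    intro s hs hd
    by_contra hn
    obtain ⟨h5, h6⟩ := hG3 _ (var_mem_bodyVars_of_mem_sis hQ hs)
    have h7 := hacs s hs
    rw [hd] at hn h7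
    have := h4 _ h5 s.const (Or.inl (hsi _ (hmemC s hs))) ⟨hmemC s hs, hn⟩
    rw [h6] at this
    exact absurd h7 (not_le.2 this)
  by_cases hge : ∀ s ∈ Q.sis, s.dir = .ge → Der (.inr (.I s.dir s.const)) (G (.orig s.var) :: o)
  · refine hcon (query_of_coreBody hG1 hG2 fun s hs => ?_)
    cases hd : s.dir with
    | le => exact hd ▸ hle s hs hd
    | ge => exact hd ▸ hge s hs hd
  · push Not at hge
    obtain ⟨s, hs, hd, hn⟩ := hge
    obtain ⟨j, hj⟩ := List.mem_iff_getElem?.1 hs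
    -- All the other comparisons are left ones, so that the mapping rule fires.
    have hJs := j_of_coreBody hG1 hG2 hj fun s' hs' => by
      refine hle s' (List.mem_of_mem_eraseIdx hs') ?_
      have := not_mem_eraseIdx_of_length_filter_le_one hRSI.2 hj (by simp [hd]) hs'
      cases hd' : s'.dir with
      | le => rfl
      | ge => simp [hd'] at this
    obtain ⟨h5, h6⟩ := hG3 _ (var_mem_bodyVars_of_mem_sis hQ hs)
    have h7 := hacs s hs
    rw [hd] at hn h7 hJs
    have := h3 _ h5 s.const (Or.inl (hsi _ (hmemC s hs))) ⟨hmemC s hs, hJs, hn⟩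
    rw [h6] at this
    exact absurd h7 (not_le.2 this)

/-- On a finite view instance, the logic program derives all certain answers. -/
theorem modelDerives_of_certain (hCQ : ∀ c ∈ Q.consts, c ∈ C)
    (hC : ∀ i, ∀ c ∈ (V i).consts, c ∈ C) (hQ : Q.WellFormed) (hRSI : Q.IsClosedRSI1)
    (hV : ∀ i, (V i).WellFormed) (hfin : J.Finite) {D : Instance B α} (hJ : J ⊆ viewOutput V D)
    {t : List α} (ht : ∀ D, J ⊆ viewOutput V D → t ∈ Q.eval D) :
    Der (.inr .query) (t.map .const) := by
  classical
  have hlen : t.length = Q.head.length := by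
    obtain ⟨h, -, -, rfl⟩ := ht D hJ
    simp
  by_cases hta : ∀ a ∈ t, a ∈ activeDomain C V J
  · exact modelDerives_of_certain_of_subset hCQ hC hQ hRSI hV hfin hJ hlen ht hta
  exfalso
  have hP := hasSafeHeads_queryDatalog C hQ
  have hnode : ∀ {x y}, Utr x y → IsNode C V J x ∧ IsNode C V J y := fun h =>
    ⟨isNode_of_modelDerives hC hP h _ (by simp), isNode_of_modelDerives hC hP h _ (by simp)⟩
  have hfinA := finite_activeDomain (C := C) (V := V) hfin
  have hfinN := finite_isNode (C := C) (V := V) hfin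
  -- A value of `t` outside the active domain is avoided by all ground terms.
  obtain ⟨ν, h1, h2, h3, -, -⟩ := exists_valuation_of_bounds (N := GTerm (CQViewName n α × QVar) α)
    (α := α) Utr (fun _ _ _ => utr_trans) .const (fun _ _ => False) (fun _ _ => False)
    hfinA.toFinset t.toFinset
    (fun a ha b hb hab => utr_const (hfinA.mem_toFinset.1 ha) (hfinA.mem_toFinset.1 hb) hab)
    (fun b a h => sound_of_modelDerives hRSI.1 hJ h _ _ rfl)
    (fun _ _ _ _ h => h.elim) (fun _ _ _ h => h.elim) (fun _ _ _ _ h => h.elim)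
    hfinN.toFinset (fun x hx => utr_refl hC hV hJ (hfinN.mem_toFinset.1 hx))
  simp only [Set.Finite.mem_toFinset, Set.mem_ofPred_eq, List.mem_toFinset] at h1 h2 h3
  have hν : IsGenericValuation C Q V J ν := ⟨h1,
    fun x y h => (h2 x (hnode h).1 y (hnode h).2).1 h, fun x y hx hy => (h2 x hx y hy).2⟩
  obtain ⟨h, hb, -, rfl⟩ := ht _ (subset_viewOutput_canonicalDatabase hC hQ hRSI hV hJ hν)
  refine hta fun a ha => ?_
  obtain ⟨s, hs, rfl⟩ := List.mem_map.1 ha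
  cases s with
  | const c =>
    refine Or.inl (hCQ c ?_)
    simp only [CQAC.consts, List.mem_append, List.mem_flatMap]
    exact Or.inl (Or.inl ⟨_, hs, by simp [Term.consts]⟩)
  | var x =>
    obtain ⟨b, hbb, hxb⟩ := List.mem_flatMap.1 (hQ.safe_head _ hs x (by simp [Term.vars]))
    obtain ⟨gs, hgs, e⟩ := hb b hbb
    have : h x ∈ b.args.map (Term.eval h) := List.mem_map.2 ⟨_, mem_atom_vars.1 hxb, rfl⟩
    rw [show b.args.map (Term.eval h) = gs.map ν from e] at this
    obtain ⟨g, hg, hgx⟩ := List.mem_map.1 this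
    have hgn := isNode_of_modelDerives hC hP hgs g hg
    obtain ⟨c, hc, h5, h6⟩ := h3 g hgn (hgx ▸ ha)
    have : h x = c := by
      rw [← hgx, ← hν.const c hc]
      exact le_antisymm (hν.mono _ _ h5) (hν.mono _ _ h6)
    rw [show (Term.var x).eval h = c from this]
    exact hc

end Completeness

/-! ### Perturbation of valuations -/

section Perturbation

variable {α : Type} [LinearOrder α]

/-- A partial monotone map with finite domain extends to a monotone map. -/
theorem exists_monotone_eq {ι β : Type} [LinearOrder β] [Nonempty β] (T : Finset ι) (f : ι → α)
    (g : ι → β) (h : ∀ s ∈ T, ∀ t ∈ T, f s ≤ f t → g s ≤ g t) :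
    ∃ φ : α → β, Monotone φ ∧ ∀ s ∈ T, φ (f s) = g s := by
  classical
  rcases T.eq_empty_or_nonempty with rfl | hT
  · exact ⟨fun _ => Classical.arbitrary β, fun _ _ _ => le_rfl, by simp⟩
  let L : α → Finset ι := fun x => T.filter fun s => f s ≤ x
  refine ⟨fun x => if hx : (L x).Nonempty then (L x).sup' hx g else T.inf' hT g, ?_, ?_⟩
  · intro x y hxy
    have hsub : L x ⊆ L y := fun s hs => by
      simp only [L, Finset.mem_filter] at hs ⊢
      exact ⟨hs.1, hs.2.trans hxy⟩
    by_cases hx : (L x).Nonempty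
    · simp only [hx, hx.mono hsub, dif_pos]
      exact Finset.sup'_mono _ hsub hx
    · by_cases hy : (L y).Nonempty
      · simp only [hx, hy, dif_pos, dif_neg, not_false_eq_true]
        obtain ⟨s, hs⟩ := hy
        exact (Finset.inf'_le g (Finset.mem_filter.1 hs).1).trans (Finset.le_sup' g hs)
      · simp [hx, hy]
  · intro s hs
    have hsL : s ∈ L (f s) := Finset.mem_filter.2 ⟨hs, le_rfl⟩
    have hL : (L (f s)).Nonempty := ⟨s, hsL⟩
    simp only [hL, dif_pos]
    refine le_antisymm (Finset.sup'_le _ _ fun t ht => ?_) (Finset.le_sup' g hsL)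
    obtain ⟨h1, h2⟩ := Finset.mem_filter.1 ht
    exact h t h1 s hs h2

variable [DenselyOrdered α] [NoMinOrder α] [NoMaxOrder α] [Nonempty α]

/-- If a valuation `v` of some of the variables `U` satisfies all closed comparisons on `U` that `β`
implies, then `β` has a solution which orders the terms over `U` at least as finely as `v` does. -/
theorem exists_solution_refining {X : Type} {β : List (AC X α)} (hβ : AC.Consistent β) (U : Set X)
    (v : X → α) (hv : ∀ s t : Term X α, (∀ x ∈ s.vars, x ∈ U) → (∀ x ∈ t.vars, x ∈ U) →
      AC.Implies β ⟨s, .le, t⟩ → s.eval v ≤ t.eval v)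
    (T : List (Term X α)) (hT : ∀ t ∈ T, ∀ x ∈ t.vars, x ∈ U) :
    ∃ g : X → α, (∀ a ∈ β, a.Holds g) ∧
      ∀ s ∈ T, ∀ t ∈ T, s.eval g ≤ t.eval g → s.eval v ≤ t.eval v := by
  classical
  obtain ⟨v₁, hv₁⟩ := hβ
  let S : Finset (Term X α) := (T ++ β.flatMap fun a => [a.lhs, a.rhs]).toFinset
  let sep : Term X α × Term X α → α := fun p =>
    if h : p.2.eval v < p.1.eval v then (exists_between h).choose else Classical.arbitrary α
  let M : Finset α := (S.toList.flatMap Term.consts).toFinset ∪ (T.product T).toFinset.image sep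
  obtain ⟨ν, h1, h2, -, h3, h4⟩ := exists_valuation_of_bounds (N := Term X α) (α := α)
    (fun s t => AC.Implies β ⟨s, .le, t⟩)
    (fun x y z h h' u hu => le_trans (h u hu) (h' u hu)) .const
    (fun a t => (∀ x ∈ t.vars, x ∈ U) ∧ t.eval v < a)
    (fun b t => (∀ x ∈ t.vars, x ∈ U) ∧ b < t.eval v) M ∅
    (fun a _ b _ hab _ _ => hab) (fun b a h => h v₁ hv₁)
    (fun b a t h ht => (hv (.const b) t (by simp [Term.vars]) ht.1 h).trans_lt ht.2)
    (fun b a t ht h => ht.2.trans_le (hv t (.const a) ht.1 (by simp [Term.vars]) h))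
    (fun b a s t hs h ht => hs.2.trans_le ((hv s t hs.1 ht.1 h).trans ht.2.le))
    S (fun _ _ _ _ => le_rfl)
  let g : X → α := fun x => ν (.var x)
  have hg : ∀ s ∈ S, s.eval g = ν s := by
    intro s hs
    cases s with
    | var x => rfl
    | const c =>
      refine (h1 c (Finset.mem_union_left _ ?_)).symm
      rw [List.mem_toFinset]
      exact List.mem_flatMap.2 ⟨_, Finset.mem_toList.2 hs, by simp [Term.consts]⟩
  refine ⟨g, fun a ha => ?_, fun s hs t ht hst => ?_⟩
  · have hl : a.lhs ∈ S :=
      List.mem_toFinset.2 (List.mem_append_right _ (List.mem_flatMap.2 ⟨a, ha, by simp⟩))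
    have hr : a.rhs ∈ S :=
      List.mem_toFinset.2 (List.mem_append_right _ (List.mem_flatMap.2 ⟨a, ha, by simp⟩))
    have hlr := h2 _ hl _ hr
    have hrl := h2 _ hr _ hl
    have h₁ := hv₁ a ha
    have hall : ∀ u : X → α, (∀ b ∈ β, b.Holds u) → a.Holds u := fun u hu => hu a ha
    obtain ⟨s, op, t⟩ := a
    cases op <;> simp only [AC.Holds] at h₁ hall ⊢ <;> rw [hg _ hl, hg _ hr]
    · exact hlr.1 hall
    · exact lt_of_le_of_ne (hlr.1 fun u hu => (hall u hu).le) fun e =>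
        absurd (hrl.2 e.symm v₁ hv₁) (not_le.2 h₁)
    · exact le_antisymm (hlr.1 fun u hu => (hall u hu).le) (hrl.1 fun u hu => (hall u hu).ge)
    · exact fun e => h₁ (le_antisymm (hlr.2 e v₁ hv₁) (hrl.2 e.symm v₁ hv₁))
  · by_contra! hlt
    -- A separator `d` of the two values forces the values under `g` into the same order.
    have hsep : sep (s, t) = (exists_between hlt).choose := dif_pos hlt
    obtain ⟨hd1, hd2⟩ := (exists_between hlt).choose_spec
    rw [← hsep] at hd1 hd2
    have hdM : sep (s, t) ∈ M := Finset.mem_union_right _ (Finset.mem_image_of_mem _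
      (List.mem_toFinset.2 (List.mem_product.2 ⟨hs, ht⟩)))
    have hsS : s ∈ S := List.mem_toFinset.2 (List.mem_append_left _ hs)
    have htS : t ∈ S := List.mem_toFinset.2 (List.mem_append_left _ ht)
    rw [hg s hsS, hg t htS] at hst
    exact absurd hst (not_le.2 ((h3 t htS _ hdM ⟨hT t ht, hd1⟩).trans
      (h4 s hsS _ hdM ⟨hT s hs, hd2⟩)))

end Perturbation

/-! ### Transfer of derivations -/

section Transfer

/-- The action on ground terms of a map of the constants. -/
def GTerm.map {F α : Type} (φ : α → α) : GTerm F α → GTerm F α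
  | .const c => .const (φ c)
  | .app f l => .app f (l.map φ)

theorem Term.map_eval_of_fixed {X α : Type} {φ : α → α} {l : List (Term X α)}
    (hl : ∀ c, .const c ∈ l → φ c = c) (h : X → α) :
    (l.map (Term.eval h)).map φ = l.map (Term.eval fun x => φ (h x)) := by
  rw [List.map_map]
  refine List.map_congr_left fun t ht => ?_
  cases t with
  | var x => rfl
  | const c => exact hl c ht

theorem Term.map_ground_of_fixed {F X α : Type} {φ : α → α} {l : List (Term X α)}
    (hl : ∀ c, .const c ∈ l → φ c = c) (g : X → GTerm F α) :
    (l.map (Term.ground g)).map (GTerm.map φ) = l.map (Term.ground fun x => (g x).map φ) := by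
  rw [List.map_map]
  refine List.map_congr_left fun t ht => ?_
  cases t with
  | var x => rfl
  | const c => exact congrArg GTerm.const (hl c ht)

variable {B α : Type} {n : ℕ} {C : List α} {Q : CQAC B ℕ α}
  {V : Fin n → CQAC B ℕ α} {J J' : Instance (Fin n) α}

theorem mem_of_const_mem_coreBody (hCQ : ∀ c ∈ Q.consts, c ∈ C) :
    ∀ a ∈ coreBody Q, ∀ c, .const c ∈ a.args → c ∈ C := by
  have key : ∀ (x : QVar) (t : Term ℕ α), (∀ c ∈ t.consts, c ∈ Q.consts) → ∀ c,
      .const c = (.var x : Term QVar α) ∨ .const c = t.rename QVar.orig → c ∈ C := by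
    intro x t ht c hc
    cases t with
    | var y => simp [Term.rename] at hc
    | const d =>
      simp only [reduceCtorEq, Term.rename, Term.const.injEq, false_or] at hc
      exact hCQ c (ht c (by simp [Term.consts, hc]))
  rw [forall_mem_coreBody]
  refine ⟨fun k a hk => ⟨by simp, fun j t hj => ?_⟩, fun j t hj => ?_⟩
  · have := key (.occ k j) t fun c hc => by
      simp only [CQAC.consts, List.mem_append, List.mem_flatMap, Atom.consts]
      exact Or.inl (Or.inr ⟨a, List.mem_of_getElem? hk, t, List.mem_of_getElem? hj, hc⟩)
    simp only [utrAtom, List.mem_cons, List.not_mem_nil, or_false]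
    exact ⟨this, fun c hc => this c hc.symm⟩
  · have := key (.out j) t fun c hc => by
      simp only [CQAC.consts, List.mem_append, List.mem_flatMap]
      exact Or.inl (Or.inl ⟨t, List.mem_of_getElem? hj, hc⟩)
    simp only [utrAtom, List.mem_cons, List.not_mem_nil, or_false]
    exact ⟨this, fun c hc => this c hc.symm⟩

theorem const_notMem_outs {c : α} : .const c ∉ outs Q := by
  rw [mem_outs]; simp

theorem const_notMem_guards {c : α} : ∀ a ∈ guards Q, .const c ∉ a.args := by
  intro a ha
  obtain ⟨t, ht, rfl⟩ := List.mem_map.1 ha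
  obtain ⟨i, -, rfl⟩ := mem_outs.1 ht
  simp [utrAtom]

theorem map_mem_activeDomain {φ : α → α} (hφC : ∀ c ∈ C, φ c = c)
    (hJ : ∀ i l, (i, l) ∈ J → (i, l.map φ) ∈ J') {a : α} (ha : a ∈ activeDomain C V J) :
    φ a ∈ activeDomain C V J' := by
  rcases ha with h | ⟨i, l, h, hl, ha⟩
  · exact Or.inl (by rwa [hφC a h])
  · exact Or.inr ⟨i, _, hJ i l h, by simpa using hl, List.mem_map_of_mem ha⟩

variable [LinearOrder α]

theorem mem_of_const_mem_queryDatalog (hCQ : ∀ c ∈ Q.consts, c ∈ C) {r : QRule B α}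
    (hr : r ∈ (queryDatalog C Q).rules) : ∀ a ∈ r.body, ∀ c, .const c ∈ a.args → c ∈ C := by
  have hcore := mem_of_const_mem_coreBody hCQ
  have hsi : ∀ s : SI ℕ α, ∀ c, .const c ∈ (siSubgoal Q s).args → c ∈ C := by
    intro s c hc
    simp [siSubgoal, asSubgoal, iAtom, const_notMem_outs] at hc
  rcases mem_queryDatalog_rules.1 hr with rfl | hr | hr | hr | hr | hr
  · intro a ha
    rcases List.mem_append.1 ha with ha | ha
    · exact hcore a ha
    · obtain ⟨s, -, rfl⟩ := List.mem_map.1 ha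
      exact hsi s
  · obtain ⟨p, -, rfl⟩ := List.mem_map.1 hr
    intro a ha
    rcases List.mem_append.1 ha with ha | ha
    · exact hcore a ha
    · obtain ⟨s, -, rfl⟩ := List.mem_map.1 ha
      exact hsi s
  · obtain ⟨p, -, hr⟩ := List.mem_flatMap.1 hr
    simp only [List.mem_cons, List.not_mem_nil, or_false] at hr
    rcases hr with rfl | rfl | rfl | rfl <;>
      simp [asSubgoal, jAtom, utrAtom, vX, vY, const_notMem_outs]
  · rcases List.mem_append.1 hr with hr | hr <;> obtain ⟨p, -, rfl⟩ := List.mem_map.1 hr <;>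
      simp only [List.forall_mem_cons] <;>
      exact ⟨by simp [vX], fun a ha c hc => absurd hc (const_notMem_guards a ha)⟩
  · simp only [transitiveRules, List.mem_append, List.mem_cons, List.not_mem_nil, or_false,
      List.mem_map] at hr
    rcases hr with (rfl | rfl) | ⟨p, -, rfl⟩ <;> simp [utrAtom, vX, vY, vZ]
  · rcases List.mem_append.1 hr with hr | hr <;> obtain ⟨p, -, rfl⟩ := List.mem_map.1 hr <;>
      simp only [List.forall_mem_cons] <;>
      exact ⟨by simp [vY], by simp [utrAtom, vX, vY],
        fun a ha c hc => absurd hc (const_notMem_guards a ha)⟩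

/-- Derivations are preserved by monotone maps that fix the constants of the query and the
views. -/
theorem QueryDerives.map (hCQ : ∀ c ∈ Q.consts, c ∈ C) (hC : ∀ i, ∀ c ∈ (V i).consts, c ∈ C)
    (hQ : Q.WellFormed) {φ : α → α} (hφ : Monotone φ) (hφC : ∀ c ∈ C, φ c = c)
    (hJ : ∀ i l, (i, l) ∈ J → (i, l.map φ) ∈ J') {p : ExtPred B α ⊕ QIdb α}
    {gs : List (GTerm (CQViewName n α × QVar) α)} (H : QueryDerives C Q V J p gs) :
    QueryDerives C Q V J' p (gs.map (GTerm.map φ)) := by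
  have hadom : ∀ a ∈ activeDomain C V J, φ a ∈ activeDomain C V J' := fun a =>
    map_mem_activeDomain hφC hJ
  induction H with
  | inverse w hw h hD a ha =>
    have hhead : ∀ c, .const c ∈ (cqViews C V w).head → φ c = c := by
      intro c hc
      refine hφC c ?_
      cases w with
      | view i =>
        obtain ⟨t, ht, htc⟩ := List.mem_map.1 hc
        cases t with
        | var x => cases htc
        | const d =>
          cases htc
          refine hC i c ?_
          simp only [CQAC.consts, List.mem_append, List.mem_flatMap]
          exact Or.inl (Or.inl ⟨_, ht, by simp [Term.consts]⟩)
      | u => simp [cqViews] at hc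
      | usi θ c => simp [cqViews] at hc
    have hD' : (w, ((cqViews C V w).head.map (Term.eval h)).map φ) ∈ cqInstance C V J' := by
      generalize (cqViews C V w).head.map (Term.eval h) = l at hD
      cases w with
      | view i => exact hJ i l hD
      | u =>
        obtain ⟨a, b, rfl, ha, hb, hab⟩ := hD
        exact ⟨_, _, rfl, hadom a ha, hadom b hb, hφ hab⟩
      | usi θ c =>
        obtain ⟨a, rfl, ha, hac⟩ := hD
        have hc : φ c = c := hφC c (by
          simp only [cqViewNames, List.mem_append, List.mem_map] at hw
          grind)
        refine ⟨_, rfl, hadom a ha, ?_⟩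
        rw [← hc]
        cases θ <;> exact hφ hac
    rw [Term.map_eval_of_fixed hhead] at hD'
    have := LogicDerives.inverse (P := queryDatalog C Q) w hw _ hD' a ha
    convert this using 1
    rw [List.map_map]
    refine List.map_congr_left fun t ht => ?_
    cases t with
    | const c => exact congrArg GTerm.const (hφC c (mem_of_const_mem_cqViews hC ha ht))
    | var x =>
      simp only [Function.comp_apply, inverseTerm]
      split
      · rfl
      · exact congrArg (GTerm.app _) (Term.map_eval_of_fixed hhead h)
  | rule r hr g hb ih =>
    rw [Term.map_ground_of_fixed]
    · refine LogicDerives.rule r hr _ fun a ha => ?_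
      have := ih a ha
      rwa [Term.map_ground_of_fixed fun c hc =>
        hφC c (mem_of_const_mem_queryDatalog hCQ hr a ha c hc)] at this
    · intro c hc
      obtain ⟨⟨x, hx⟩, -⟩ := hasSafeHeads_queryDatalog C hQ r hr _ hc
      cases hx

end Transfer

/-! ### Derivations from finite instances -/

section Finite

variable {E I X α : Type} [LinearOrder α] {P : DatalogAC E I X α} {D D' : Instance E α}

theorem DatalogAC.Derives.mono (hD : D ⊆ D') {i : I} {t : List α} (H : P.Derives D i t) :
    P.Derives D' i t := by
  induction H with
  | fire r hr h hE _ hAC ih => exact .fire r hr h (fun e args he => hD (hE e args he)) ih hAC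

/-- A derivation uses only finitely many facts. -/
theorem DatalogAC.Derives.exists_finite {i : I} {t : List α} (H : P.Derives D i t) :
    ∃ D' ⊆ D, D'.Finite ∧ P.Derives D' i t := by
  induction H with
  | fire r hr h hE _ hAC ih =>
    have key : ∀ a : Atom (E ⊕ I) X α, ∃ D' ⊆ D, D'.Finite ∧ (a ∈ r.body → match a.pred with
        | .inl e => (e, a.args.map (Term.eval h)) ∈ D'
        | .inr i => P.Derives D' i (a.args.map (Term.eval h))) := by
      intro a
      by_cases ha : a ∈ r.body
      · obtain ⟨e | i, args⟩ := a
        · exact ⟨{(e, args.map (Term.eval h))}, by simpa using hE e args ha, Set.finite_singleton _,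
            fun _ => rfl⟩
        · obtain ⟨D', h1, h2, h3⟩ := ih i args ha
          exact ⟨D', h1, h2, fun _ => h3⟩
      · exact ⟨∅, Set.empty_subset _, Set.finite_empty, fun h => absurd h ha⟩
    choose F hF1 hF2 hF3 using key
    refine ⟨⋃ a ∈ {a | a ∈ r.body}, F a, Set.iUnion₂_subset fun a _ => hF1 a,
      (List.finite_toSet r.body).biUnion fun a _ => hF2 a, ?_⟩
    have hsub : ∀ a ∈ r.body, F a ⊆ ⋃ a ∈ {a | a ∈ r.body}, F a := fun a ha =>
      Set.subset_biUnion_of_mem (u := F) (show a ∈ {a | a ∈ r.body} from ha)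
    exact .fire r hr h (fun e args he => hsub _ he (hF3 _ he))
      (fun i args hi => (hF3 _ hi).mono (hsub _ hi)) hAC

end Finite

/-! ### The maximally contained rewriting -/

section Main

variable {B α : Type} {n : ℕ}

theorem consts_subset_relevantConsts (Q : CQAC B ℕ α) (V : Fin n → CQAC B ℕ α) (i : Fin n) :
    ∀ c ∈ (V i).consts, c ∈ relevantConsts Q V := fun _ hc =>
  List.mem_append_right _ (List.mem_flatMap.2 ⟨i, List.mem_finRange i, hc⟩)

theorem consts_subset_relevantConsts_query (Q : CQAC B ℕ α) (V : Fin n → CQAC B ℕ α) :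
    ∀ c ∈ Q.consts, c ∈ relevantConsts Q V := fun _ hc => List.mem_append_left _ hc

variable [LinearOrder α]

/-- The database that a valuation makes of the view-expansion yields the image of the rewriting. -/
theorem image_subset_viewOutput {V : Fin n → CQAC B ℕ α} {R : CQAC (Fin n) ℕ α}
    (hR : IsCQACRewriting V R) {g : ℕ ⊕ ℕ × ℕ → α} (hg : ∀ a ∈ (viewExpansion V R).acs, a.Holds g) :
    {f | ∃ a ∈ R.body, f = (a.pred, a.args.map (Term.eval fun x => g (.inl x)))} ⊆
      viewOutput V
        {f | ∃ b ∈ (viewExpansion V R).body, f = (b.pred, b.args.map (Term.eval g))} := by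
  rintro _ ⟨a, ha, rfl⟩
  obtain ⟨k, hk⟩ := List.mem_iff_getElem?.1 ha
  have hak : (a, k) ∈ R.body.zipIdx := List.mem_zipIdx_iff_getElem?.2 hk
  refine ⟨fun x => g (.inr (k, x)), fun b hb => ?_, fun b hb => ?_, ?_⟩
  · refine ⟨_, List.mem_flatMap.2 ⟨(a, k), hak, List.mem_map_of_mem hb⟩, ?_⟩
    simp only [Atom.rename, Term.map_eval_map_rename]
  · have := hg _ (List.mem_append_right _ (List.mem_flatMap.2 ⟨(a, k), hak,
      List.mem_append_left _ (List.mem_map_of_mem hb)⟩))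
    obtain ⟨s, op, t⟩ := b
    cases op <;> simpa only [AC.Holds, AC.rename, Term.eval_rename] using this
  · have hlen := hR.2 a ha
    apply List.ext_getElem
    · simpa using hlen
    · intro j h1 h2
      simp only [List.length_map] at h1 h2
      have := hg _ (List.mem_append_right _ (List.mem_flatMap.2 ⟨(a, k), hak,
        List.mem_append_right _ (List.mem_iff_getElem.2 ⟨j, by simpa using ⟨h1, h2⟩, rfl⟩)⟩))
      simpa only [List.getElem_zipWith, AC.Holds, Term.eval_rename, List.getElem_map] using this

theorem isContainedRewriting_mcrRSI1 [Nonempty α] {Q : CQAC B ℕ α} {V : Fin n → CQAC B ℕ α}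
    (hRSI1 : Q.IsClosedRSI1) :
    IsContainedRewriting V Q (mcrRSI1 Q V).eval := by
  intro J D hJ t ht
  have := sound_of_modelDerives hRSI1.1 hJ (modelDerives_of_mem_eval ht)
  rw [List.map_map] at this
  change t.map id ∈ Q.eval D at this
  rwa [List.map_id] at this

variable [DenselyOrdered α] [NoMinOrder α] [NoMaxOrder α] [Nonempty α]

/-- A match `h` of the rectified `R` need not extend to a valuation of the expansion, since
inequations such as `x ≤ y ≤ z`, `y ≠ w` have a projection that no conjunction of comparisons
defines. But `h` satisfies all implied closed comparisons, so it is the monotone image of a match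
that does extend, and derivations are preserved by monotone maps. -/
theorem rectifiedEval_subset {Q : CQAC B ℕ α} {V : Fin n → CQAC B ℕ α}
    (hQ : Q.WellFormed) (hRSI1 : Q.IsClosedRSI1) (hV : ∀ i, (V i).WellFormed)
    {R : CQAC (Fin n) ℕ α} (hR : IsCQACRewriting V R) (hRQ : IsContainedRewriting V Q R.eval)
    (J : Instance (Fin n) α) : rectifiedEval V R J ⊆ (mcrRSI1 Q V).eval J := by
  classical
  rintro _ ⟨h, hbody, -, hrect, rfl⟩
  have hC := consts_subset_relevantConsts Q V
  have hCQ := consts_subset_relevantConsts_query Q V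
  set C := relevantConsts Q V with hCdef
  -- An inconsistent expansion implies `c ≠ c`, which no valuation satisfies.
  have hcons : AC.Consistent (viewExpansion V R).acs := by
    by_contra hn
    let c : α := Classical.arbitrary α
    exact hrect ⟨.const c, .ne, .const c⟩ (fun u hu => absurd ⟨u, hu⟩ hn) rfl
  let v : ℕ ⊕ ℕ × ℕ → α := Sum.elim h fun _ => Classical.arbitrary α
  have hleft : ∀ s : Term (ℕ ⊕ ℕ × ℕ) α, (∀ x ∈ s.vars, x ∈ {x | x.isLeft = true}) →
      ∃ s' : Term ℕ α, s = s'.rename Sum.inl := by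
    rintro (x | c) hs
    · obtain ⟨y, rfl⟩ := Sum.isLeft_iff.1 (hs x (by simp [Term.vars]))
      exact ⟨.var y, rfl⟩
    · exact ⟨.const c, rfl⟩
  -- `φ` has to respect all terms of `R`, and to fix the constants of the algorithm.
  let T : List (Term ℕ α) := R.head ++ R.body.flatMap Atom.args ++ C.map .const
  obtain ⟨g, hg, hgT⟩ := exists_solution_refining hcons {x | x.isLeft = true} v (by
      intro s t hs ht hst
      obtain ⟨s, rfl⟩ := hleft s hs
      obtain ⟨t, rfl⟩ := hleft t ht
      rw [Term.eval_rename, Term.eval_rename]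
      exact hrect ⟨s, .le, t⟩ hst) (T.map (Term.rename Sum.inl)) (by
      intro t ht x hx
      obtain ⟨s, -, rfl⟩ := List.mem_map.1 ht
      cases s with
      | var y => simp [Term.rename, Term.vars] at hx; subst hx; rfl
      | const c => simp [Term.rename, Term.vars] at hx)
  set g' : ℕ → α := fun x => g (.inl x) with hg'
  obtain ⟨φ, hφ, hφT⟩ := exists_monotone_eq T.toFinset (fun s => s.eval g') (fun s => s.eval h) (by
    intro s hs t ht hst
    have := hgT _ (List.mem_map_of_mem (List.mem_toFinset.1 hs)) _
      (List.mem_map_of_mem (List.mem_toFinset.1 ht))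
    simp only [Term.eval_rename] at this
    exact this hst)
  simp only [List.mem_toFinset] at hφT
  have hφC : ∀ c ∈ C, φ c = c := fun c hc => hφT (.const c)
    (List.mem_append_right _ (List.mem_map_of_mem hc))
  have hφl : ∀ l : List (Term ℕ α), (∀ s ∈ l, s ∈ T) →
      (l.map (Term.eval g')).map φ = l.map (Term.eval h) := by
    intro l hl
    rw [List.map_map]
    exact List.map_congr_left fun s hs => hφT s (hl s hs)
  let J' : Instance (Fin n) α := {f | ∃ a ∈ R.body, f = (a.pred, a.args.map (Term.eval g'))}
  have hJ'fin : J'.Finite := by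
    refine ((List.finite_toSet R.body).image fun a => (a.pred, a.args.map (Term.eval g'))).subset ?_
    rintro _ ⟨a, ha, rfl⟩
    exact ⟨a, ha, rfl⟩
  have hJ'V := image_subset_viewOutput hR hg
  have hmem : R.head.map (Term.eval g') ∈ R.eval J' := by
    refine ⟨g', fun a ha => ⟨a, ha, rfl⟩, fun a ha => ?_, rfl⟩
    have := hg _ (List.mem_append_left _ (List.mem_map_of_mem ha))
    obtain ⟨s, op, t⟩ := a
    cases op <;> simpa only [AC.Holds, AC.rename, Term.eval_rename] using this
  have hder := modelDerives_of_certain hCQ hC hQ hRSI1 hV hJ'fin hJ'V fun D hD => hRQ J' D hD hmem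
  have hlen : (R.head.map (Term.eval h)).length = Q.head.length := by
    obtain ⟨u, -, -, hu⟩ := hRQ J' _ hJ'V hmem
    simpa using congrArg List.length hu
  have hder' := QueryDerives.map (J' := J) hCQ hC hQ hφ hφC (by
    rintro _ _ ⟨a, ha, e⟩
    cases e
    rw [hφl _ fun s hs => List.mem_append_left _ (List.mem_append_right _
      (List.mem_flatMap.2 ⟨a, ha, hs⟩))]
    exact hbody a ha) hder
  have hmap : ((R.head.map (Term.eval g')).map (GTerm.const (F := CQViewName n α × QVar))).map
      (GTerm.map φ) = (R.head.map (Term.eval h)).map .const := by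
    rw [← hφl R.head fun s hs => List.mem_append_left _ (List.mem_append_left _ hs)]
    simp only [List.map_map]
    rfl
  rw [hmap] at hder'
  have := mem_eval_of_modelDerives hC (hasSafeHeads_queryDatalog C hQ) hder'
  rw [hlen] at this
  exact this

/-- A derivation of a contained rewriting uses finitely many view tuples, and what it derives is a
certain answer for these. -/
theorem eval_subset_of_isContainedRewriting {Q : CQAC B ℕ α} {V : Fin n → CQAC B ℕ α}
    (hQ : Q.WellFormed) (hRSI1 : Q.IsClosedRSI1) (hV : ∀ i, (V i).WellFormed) {I X : Type}
    {P : DatalogAC (Fin n) I X α} (hP : IsContainedRewriting V Q P.eval)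
    {J : Instance (Fin n) α} {D : Instance B α} (hJ : J ⊆ viewOutput V D) :
    P.eval J ⊆ (mcrRSI1 Q V).eval J := by
  intro t ht
  have hC := consts_subset_relevantConsts Q V
  obtain ⟨J', hJ', hfin, hder⟩ := DatalogAC.Derives.exists_finite ht
  have hmod := modelDerives_of_certain (consts_subset_relevantConsts_query Q V) hC hQ hRSI1 hV hfin
    (hJ'.trans hJ) fun D hD => hP J' D hD hder
  have hlen : t.length = Q.head.length := by
    obtain ⟨u, -, -, rfl⟩ := hP J D hJ ht
    simp
  have := mem_eval_of_modelDerives hC (hasSafeHeads_queryDatalog _ hQ) hmod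
  rw [hlen] at this
  exact DatalogAC.Derives.mono hJ' this

end Main

theorem mainTheorem4 {B α : Type} [LinearOrder α] [DenselyOrdered α] [NoMinOrder α] [NoMaxOrder α]
    [Nonempty α] {n : ℕ} (Q : CQAC B ℕ α) (V : Fin n → CQAC B ℕ α)
    (hQ : Q.WellFormed) (hRSI1 : Q.IsClosedRSI1) (hV : ∀ i, (V i).WellFormed) :
    IsDatalogACRewriting V (mcrRSI1 Q V) ∧
    IsContainedRewriting V Q (mcrRSI1 Q V).eval ∧
    (∀ (I X : Type) (P : DatalogAC (Fin n) I X α), IsDatalogACRewriting V P →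
      IsContainedRewriting V Q P.eval →
      ∀ (J : Instance (Fin n) α) (D : Instance B α), J ⊆ viewOutput V D →
        P.eval J ⊆ (mcrRSI1 Q V).eval J) ∧
    (∀ R : CQAC (Fin n) ℕ α, IsCQACRewriting V R → IsContainedRewriting V Q R.eval →
      ∀ J : Instance (Fin n) α, rectifiedEval V R J ⊆ (mcrRSI1 Q V).eval J) :=

  ⟨isDatalogACRewriting_rewritingOf _ V (hasSafeHeads_queryDatalog _ hQ) _,
    isContainedRewriting_mcrRSI1 hRSI1,
    fun _ _ _ _ hP _ _ hJ => eval_subset_of_isContainedRewriting hQ hRSI1 hV hP hJ,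
    fun _ hR hRQ J => rectifiedEval_subset hQ hRSI1 hV hR hRQ J⟩
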